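/- A (finitary) polynomial endofunctor $P$ is given by a diagram of groupoids $I \xleftarrow{s} E \xrightarrow{p} B \xrightarrow{t} I$ in which all homotopy fibres $E_b$ of $p$ are discrete with finitely many isomorphism classes; $|E_b|$ is the arity of the operation $b\in B$. Assume that no operation has arity $0$ or $1$, and that for every $i\in I$ and $n\in\mathbb N$ the groupoid of $n$-ary operations in the homotopy fibre $B_i$ of $t$ over $i$ is finite (finitely many isomorphism classes, finite automorphism groups). The cardinality of a finite groupoid $G$ is $|G|=\sum_{x\in\pi_0 G} 1/|\mathrm{Aut}(x)|\in\mathbb Q$. An operadic tree is a diagram of finite sets $A\xleftarrow{s}M\xrightarrow{p}N\xrightarrow{t}A$ (edges, nodes with a marked input edge, nodes) with $t$ injective, with $s$ injective with a single edge (the root) outside its image, and such that the walk $s(m)\mapsto t(p(m))$ leads from every edge to the root; the leaves are the edges not in the image of $t$. A $P$-tree is such a tree with a map of diagrams to $I\leftarrow E\to B\to I$ whose squares commute up to specified isomorphisms and whose middle square is a homotopy pullback; $P$-trees and their isomorphisms form a groupoid $\mathbf T_P$, lying over $I$ by the decoration of the root edge. The core of a $P$-tree is the combinatorial rooted tree formed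 by its nodes and inner edges. Let $\mathcal H_{\mathrm{CK}}$ be the Connes–Kreimer Hopf algebra over $\mathbb Q$ (as an algebra, the free commutative algebra on isomorphism classes of nonempty finite combinatorial rooted trees), and let $B_+$ be the linear operator grafting the trees of a forest onto a new root, extended coefficientwise to $\mathcal H_{\mathrm{CK}}[[\alpha]]$. **Theorem.** (1) The Bergbauer–Kreimer system corresponding to $X\simeq 1+P(X)$, $$X_i \;=\; 1+\sum_{b\in\pi_0 B_i}\frac{1}{|\mathrm{Aut}_{B_i}(b)|}\,\alpha^{|E_b|-1}\,B_+\Big(\prod_{e\in E_b}X_{s(e)}\Big)\qquad (i\in I),$$ has a unique solution $X_i=\sum_k c_{k,i}\,\alpha^k\in\mathcal H_{\mathrm{CK}}[[\alpha]]$. For every $i\in I$, $k\ge 0$ and combinatorial tree $\tau$, the groupoid of $P$-trees with root colour identified with $i$ (homotopy fibre of $\mathbf T_P\to I$ over $i$), with $k+1$ leaves and with core isomorphic to $\tau$, is finite, and its cardinality is the coefficient of $\tau$ in $c_{k,i}$. (2) In particular, if $P$ is a polynomial endofunctor in one variable ($I$ is contractible), then the groupoid $B_{n}$ of $n$-ary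 operations is finite for every $n$, the Bergbauer–Kreimer equation $$X \;=\; 1+\sum_{n\ge 1} w_n\,\alpha^n\,B_+(X^{n+1}),\qquad w_n=|B_{n+1}|,$$ has a unique solution $X=\sum_k c_k\,\alpha^k\in\mathcal H_{\mathrm{CK}}[[\alpha]]$, and for all $k\ge 0$ and every combinatorial tree $\tau$ the coefficient of $\tau$ in $c_k$ is the (finite) groupoid cardinality of the groupoid of $P$-trees with $k+1$ leaves and core isomorphic to $\tau$. -/

import Mathlib

open CategoryTheory

universe u v

noncomputable section

/-! ## Groupoid cardinality -/

/-- The set `π₀ C` of isomorphism classes of objects of a category (usually a groupoid). -/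
def PiZero (C : Type u) [Category.{v} C] : Type u :=
  Quotient (isIsomorphicSetoid C)

/-- A chosen object in an isomorphism class. -/
def PiZero.rep {C : Type u} [Category.{v} C] (x : PiZero C) : C :=
  Quotient.out x

/-- A (homotopy) finite groupoid: finitely many isomorphism classes, and all automorphism groups
finite. -/
def IsFiniteGroupoid (C : Type u) [Category.{v} C] : Prop :=
  Finite (PiZero C) ∧ ∀ x : C, Finite (Aut x)

/-- Groupoid (homotopy) cardinality `∑_{x ∈ π₀ C} 1 / |Aut x|` of a finite groupoid. -/
def groupoidCard (C : Type u) [Category.{v} C] : ℚ :=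
  ∑ᶠ x : PiZero C, (1 : ℚ) / (Nat.card (Aut x.rep) : ℚ)

/-! ## Operadic trees -/

/-- A finite rooted tree with open-ended edges (leaves and root): a diagram of finite sets
`A ← M → N → A` (edges, nodes with a marked input edge, nodes), with `t` (output edge of a node)
injective, `s` injective with complement the single edge `root`, and such that walking
`s m ↦ t (p m)` from any edge eventually leads to the root. -/
structure OpTree where
  A : Type
  M : Type
  N : Type
  finA : Finite A
  finM : Finite M
  finN : Finite N
  s : M → A
  p : M → N
  t : N → A
  t_inj : Function.Injective t
  s_inj : Function.Injective s
  root : A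
  not_mem_range_s : ∀ a, a ∉ Set.range s ↔ a = root
  walk : ∀ a, Relation.ReflTransGen (fun x y => ∃ m, s m = x ∧ t (p m) = y) a root

/-- The number of leaves: edges that are not the output edge of any node. -/
def OpTree.numLeaves (T : OpTree) : ℕ :=
  Nat.card {a : T.A // a ∉ Set.range T.t}

/-! ## Combinatorial trees and the Connes–Kreimer algebra -/

/-- A (nonempty, finite) combinatorial rooted tree, encoded by its parent function; by convention
the root is its own parent. -/
structure CombTree where
  V : Type
  finV : Finite V
  root : V
  parent : V → V
  parent_root : parent root = root
  walk : ∀ v, ∃ k : ℕ, parent^[k] v = root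

namespace CombTree

/-- Isomorphism of combinatorial trees. -/
def IsIso (S T : CombTree) : Prop :=
  ∃ e : S.V ≃ T.V, e S.root = T.root ∧ ∀ v, e (S.parent v) = T.parent (e v)

instance setoid : Setoid CombTree where
  r := IsIso
  iseqv :=
    { refl := fun _ => ⟨Equiv.refl _, rfl, fun _ => rfl⟩
      symm := by
        rintro S T ⟨e, h₀, h⟩
        refine ⟨e.symm, by rw [← h₀, Equiv.symm_apply_apply], fun v => ?_⟩
        apply e.injective
        rw [h, Equiv.apply_symm_apply, Equiv.apply_symm_apply]
      trans := by
        rintro S T U ⟨e, h₀, h⟩ ⟨f, k₀, k⟩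
        refine ⟨e.trans f, ?_, fun v => ?_⟩
        · rw [Equiv.trans_apply, h₀, k₀]
        · rw [Equiv.trans_apply, h, k, Equiv.trans_apply] }

open Classical in
/-- The parent function of the tree obtained by grafting a family of trees onto a new root `none`:
the roots of the given trees become children of the new root. -/
def graftParent {ι : Type} (F : ι → CombTree) :
    Option (Σ i, (F i).V) → Option (Σ i, (F i).V)
  | none => none
  | some ⟨i, v⟩ => if v = (F i).root then none else some ⟨i, (F i).parent v⟩

/-- Grafting a finite family of trees onto a new root node. -/
def graft {ι : Type} [Finite ι] (F : ι → CombTree) : CombTree where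
  V := Option (Σ i, (F i).V)
  finV := by
    have : ∀ i, Finite (F i).V := fun i => (F i).finV
    infer_instance
  root := none
  parent := graftParent F
  parent_root := rfl
  walk := by
    have key : ∀ (k : ℕ) (i : ι) (v : (F i).V), ((F i).parent^[k] v = (F i).root) →
        ∃ l : ℕ, (graftParent F)^[l] (some ⟨i, v⟩) = none := by
      intro k
      induction k with
      | zero =>
        intro i v hv
        refine ⟨1, ?_⟩
        have hv' : v = (F i).root := hv
        simp [graftParent, hv']
      | succ k ih =>
        intro i v hv
        by_cases h : v = (F i).root
        · exact ⟨1, by simp [graftParent, h]⟩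
        · obtain ⟨l, hl⟩ := ih i ((F i).parent v) hv
          refine ⟨l + 1, ?_⟩
          rw [Function.iterate_succ_apply]
          simpa [graftParent, h] using hl
    rintro (_ | ⟨i, v⟩)
    · exact ⟨0, rfl⟩
    · obtain ⟨k, hk⟩ := (F i).walk v
      exact key k i v hk

end CombTree

/-- Isomorphism classes of combinatorial trees. -/
def CombTreeClass : Type 1 := Quotient CombTree.setoid

/-- The isomorphism class of a combinatorial tree. -/
def CombTree.cls (τ : CombTree) : CombTreeClass := Quotient.mk _ τ

/-- The underlying algebra of the Connes–Kreimer Hopf algebra: the free commutative `ℚ`-algebra on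
isomorphism classes of combinatorial trees.  Its monomials are the forests. -/
abbrev HCK : Type 1 := MvPolynomial CombTreeClass ℚ

/-- The tree obtained by grafting all the trees of a forest (with multiplicities) onto a new root.
The auxiliary order of the list does not affect the isomorphism class. -/
def graftForest (m : CombTreeClass →₀ ℕ) : CombTreeClass :=
  (CombTree.graft (fun j : Fin (Finsupp.toMultiset m).toList.length =>
    Quotient.out ((Finsupp.toMultiset m).toList.get j))).cls

/-- The `B₊`-operator: the linear map sending a forest to the tree obtained by grafting. -/
def Bplus : HCK →ₗ[ℚ] HCK :=
  (MvPolynomial.basisMonomials CombTreeClass ℚ).constr ℚ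
    (fun m => MvPolynomial.X (graftForest m))

/-- `B₊` extended coefficientwise to `H_CK[[α]]`. -/
def BplusSeries (Y : PowerSeries HCK) : PowerSeries HCK :=
  PowerSeries.mk fun k => Bplus (PowerSeries.coeff k Y)

/-! ## Polynomial endofunctors over groupoids -/

/-- A polynomial endofunctor, given by a diagram of groupoids `I ← E → B → I`. -/
structure PolyEndo where
  I : Type u
  E : Type u
  B : Type u
  [grpdI : Groupoid.{v} I]
  [grpdE : Groupoid.{v} E]
  [grpdB : Groupoid.{v} B]
  s : E ⥤ I
  p : E ⥤ B
  t : B ⥤ I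

attribute [instance] PolyEndo.grpdI PolyEndo.grpdE PolyEndo.grpdB

namespace PolyEndo

variable (P : PolyEndo.{u, v})

/-- The homotopy fibre `E_b` of `p` over `b`: objects `e` of `E` with an arrow `p e ⟶ b`. -/
abbrev Fib (b : P.B) := CostructuredArrow P.p b

/-- The homotopy fibre `B_i` of `t` over a colour `i`: operations `b` with an arrow `t b ⟶ i`. -/
abbrev OpsOver (i : P.I) := CostructuredArrow P.t i

/-- Finitary: the homotopy fibres of `p` are finite discrete groupoids. -/
def Finitary : Prop :=
  ∀ b : P.B, Quiver.IsThin (P.Fib b) ∧ Finite (PiZero (P.Fib b))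

/-- The arity of an operation. -/
def arity (b : P.B) : ℕ := Nat.card (PiZero (P.Fib b))

/-- The groupoid of `n`-ary operations. -/
abbrev OpsArity (n : ℕ) :=
  ObjectProperty.FullSubcategory (fun b : P.B => P.arity b = n)

/-- The groupoid of `n`-ary operations with output colour identified with `i`. -/
abbrev OpsOverArity (i : P.I) (n : ℕ) :=
  ObjectProperty.FullSubcategory (fun β : P.OpsOver i => P.arity β.left = n)

/-- A `P`-tree: a diagram from a tree `A ← M → N → A` to `I ← E → B → I`, whose squares commute up
to specified isomorphisms and whose middle square is a homotopy pullback.  As the fibres of `p` are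
discrete, the last condition says that for all nodes `n` the input edges of `n` correspond
bijectively to `π₀` of the fibre of `p` over the operation decorating `n`. -/
structure PTree where
  tree : OpTree
  colour : tree.A → P.I
  mark : tree.M → P.E
  op : tree.N → P.B
  isoS : ∀ m, P.s.obj (mark m) ⟶ colour (tree.s m)
  isoP : ∀ m, P.p.obj (mark m) ⟶ op (tree.p m)
  isoT : ∀ n, P.t.obj (op n) ⟶ colour (tree.t n)
  cart : Function.Bijective
    (fun m : tree.M =>
      (⟨tree.p m, Quotient.mk _ (CostructuredArrow.mk (isoP m))⟩ :
        Σ n : tree.N, PiZero (P.Fib (op n))))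

namespace PTree

variable {P}

/-- A morphism of `P`-trees: an isomorphism of the underlying trees together with arrows between
the decorations, compatible with the structural isomorphisms. -/
structure Hom (S T : PTree P) where
  fA : S.tree.A ≃ T.tree.A
  fM : S.tree.M ≃ T.tree.M
  fN : S.tree.N ≃ T.tree.N
  comm_s : ∀ m, fA (S.tree.s m) = T.tree.s (fM m)
  comm_p : ∀ m, fN (S.tree.p m) = T.tree.p (fM m)
  comm_t : ∀ n, fA (S.tree.t n) = T.tree.t (fN n)
  cA : ∀ a, S.colour a ⟶ T.colour (fA a)
  cM : ∀ m, S.mark m ⟶ T.mark (fM m)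
  cN : ∀ n, S.op n ⟶ T.op (fN n)
  nat_s : ∀ m, S.isoS m ≫ cA (S.tree.s m) ≫ eqToHom (congrArg T.colour (comm_s m)) =
    P.s.map (cM m) ≫ T.isoS (fM m)
  nat_p : ∀ m, S.isoP m ≫ cN (S.tree.p m) ≫ eqToHom (congrArg T.op (comm_p m)) =
    P.p.map (cM m) ≫ T.isoP (fM m)
  nat_t : ∀ n, S.isoT n ≫ cA (S.tree.t n) ≫ eqToHom (congrArg T.colour (comm_t n)) =
    P.t.map (cN n) ≫ T.isoT (fN n)

theorem nat_eqToHom {α β C : Type*} [Category C] {F : α → C} {G : β → C} {f : α → β}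
    (c : ∀ a, F a ⟶ G (f a)) {x y : α} (h : x = y) :
    c x ≫ eqToHom (congrArg (fun a => G (f a)) h) = eqToHom (congrArg F h) ≫ c y := by
  subst h; simp

/-- The identity of a `P`-tree. -/
def Hom.id (T : PTree P) : Hom T T where
  fA := Equiv.refl _
  fM := Equiv.refl _
  fN := Equiv.refl _
  comm_s _ := rfl
  comm_p _ := rfl
  comm_t _ := rfl
  cA _ := 𝟙 _
  cM _ := 𝟙 _
  cN _ := 𝟙 _
  nat_s m := by simp
  nat_p m := by simp
  nat_t n := by simp

theorem comp_nat {α β C : Type*} [Category C] {F : α → C} {G : β → C}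
    {f : α → β} (c : ∀ a, F a ⟶ G (f a)) {W W' W'' : C} {x y : α} {z : β}
    (i : W ⟶ F x) (j : W' ⟶ F y) (k : W'' ⟶ G z) (g : W ⟶ W') (g' : W' ⟶ W'')
    (h₁ : x = y) (h₂ : f y = z)
    (e₁ : i ≫ eqToHom (congrArg F h₁) = g ≫ j)
    (e₂ : j ≫ c y ≫ eqToHom (congrArg G h₂) = g' ≫ k) :
    i ≫ c x ≫ eqToHom (congrArg G ((congrArg f h₁).trans h₂)) = g ≫ g' ≫ k := by
  subst h₁
  simp only [eqToHom_refl, Category.comp_id] at e₁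
  rw [← e₂, e₁, Category.assoc]

/-- Composition of morphisms of `P`-trees. -/
def Hom.comp {S T U : PTree P} (f : Hom S T) (g : Hom T U) : Hom S U where
  fA := f.fA.trans g.fA
  fM := f.fM.trans g.fM
  fN := f.fN.trans g.fN
  comm_s m := (congrArg g.fA (f.comm_s m)).trans (g.comm_s _)
  comm_p m := (congrArg g.fN (f.comm_p m)).trans (g.comm_p _)
  comm_t n := (congrArg g.fA (f.comm_t n)).trans (g.comm_t _)
  cA a := f.cA a ≫ g.cA (f.fA a)
  cM m := f.cM m ≫ g.cM (f.fM m)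
  cN n := f.cN n ≫ g.cN (f.fN n)
  nat_s m := by
    have := comp_nat g.cA (S.isoS m ≫ f.cA (S.tree.s m)) (T.isoS (f.fM m))
      (U.isoS (g.fM (f.fM m))) (P.s.map (f.cM m)) (P.s.map (g.cM _)) (f.comm_s m)
      (g.comm_s _) (by simpa using f.nat_s m) (g.nat_s _)
    simpa using this
  nat_p m := by
    have := comp_nat g.cN (S.isoP m ≫ f.cN (S.tree.p m)) (T.isoP (f.fM m))
      (U.isoP (g.fM (f.fM m))) (P.p.map (f.cM m)) (P.p.map (g.cM _)) (f.comm_p m)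
      (g.comm_p _) (by simpa using f.nat_p m) (g.nat_p _)
    simpa using this
  nat_t n := by
    have := comp_nat g.cA (S.isoT n ≫ f.cA (S.tree.t n)) (T.isoT (f.fN n))
      (U.isoT (g.fN (f.fN n))) (P.t.map (f.cN n)) (P.t.map (g.cN _)) (f.comm_t n)
      (g.comm_t _) (by simpa using f.nat_t n) (g.nat_t _)
    simpa using this

/-- The groupoid `T_P` of `P`-trees, as a category. -/
instance category : Category (PTree P) where
  Hom := Hom
  id := Hom.id
  comp := Hom.comp
  id_comp f := by
    cases f
    unfold Hom.comp Hom.id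
    congr 1 <;> exact funext fun _ => Category.id_comp _
  comp_id f := by
    cases f
    unfold Hom.comp Hom.id
    congr 1 <;> exact funext fun _ => Category.comp_id _
  assoc f g h := by
    unfold Hom.comp
    congr 1 <;> exact funext fun _ => Category.assoc _ _ _

theorem Hom.map_root {S T : PTree P} (f : Hom S T) : f.fA S.tree.root = T.tree.root := by
  rw [← T.tree.not_mem_range_s]
  rintro ⟨m, hm⟩
  apply (S.tree.not_mem_range_s S.tree.root).2 rfl
  refine ⟨f.fM.symm m, f.fA.injective ?_⟩
  rw [f.comm_s, Equiv.apply_symm_apply, hm]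

/-- The projection `T_P → I` to the colour of the root edge. -/
def rootColour : PTree P ⥤ P.I where
  obj T := T.colour T.tree.root
  map {S T} f := Hom.cA f S.tree.root ≫ eqToHom (congrArg T.colour (Hom.map_root f))
  map_id T := by
    change 𝟙 _ ≫ eqToHom _ = _
    simp
  map_comp {S T U} f g := by
    change (Hom.cA f _ ≫ Hom.cA g (Hom.fA f _)) ≫ eqToHom _ = _
    have := nat_eqToHom (Hom.cA g) (Hom.map_root f)
    rw [Category.assoc, Category.assoc, ← reassoc_of% this]
    simp

/-- `τ` is (isomorphic to) the core of the tree `T`: forgetting leaves and root edge, the nodes of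
`T` are the vertices of `τ`, the node whose output is the root edge is the root of `τ`, and each
inner edge, from a node `n` down to a node `p m`, makes `p m` the parent of `n`. -/
def HasCore (T : OpTree) (τ : CombTree) : Prop :=
  ∃ e : T.N ≃ τ.V,
    (∀ n, T.t n = T.root → e n = τ.root) ∧
    (∀ n m, T.t n = T.s m → τ.parent (e n) = e (T.p m))

end PTree

/-- The groupoid of `P`-trees with `l` leaves and core `τ`. -/
abbrev TreesWith (l : ℕ) (τ : CombTree) :=
  ObjectProperty.FullSubcategory
    (fun T : PTree P => T.tree.numLeaves = l ∧ PTree.HasCore T.tree τ)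

/-- The groupoid of `P`-trees with root colour identified with `i`, with `l` leaves and core `τ`
(a part of the homotopy fibre of `T_P → I` over `i`). -/
abbrev TreesOverWith (i : P.I) (l : ℕ) (τ : CombTree) :=
  ObjectProperty.FullSubcategory
    (fun T : CostructuredArrow (PTree.rootColour (P := P)) i =>
      T.left.tree.numLeaves = l ∧ PTree.HasCore T.left.tree τ)

/-- The right-hand side of the Bergbauer–Kreimer system of `P`: the series
`1 + ∑_{β = (b, t b ⟶ i) ∈ π₀ B_i} |Aut β|⁻¹ α^(|E_b| - 1) B₊ (∏_{e ∈ E_b} X_{s e})`,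
the sum being taken coefficientwise in `α`. -/
def bkSystemRHS (X : P.I → PowerSeries HCK) (i : P.I) : PowerSeries HCK :=
  1 + PowerSeries.mk fun k => ∑ᶠ β : PiZero (P.OpsOver i),
    PowerSeries.coeff k (((1 : ℚ) / (Nat.card (Aut β.rep) : ℚ)) •
      (PowerSeries.X ^ (P.arity β.rep.left - 1) *
        BplusSeries (∏ᶠ e : PiZero (P.Fib β.rep.left), X (P.s.obj e.rep.left))))

end PolyEndo

/-- The right-hand side of the one-variable Bergbauer–Kreimer equation with weights `w`: the series
`1 + ∑_{n ≥ 1} w_n α^n B₊ (Y^(n+1))`.  The terms with `n > k` do not contribute to the coefficient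
of `α^k`. -/
def bkRHS (w : ℕ → ℚ) (Y : PowerSeries HCK) : PowerSeries HCK :=
  1 + PowerSeries.mk fun k => ∑ n ∈ Finset.Icc 1 k,
    PowerSeries.coeff k (w n • (PowerSeries.X ^ n * BplusSeries (Y ^ (n + 1))))

/-- The coefficient of (the class of) a combinatorial tree in an element of `H_CK`. -/
def treeCoeff (τ : CombTree) (h : HCK) : ℚ :=
  MvPolynomial.coeff (Finsupp.single τ.cls 1) h

end

/-! Weight every `P`-tree over a colour `i` by the monomial of its core in `HCK` (the generator of
the core, or `1` if there are no nodes). The claim behind both parts is that the coefficient of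
`α^k` in `X i` is the sum of core monomials, each divided by the order of the automorphism group,
over isomorphism classes of trees over `i` with `k + 1` leaves (`coeff_eq_groupoidInt`). Taking the
coefficient of the generator `τ`, a linear functional, turns each monomial into the indicator of
having core `τ` and leaves a groupoid cardinality (`treesOverWith_card`).

The claim is proved by strong induction on `k`. A tree over `i` either has no nodes, and such trees
form a contractible groupoid accounting for the summand `1`, or it has a root node. Sending a tree
of the second kind to its root operation is a functor to the groupoid `B_i`, whose homotopy fibre
over an operation `β` is, by grafting, the product over the inputs `e` of `β` of the groupoids of
trees over `s e` (`graftOverMap_bijective`, `exists_graftOver_hom`). Weighted cardinality behaves as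
it should: it is multiplicative on products (`groupoidInt_pi`), and over a base it is the sum of the
fibres divided by the automorphisms of the base points (`groupoidInt_fibration`). The core of a
grafted tree is `B₊` of the product of the cores (`Bplus_prod_coreMonomial`), and leaves add up: `k
+ 1 = ∑ (k_e + 1)` means `k = (|E_b| - 1) + ∑ k_e`, which is the exponent of `α` in the equation.

Since arities are at least `2` and every tree has a leaf, each grafted subtree has fewer leaves than
the whole tree, so the induction applies. The same bound on arities makes the right-hand side of the
system a contraction for the `α`-adic topology, hence existence and uniqueness of `X`. Infinite sums
are `finsum`s, which are meaningful only on finite supports; finiteness (`IsFiniteOn`) is therefore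
proved along with the values.

In one variable every triangle over the contractible base `I` commutes, so fibres over a colour may
be replaced by the whole groupoids. Grouping operations by arity shows that the constant family of
the one-variable solution solves the system (`bkSystemRHS_const`), and the first part applies. -/

noncomputable section

/-! ## Weighted groupoid cardinality -/

section GroupoidIntegral

universe u₁ v₁ u₂ v₂ w₁

/-- The isomorphism class of an object. -/
def PiZero.mk {C : Type u₁} [Category.{v₁} C] (x : C) : PiZero C :=
  Quotient.mk (isIsomorphicSetoid C) x

theorem PiZero.mk_rep {C : Type u₁} [Category.{v₁} C] (z : PiZero C) : PiZero.mk z.rep = z :=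
  Quotient.out_eq z

theorem PiZero.mk_surjective {C : Type u₁} [Category.{v₁} C] :
    Function.Surjective (PiZero.mk (C := C)) :=
  fun z => ⟨z.rep, z.mk_rep⟩

theorem PiZero.mk_eq_iff {C : Type u₁} [Category.{v₁} C] [IsGroupoid C] {x y : C} :
    PiZero.mk x = PiZero.mk y ↔ Nonempty (x ⟶ y) := by
  constructor
  · intro h
    obtain ⟨e⟩ : Nonempty (x ≅ y) := Quotient.exact h
    exact ⟨e.hom⟩
  · rintro ⟨f⟩
    exact Quotient.sound ⟨asIso f⟩

theorem PiZero.rep_hom {C : Type u₁} [Category.{v₁} C] [IsGroupoid C] (x : C) :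
    Nonempty ((PiZero.mk x).rep ⟶ x) :=
  PiZero.mk_eq_iff.1 (PiZero.mk_rep _)

instance {C : Type u₁} [Category.{v₁} C] [IsGroupoid C] {D : Type u₂} [Category.{v₂} D]
    (F : C ⥤ D) (d : D) : IsGroupoid (CostructuredArrow F d) :=
  isGroupoid_of_reflects_iso (CostructuredArrow.proj F d)

instance {C : Type u₁} [Category.{v₁} C] [IsGroupoid C] (Q : ObjectProperty C) :
    IsGroupoid Q.FullSubcategory :=
  isGroupoid_of_reflects_iso Q.ι

theorem nonempty_hom_symm {C : Type u₁} [Category.{v₁} C] [IsGroupoid C] {x y : C}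
    (h : Nonempty (x ⟶ y)) : Nonempty (y ⟶ x) :=
  h.map fun f => inv f

/-- In a groupoid, automorphisms are the same as endomorphisms. -/
def autEquivEnd {C : Type u₁} [Category.{v₁} C] [IsGroupoid C] (x : C) : Aut x ≃ (x ⟶ x) where
  toFun f := Iso.hom f
  invFun f := asIso f
  left_inv f := by ext; rfl
  right_inv f := rfl

/-- In a groupoid, an arrow identifies the hom-sets into its ends. -/
def homCompEquiv {C : Type u₁} [Category.{v₁} C] [IsGroupoid C] (z : C) {x y : C} (f : x ⟶ y) :
    (z ⟶ x) ≃ (z ⟶ y) where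
  toFun g := g ≫ f
  invFun g := g ≫ inv f
  left_inv g := by simp
  right_inv g := by simp

/-- In a groupoid, an arrow identifies the endomorphisms of its ends. -/
def endConjEquiv {C : Type u₁} [Category.{v₁} C] [IsGroupoid C] {x y : C} (f : x ⟶ y) :
    (x ⟶ x) ≃ (y ⟶ y) where
  toFun g := inv f ≫ g ≫ f
  invFun g := f ≫ g ≫ inv f
  left_inv g := by simp
  right_inv g := by simp

variable {C : Type u₁} [Category.{v₁} C] {D : Type u₂} [Category.{v₂} D]
variable {V : Type w₁} [AddCommGroup V] [Module ℚ V]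

/-- The contribution `w x / |Aut x|` of an object to a weighted cardinality. -/
def autWeight (w : C → V) (x : C) : V := (Nat.card (x ⟶ x) : ℚ)⁻¹ • w x

/-- Weighted groupoid cardinality: the sum of `w x / |Aut x|` over the isomorphism classes. -/
def groupoidInt (w : C → V) : V := ∑ᶠ z : PiZero C, autWeight w z.rep

/-- The objects with a given property form finitely many isomorphism classes and have finite
automorphism groups. -/
def IsFiniteOn (S : C → Prop) : Prop :=
  (PiZero.mk '' {x | S x}).Finite ∧ ∀ x, S x → Finite (x ⟶ x)

/-- A function on objects is invariant under arrows. -/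
def ArrowInvariant {W : Sort*} (w : C → W) : Prop := ∀ ⦃x y : C⦄, (x ⟶ y) → w x = w y

theorem ArrowInvariant.rep [IsGroupoid C] {W : Sort*} {w : C → W} (hw : ArrowInvariant w) (x : C) :
    w (PiZero.mk x).rep = w x :=
  hw (PiZero.rep_hom x).some

theorem ArrowInvariant.autWeight [IsGroupoid C] {w : C → V} (hw : ArrowInvariant w) :
    ArrowInvariant (autWeight w) := by
  intro x y f
  simp only [_root_.autWeight, hw f, Nat.card_congr (endConjEquiv f)]

theorem groupoidCard_eq_groupoidInt [IsGroupoid C] :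
    groupoidCard C = groupoidInt (fun _ : C => (1 : ℚ)) := by
  simp only [groupoidCard, groupoidInt, autWeight, Nat.card_congr (autEquivEnd _), smul_eq_mul,
    one_div, mul_one]

theorem isFiniteGroupoid_iff [IsGroupoid C] :
    IsFiniteGroupoid C ↔ IsFiniteOn (fun _ : C => True) := by
  have h : PiZero.mk '' {_x : C | True} = Set.univ := by
    simpa using PiZero.mk_surjective.range_eq
  simp only [IsFiniteGroupoid, IsFiniteOn, h, Set.finite_univ_iff, forall_const]
  exact and_congr_right fun _ => forall_congr' fun x => (autEquivEnd x).finite_iff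

theorem IsFiniteOn.mono {S T : C → Prop} (h : IsFiniteOn T) (hST : ∀ x, S x → T x) :
    IsFiniteOn S :=
  ⟨h.1.subset (Set.image_mono hST), fun x hx => h.2 x (hST x hx)⟩

theorem IsFiniteOn.or {S T : C → Prop} (hS : IsFiniteOn S) (hT : IsFiniteOn T) :
    IsFiniteOn fun x => S x ∨ T x := by
  refine ⟨?_, fun x hx => hx.elim (hS.2 x) (hT.2 x)⟩
  have : {x | S x ∨ T x} = {x | S x} ∪ {x | T x} := rfl
  rw [this, Set.image_union]
  exact hS.1.union hT.1

/-- A `finsum` over an infinite support is `0` by convention, so the linearity and product formulas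
below all need this bound. -/
theorem IsFiniteOn.support_finite {S : C → Prop} (h : IsFiniteOn S) {w : C → V}
    (hw : ∀ x, w x ≠ 0 → S x) :
    (Function.support fun z : PiZero C => autWeight w z.rep).Finite := by
  refine h.1.subset fun z hz => ⟨z.rep, hw _ ?_, z.mk_rep⟩
  intro h0
  exact hz (by simp [autWeight, h0])

theorem groupoidInt_map {V' : Type*} [AddCommGroup V'] [Module ℚ V'] (L : V →ₗ[ℚ] V')
    {S : C → Prop} (h : IsFiniteOn S) {w : C → V} (hw : ∀ x, w x ≠ 0 → S x) :
    groupoidInt (fun x => L (w x)) = L (groupoidInt w) := by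
  have := L.toAddMonoidHom.map_finsum (h.support_finite hw)
  simp only [groupoidInt]
  refine Eq.trans ?_ this.symm
  simp [autWeight]

theorem groupoidInt_sum {ι : Type*} (s : Finset ι) {S : C → Prop} (h : IsFiniteOn S)
    {w : ι → C → V} (hw : ∀ i ∈ s, ∀ x, w i x ≠ 0 → S x) :
    groupoidInt (fun x => ∑ i ∈ s, w i x) = ∑ i ∈ s, groupoidInt (w i) := by
  simp only [groupoidInt]
  rw [← finsum_sum_comm]
  · simp only [autWeight, Finset.smul_sum]
  · intro i hi
    exact h.support_finite (hw i hi)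

theorem groupoidInt_add {S : C → Prop} (h : IsFiniteOn S)
    {w w' : C → V} (hw : ∀ x, w x ≠ 0 → S x) (hw' : ∀ x, w' x ≠ 0 → S x) :
    groupoidInt (fun x => w x + w' x) = groupoidInt w + groupoidInt w' := by
  simp only [groupoidInt]
  rw [← finsum_add_distrib (h.support_finite hw) (h.support_finite hw')]
  simp only [autWeight, smul_add]

/-! ### Transfer along maps that are bijective on hom-sets -/

section HomBijective

variable [IsGroupoid C] [IsGroupoid D]

/-- Finiteness and cardinality see only which hom-sets are nonempty and how large the endomorphism
sets are. Hence `φ` may be a bare map on objects, and the bijections of hom-sets need not respect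
composition. -/
theorem IsFiniteOn.of_hom_equiv {φ : C → D} (hφ : ∀ x y, Nonempty ((x ⟶ y) ≃ (φ x ⟶ φ y)))
    {S : D → Prop} (hS : ∀ y, S y → ∃ x, S (φ x) ∧ Nonempty (φ x ⟶ y))
    (h : IsFiniteOn fun x => S (φ x)) : IsFiniteOn S := by
  constructor
  · refine (h.1.image fun z => PiZero.mk (φ z.rep)).subset ?_
    rintro _ ⟨y, hy, rfl⟩
    obtain ⟨x, hx, ⟨f⟩⟩ := hS y hy
    refine ⟨_, ⟨x, hx, rfl⟩, ?_⟩
    obtain ⟨g⟩ := PiZero.rep_hom x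
    exact PiZero.mk_eq_iff.2 ⟨(hφ _ _).some g ≫ f⟩
  · intro y hy
    obtain ⟨x, hx, ⟨f⟩⟩ := hS y hy
    have := h.2 x hx
    exact Finite.of_equiv _ ((hφ x x).some.trans (endConjEquiv f))

theorem IsFiniteOn.comp_of_hom_equiv {φ : C → D}
    (hφ : ∀ x y, Nonempty ((x ⟶ y) ≃ (φ x ⟶ φ y)))
    {S : D → Prop} (h : IsFiniteOn S) : IsFiniteOn fun x => S (φ x) := by
  constructor
  · refine Set.Finite.of_finite_image (f := fun z => PiZero.mk (φ z.rep)) (h.1.subset ?_) ?_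
    · rintro _ ⟨_, ⟨x, hx, rfl⟩, rfl⟩
      refine ⟨φ x, hx, PiZero.mk_eq_iff.2 ?_⟩
      exact nonempty_hom_symm ⟨(hφ _ _).some (PiZero.rep_hom x).some⟩
    · rintro z - z' - hz
      obtain ⟨f⟩ := PiZero.mk_eq_iff.1 hz
      rw [← z.mk_rep, ← z'.mk_rep]
      exact PiZero.mk_eq_iff.2 ⟨(hφ _ _).some.symm f⟩
  · intro x hx
    have := h.2 _ hx
    exact Finite.of_equiv _ (hφ x x).some.symm

/-- The induced map on isomorphism classes is injective and preserves orders of automorphism groups;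
classes outside its image carry weight zero, so essential surjectivity is only asked on the support
of `w`. -/
theorem groupoidInt_comp {φ : C → D} (hφ : ∀ x y, Nonempty ((x ⟶ y) ≃ (φ x ⟶ φ y)))
    {w : D → V} (hw : ArrowInvariant w) (hs : ∀ y, w y ≠ 0 → ∃ x, Nonempty (φ x ⟶ y)) :
    groupoidInt (fun x => w (φ x)) = groupoidInt w := by
  let ψ : PiZero C → PiZero D := fun z => PiZero.mk (φ z.rep)
  have hψ : Function.Injective ψ := by
    intro z z' hz
    obtain ⟨f⟩ := PiZero.mk_eq_iff.1 hz
    rw [← z.mk_rep, ← z'.mk_rep]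
    exact PiZero.mk_eq_iff.2 ⟨(hφ _ _).some.symm f⟩
  have h1 : ∀ z, autWeight (fun x => w (φ x)) z.rep = autWeight w (ψ z).rep := by
    intro z
    rw [hw.autWeight.rep]
    simp only [autWeight, Nat.card_congr (hφ _ _).some]
  simp only [groupoidInt]
  rw [finsum_congr h1, ← finsum_mem_range hψ (f := fun z => autWeight w z.rep)]
  refine (finsum_mem_inter_support_eq _ _ Set.univ ?_).trans (finsum_mem_univ _)
  ext z
  simp only [Set.mem_inter_iff, Set.mem_univ, true_and, and_iff_right_iff_imp]
  intro hz
  have : w z.rep ≠ 0 := fun h0 => hz (by simp [autWeight, h0])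
  obtain ⟨x, ⟨f⟩⟩ := hs _ this
  refine ⟨PiZero.mk x, ?_⟩
  rw [← z.mk_rep]
  exact PiZero.mk_eq_iff.2 ⟨(hφ _ _).some (PiZero.rep_hom x).some ≫ f⟩

end HomBijective

/-! ### Products of groupoids -/

section Pi

variable {ι : Type} [Fintype ι] {G : ι → Type u₁} [∀ i, Category.{v₁} (G i)]
  [∀ i, IsGroupoid (G i)]

theorem isFiniteOn_pi {S : ∀ i, G i → Prop} (h : ∀ i, IsFiniteOn (S i)) :
    IsFiniteOn fun x : ∀ i, G i => ∀ i, S i (x i) := by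
  constructor
  · refine ((Set.Finite.pi' fun i => (h i).1).image
      (fun z => PiZero.mk fun i => (z i).rep)).subset ?_
    rintro _ ⟨x, hx, rfl⟩
    refine ⟨fun i => PiZero.mk (x i), fun i => ⟨_, hx i, rfl⟩, ?_⟩
    exact PiZero.mk_eq_iff.2 ⟨fun i => (PiZero.rep_hom (x i)).some⟩
  · intro x hx
    have := fun i => (h i).2 _ (hx i)
    exact inferInstanceAs (Finite (∀ i, x i ⟶ x i))

/-- Isomorphism classes and automorphisms of a product are formed componentwise; what remains is
expanding a product of finite sums. -/
theorem groupoidInt_pi {R : Type*} [CommRing R] [Algebra ℚ R] {S : ∀ i, G i → Prop}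
    (h : ∀ i, IsFiniteOn (S i)) {w : ∀ i, G i → R} (hw : ∀ i x, w i x ≠ 0 → S i x)
    (hinv : ∀ i, ArrowInvariant (w i)) :
    groupoidInt (fun x : ∀ i, G i => ∏ i, w i (x i)) = ∏ i, groupoidInt (w i) := by
  classical
  let ψ : PiZero (∀ i, G i) → ∀ i, PiZero (G i) := fun z i => PiZero.mk (z.rep i)
  have hψ : Function.Bijective ψ := by
    constructor
    · intro z z' hz
      rw [← z.mk_rep, ← z'.mk_rep]
      exact PiZero.mk_eq_iff.2 ⟨fun i => (PiZero.mk_eq_iff.1 (congrFun hz i)).some⟩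
    · intro y
      refine ⟨PiZero.mk fun i => (y i).rep, ?_⟩
      funext i
      obtain ⟨f⟩ := PiZero.rep_hom (fun i => (y i).rep)
      rw [← (y i).mk_rep]
      exact PiZero.mk_eq_iff.2 ⟨f i⟩
  have h1 : ∀ z : PiZero (∀ i, G i), autWeight (fun x : ∀ i, G i => ∏ i, w i (x i)) z.rep =
      ∏ i, autWeight (w i) (ψ z i).rep := by
    intro z
    have h2 : Nat.card (z.rep ⟶ z.rep) = ∏ i, Nat.card (z.rep i ⟶ z.rep i) := Nat.card_pi
    simp only [ψ, (hinv _).autWeight.rep]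
    simp only [autWeight, h2, Finset.prod_smul]
    push_cast
    rw [Finset.prod_inv_distrib]
  have hf : ∀ i, (Function.support fun z : PiZero (G i) => autWeight (w i) z.rep).Finite :=
    fun i => (h i).support_finite (hw i)
  simp only [groupoidInt]
  rw [finsum_congr h1, finsum_eq_of_bijective (g := fun y => ∏ i, autWeight (w i) (y i).rep) ψ hψ
    fun z => rfl]
  rw [finsum_eq_sum_of_support_subset (s := Fintype.piFinset fun i => (hf i).toFinset)]
  · refine (Finset.prod_univ_sum (fun i => (hf i).toFinset)
      fun i z => autWeight (w i) z.rep).symm.trans ?_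
    exact Finset.prod_congr rfl fun i _ => (finsum_eq_sum _ (hf i)).symm
  · intro y hy
    simp only [Finset.mem_coe, Fintype.mem_piFinset, Set.Finite.mem_toFinset,
      Function.mem_support]
    intro i h0
    exact hy (Finset.prod_eq_zero (Finset.mem_univ i) h0)

end Pi

/-! ### Summation over the homotopy fibres of a functor -/

section Fibration

variable [IsGroupoid C] (F : C ⥤ D)

/-- Endomorphisms of `g`, sorted by the arrow `F g ⟶ d` they produce from a given one. -/
def endEquivSigma {d : D} {g : C} (φ : F.obj g ⟶ d) :
    (g ⟶ g) ≃ Σ χ : {χ : F.obj g ⟶ d // Nonempty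
      (CostructuredArrow.mk χ ⟶ CostructuredArrow.mk φ)},
      (CostructuredArrow.mk χ.1 ⟶ CostructuredArrow.mk φ) where
  toFun a := ⟨⟨F.map a ≫ φ, ⟨CostructuredArrow.homMk a rfl⟩⟩, CostructuredArrow.homMk a rfl⟩
  invFun x := x.2.left
  left_inv a := rfl
  right_inv := by
    have key : ∀ (a : g ⟶ g) (χ : F.obj g ⟶ d) (hχ) (f : CostructuredArrow.mk χ ⟶
        CostructuredArrow.mk φ) (h : F.map a ≫ φ = χ), f.left = a →
        (⟨⟨F.map a ≫ φ, ⟨CostructuredArrow.homMk a rfl⟩⟩, CostructuredArrow.homMk a rfl⟩ :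
          Σ χ : {χ : F.obj g ⟶ d // Nonempty
            (CostructuredArrow.mk χ ⟶ CostructuredArrow.mk φ)},
            (CostructuredArrow.mk χ.1 ⟶ CostructuredArrow.mk φ)) = ⟨⟨χ, hχ⟩, f⟩ := by
      rintro a _ hχ f rfl hf
      obtain rfl : f = CostructuredArrow.homMk a rfl := by
        ext
        exact hf
      rfl
    rintro ⟨⟨χ, hχ⟩, f⟩
    exact key f.left χ hχ f (CostructuredArrow.w f) rfl

/-- Orbit–stabiliser: the endomorphisms of `g` act on the arrows `F g ⟶ d`, the orbit of `φ`
consists of the arrows isomorphic to `φ` in the homotopy fibre, and the stabiliser is the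
automorphism group of `φ` there. -/
theorem card_end_eq_mul {d : D} {g : C} (φ : F.obj g ⟶ d) :
    Nat.card (g ⟶ g) = Nat.card {χ : F.obj g ⟶ d // PiZero.mk (CostructuredArrow.mk χ) =
      PiZero.mk (CostructuredArrow.mk φ)} *
      Nat.card (CostructuredArrow.mk φ ⟶ CostructuredArrow.mk φ) := by
  have e : (g ⟶ g) ≃ {χ : F.obj g ⟶ d // PiZero.mk (CostructuredArrow.mk χ) =
      PiZero.mk (CostructuredArrow.mk φ)} × (CostructuredArrow.mk φ ⟶ CostructuredArrow.mk φ) := by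
    refine (endEquivSigma F φ).trans ((Equiv.sigmaCongrRight fun χ => ?_).trans
      ((Equiv.sigmaEquivProd _ _).trans (Equiv.prodCongrLeft fun _ =>
        Equiv.subtypeEquivRight fun χ => PiZero.mk_eq_iff.symm)))
    -- Over each point of the orbit the arrows to `φ` form a torsor; a chosen one identifies them
    -- with the endomorphisms of `φ`.
    exact { toFun := fun f => inv χ.2.some ≫ f
            invFun := fun f => χ.2.some ≫ f
            left_inv := fun f => by simp
            right_inv := fun f => by simp }
  rw [Nat.card_congr e, Nat.card_prod]

variable [IsGroupoid D] {F}

/-- Each isomorphism class is represented in the fibre over one of finitely many base classes.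
Endomorphisms of `g` are sorted by `endEquivSigma` into finitely many sets, each empty or of the
size of an automorphism group in the fibre. -/
theorem IsFiniteOn.of_fibration (hD : ∀ d : D, Finite (d ⟶ d)) {S : C → Prop}
    (hbase : (PiZero.mk '' {d : D | ∃ g, S g ∧ Nonempty (F.obj g ⟶ d)}).Finite)
    (hfib : ∀ z : PiZero D, IsFiniteOn fun y : CostructuredArrow F z.rep => S y.left) :
    IsFiniteOn S := by
  constructor
  · refine (hbase.biUnion fun z _ => (hfib z).1.image fun y => PiZero.mk y.rep.left).subset ?_
    rintro _ ⟨g, hg, rfl⟩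
    obtain ⟨φ⟩ := nonempty_hom_symm (PiZero.rep_hom (F.obj g))
    simp only [Set.mem_iUnion]
    refine ⟨PiZero.mk (F.obj g), ⟨_, ⟨g, hg, ⟨𝟙 _⟩⟩, rfl⟩, _,
      ⟨CostructuredArrow.mk φ, hg, rfl⟩, ?_⟩
    obtain ⟨f⟩ := PiZero.rep_hom (CostructuredArrow.mk φ)
    exact PiZero.mk_eq_iff.2 ⟨f.left⟩
  · intro g hg
    obtain ⟨φ⟩ := nonempty_hom_symm (PiZero.rep_hom (F.obj g))
    have : ∀ χ : F.obj g ⟶ (PiZero.mk (F.obj g)).rep,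
        Finite (CostructuredArrow.mk χ ⟶ CostructuredArrow.mk φ) := by
      intro χ
      by_cases h : Nonempty (CostructuredArrow.mk χ ⟶ CostructuredArrow.mk φ)
      · have := (hfib _).2 (CostructuredArrow.mk χ) hg
        exact Finite.of_equiv _ (homCompEquiv _ h.some)
      · rw [not_nonempty_iff] at h
        infer_instance
    have := hD (F.obj g)
    have : Finite (F.obj g ⟶ (PiZero.mk (F.obj g)).rep) :=
      Finite.of_equiv _ (homCompEquiv _ φ)
    exact Finite.of_equiv _ (endEquivSigma F φ).symm

/-- Fix a class `z` lying over `d`. The `|Aut d|` arrows `F z ⟶ d` split into orbits indexed by the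
classes `y` of the fibre over `z`, the orbit of `y` having `|Aut z| / |Aut y|` elements. So the sum
of `1 / |Aut y|` is `|Aut d| / |Aut z|`, and dividing by `|Aut d|` leaves the weight of `z`. -/
theorem groupoidInt_fibration (hD : ∀ d : D, Finite (d ⟶ d)) {S : C → Prop}
    (hS : ArrowInvariant S)
    (hbase : (PiZero.mk '' {d : D | ∃ g, S g ∧ Nonempty (F.obj g ⟶ d)}).Finite)
    (hfib : ∀ z : PiZero D, IsFiniteOn fun y : CostructuredArrow F z.rep => S y.left)
    {w : C → V} (hw : ArrowInvariant w) (hwS : ∀ x, w x ≠ 0 → S x) :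
    groupoidInt w = ∑ᶠ z : PiZero D, (Nat.card (z.rep ⟶ z.rep) : ℚ)⁻¹ •
      groupoidInt (fun y : CostructuredArrow F z.rep => w y.left) := by
  classical
  have hC : IsFiniteOn S := IsFiniteOn.of_fibration hD hbase hfib
  let s : Finset (PiZero C) := hC.1.toFinset
  have hs : ∀ z ∈ s, S z.rep := by
    intro z hz
    obtain ⟨x, hx, rfl⟩ := hC.1.mem_toFinset.1 hz
    rw [hS.rep]
    exact hx
  let π : PiZero C → PiZero D := fun z => PiZero.mk (F.obj z.rep)
  have key : ∀ d : PiZero D, (Nat.card (d.rep ⟶ d.rep) : ℚ)⁻¹ •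
      groupoidInt (fun y : CostructuredArrow F d.rep => w y.left) =
        ∑ z ∈ s with π z = d, autWeight w z.rep := by
    intro d
    let t : Finset (PiZero (CostructuredArrow F d.rep)) := (hfib d).1.toFinset
    have hSK : ArrowInvariant fun y : CostructuredArrow F d.rep => S y.left :=
      fun x y f => hS f.left
    let ρ : PiZero (CostructuredArrow F d.rep) → PiZero C := fun y => PiZero.mk y.rep.left
    have hρ : ∀ y ∈ t, ρ y ∈ s.filter fun z => π z = d := by
      intro y hy
      obtain ⟨x, hx, rfl⟩ := (hfib d).1.mem_toFinset.1 hy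
      rw [Finset.mem_filter]
      refine ⟨hC.1.mem_toFinset.2 ⟨_, ?_, rfl⟩, ?_⟩
      · simp only [Set.mem_ofPred_eq]
        rw [hSK.rep]
        exact hx
      · refine Eq.trans ?_ d.mk_rep
        obtain ⟨f⟩ := PiZero.rep_hom (PiZero.mk x).rep.left
        exact PiZero.mk_eq_iff.2 ⟨F.map f ≫ (PiZero.mk x).rep.hom⟩
    have h1 : groupoidInt (fun y : CostructuredArrow F d.rep => w y.left) =
        ∑ y ∈ t, autWeight (fun y : CostructuredArrow F d.rep => w y.left) y.rep := by
      refine finsum_eq_sum_of_support_subset _ fun y hy => ?_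
      have : w y.rep.left ≠ 0 := fun h0 => hy (by simp [autWeight, h0])
      exact (hfib d).1.mem_toFinset.2 ⟨y.rep, hwS _ this, y.mk_rep⟩
    rw [h1, ← Finset.sum_fiberwise_of_maps_to hρ, Finset.smul_sum]
    refine Finset.sum_congr rfl fun z hz => ?_
    rw [Finset.mem_filter] at hz
    obtain ⟨hz, hzd⟩ := hz
    have hSz := hs z hz
    have hfg := hC.2 _ hSz
    obtain ⟨φ₀⟩ : Nonempty (F.obj z.rep ⟶ d.rep) := by
      rw [← PiZero.mk_eq_iff, d.mk_rep]
      exact hzd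
    have hfd := hD d.rep
    have hFX : Finite (F.obj z.rep ⟶ d.rep) := by
      have := hD (F.obj z.rep)
      exact Finite.of_equiv _ (homCompEquiv _ φ₀)
    have := Fintype.ofFinite (F.obj z.rep ⟶ d.rep)
    have hcardX : Nat.card (d.rep ⟶ d.rep) = Fintype.card (F.obj z.rep ⟶ d.rep) := by
      rw [← Nat.card_eq_fintype_card]
      exact (Nat.card_congr (endConjEquiv φ₀)).symm.trans (Nat.card_congr (homCompEquiv _ φ₀))
    -- The fibres of `κ` are the orbits of the action of `End z.rep` on these arrows.
    let κ : (F.obj z.rep ⟶ d.rep) → PiZero (CostructuredArrow F d.rep) :=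
      fun χ => PiZero.mk (CostructuredArrow.mk χ)
    have hκ : ∀ χ ∈ (Finset.univ : Finset (F.obj z.rep ⟶ d.rep)),
        κ χ ∈ t.filter fun y => ρ y = z := by
      intro χ _
      rw [Finset.mem_filter]
      refine ⟨(hfib d).1.mem_toFinset.2 ⟨_, hSz, rfl⟩, ?_⟩
      rw [← z.mk_rep]
      obtain ⟨f⟩ := PiZero.rep_hom (CostructuredArrow.mk χ)
      exact PiZero.mk_eq_iff.2 ⟨f.left⟩
    have hcard := Finset.card_eq_sum_card_fiberwise hκ
    rw [Finset.card_univ, ← hcardX] at hcard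
    have hne : (Nat.card (z.rep ⟶ z.rep) : ℚ) ≠ 0 := by
      have : Nonempty (z.rep ⟶ z.rep) := ⟨𝟙 _⟩
      exact_mod_cast Nat.card_pos.ne'
    -- Orbit–stabiliser rewrites `1 / |Aut y|` as the size of the orbit divided by `|Aut z|`, so
    -- that summing over `y` just counts all arrows.
    have hterm : ∀ y ∈ t.filter fun y => ρ y = z,
        autWeight (fun y : CostructuredArrow F d.rep => w y.left) y.rep =
        (((Finset.univ.filter fun χ => κ χ = y).card : ℚ) *
          (Nat.card (z.rep ⟶ z.rep) : ℚ)⁻¹) • w z.rep := by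
      intro y hy
      rw [Finset.mem_filter] at hy
      obtain ⟨f⟩ : Nonempty (z.rep ⟶ y.rep.left) := by
        rw [← PiZero.mk_eq_iff, z.mk_rep]
        exact hy.2.symm
      let φ : F.obj z.rep ⟶ d.rep := F.map f ≫ y.rep.hom
      let g : CostructuredArrow.mk φ ⟶ y.rep := CostructuredArrow.homMk f rfl
      have hy' : y = PiZero.mk (CostructuredArrow.mk φ) := by
        rw [← y.mk_rep]
        exact (PiZero.mk_eq_iff.2 ⟨g⟩).symm
      have hmul := card_end_eq_mul F φ
      rw [← hy', ← Nat.card_congr (endConjEquiv g).symm, Nat.card_eq_fintype_card (α := {χ // _}),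
        Fintype.card_subtype] at hmul
      simp only [autWeight]
      rw [← hw f]
      congr 1
      rw [hmul] at hne ⊢
      push_cast at hne ⊢
      have h3 := left_ne_zero_of_mul hne
      have h4 := right_ne_zero_of_mul hne
      change _ = ((Finset.univ.filter fun χ => PiZero.mk (CostructuredArrow.mk χ) = y).card : ℚ) * _
      field_simp
    rw [Finset.sum_congr rfl hterm, ← Finset.sum_smul, ← Finset.sum_mul, ← Nat.cast_sum, ← hcard,
      smul_smul, autWeight, ← mul_assoc, inv_mul_cancel₀, one_mul]
    have : Nonempty (d.rep ⟶ d.rep) := ⟨𝟙 _⟩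
    exact_mod_cast Nat.card_pos.ne'
  rw [finsum_congr key, finsum_eq_sum_of_support_subset (s := s.image π)]
  · rw [Finset.sum_fiberwise_of_maps_to fun z hz => Finset.mem_image_of_mem π hz]
    refine finsum_eq_sum_of_support_subset _ fun z hz => ?_
    have : w z.rep ≠ 0 := fun h0 => hz (by simp [autWeight, h0])
    exact hC.1.mem_toFinset.2 ⟨z.rep, hwS _ this, z.mk_rep⟩
  · intro d hd
    obtain ⟨z, hz, -⟩ := Finset.exists_ne_zero_of_sum_ne_zero hd
    rw [Finset.mem_filter] at hz
    rw [Finset.mem_coe, Finset.mem_image]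
    exact ⟨z, hz⟩

end Fibration

end GroupoidIntegral

/-! ## Operadic trees -/

namespace OpTree

variable (T : OpTree)

instance : Finite T.A := T.finA
instance : Finite T.M := T.finM
instance : Finite T.N := T.finN

/-- One step of the walk towards the root. -/
def Step (x y : T.A) : Prop := ∃ m, T.s m = x ∧ T.t (T.p m) = y

theorem s_ne_root (m : T.M) : T.s m ≠ T.root := fun h =>
  (T.not_mem_range_s _).2 h ⟨m, rfl⟩

theorem eq_root_or_eq_s (a : T.A) : a = T.root ∨ ∃ m, T.s m = a := by
  by_cases h : a ∈ Set.range T.s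
  · exact Or.inr h
  · exact Or.inl ((T.not_mem_range_s a).1 h)

theorem not_step_root (y : T.A) : ¬ T.Step T.root y := by
  rintro ⟨m, hm, -⟩
  exact T.s_ne_root m hm

theorem step_rightUnique : Relator.RightUnique T.Step := by
  rintro x y z ⟨m, rfl, rfl⟩ ⟨m', hm', rfl⟩
  rw [T.s_inj hm']

/-- Induction on edges, from the root upwards. -/
theorem edge_induction {C : T.A → Prop} (root : C T.root)
    (step : ∀ m, C (T.t (T.p m)) → C (T.s m)) (a : T.A) : C a := by
  refine Relation.ReflTransGen.head_induction_on (T.walk a) root ?_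
  rintro _ _ ⟨m, rfl, rfl⟩ - h
  exact step m h

/-- A tree is rooted if it has a root node. -/
def Rooted : Prop := ∃ n, T.t n = T.root

variable {T}

/-- The walk from the output edge of `n` to the root is either empty, making `n` a root node, or its
last step ends at the output edge of some node. -/
theorem rooted_of_node (n : T.N) : T.Rooted := by
  rcases Relation.ReflTransGen.cases_tail (T.walk (T.t n)) with h | ⟨_, -, ⟨m, -, h⟩⟩
  · exact ⟨n, h.symm⟩
  · exact ⟨_, h⟩

theorem isEmpty_node (h : ¬ T.Rooted) : IsEmpty T.N := ⟨fun n => h (rooted_of_node n)⟩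

theorem isEmpty_mark (h : ¬ T.Rooted) : IsEmpty T.M := ⟨fun m => h (rooted_of_node (T.p m))⟩

theorem eq_root (h : ¬ T.Rooted) (a : T.A) : a = T.root :=
  (T.eq_root_or_eq_s a).resolve_right fun ⟨m, _⟩ => (isEmpty_mark h).false m

theorem numLeaves_of_not_rooted (h : ¬ T.Rooted) : T.numLeaves = 1 := by
  have := isEmpty_node h
  rw [numLeaves, Nat.card_eq_one_iff_unique]
  refine ⟨⟨fun a b => Subtype.ext ((eq_root h _).trans (eq_root h _).symm)⟩, ⟨T.root, ?_⟩⟩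
  rintro ⟨n, hn⟩
  exact h ⟨n, hn⟩

/-- Counting: without leaves `t ∘ p` would map `M` onto `A`, whereas `s` together with the root
embeds a set with one element more than `M` into `A`. -/
theorem numLeaves_pos (hp : Function.Surjective T.p) : 0 < T.numLeaves := by
  have : Nonempty {a : T.A // a ∉ Set.range T.t} := by
    by_contra h
    rw [not_nonempty_iff] at h
    have ht : Function.Surjective T.t := fun a => by_contra fun ha => h.false ⟨a, ha⟩
    have hs : Function.Surjective (T.t ∘ T.p) := ht.comp hp
    have h1 := Nat.card_le_card_of_surjective _ hs
    have h2 : Nat.card (Option T.M) ≤ Nat.card T.A := by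
      refine Nat.card_le_card_of_injective (fun x => x.elim T.root T.s) ?_
      rintro (_ | m) (_ | m') h
      · rfl
      · exact (T.s_ne_root m' h.symm).elim
      · exact (T.s_ne_root m h).elim
      · exact congrArg some (T.s_inj h)
    rw [Finite.card_option] at h2
    omega
  exact Nat.card_pos

end OpTree

/-! ## The groupoid of `P`-trees -/

namespace PolyEndo

variable {P : PolyEndo.{u, v}}

namespace PTree

variable {S T : PTree P}

/-- The arrow between colours underlying a morphism, with a free target edge. -/
def Hom.colourHom (f : Hom S T) {a : S.tree.A} {a' : T.tree.A} (h : f.fA a = a') :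
    S.colour a ⟶ T.colour a' :=
  f.cA a ≫ eqToHom (congrArg T.colour h)

/-- The arrow between marks underlying a morphism, with a free target. -/
def Hom.markHom (f : Hom S T) {m : S.tree.M} {m' : T.tree.M} (h : f.fM m = m') :
    S.mark m ⟶ T.mark m' :=
  f.cM m ≫ eqToHom (congrArg T.mark h)

/-- The arrow between operations underlying a morphism, with a free target node. -/
def Hom.opHom (f : Hom S T) {n : S.tree.N} {n' : T.tree.N} (h : f.fN n = n') :
    S.op n ⟶ T.op n' :=
  f.cN n ≫ eqToHom (congrArg T.op h)

/-- With the target index free, the `eqToHom` of `nat_s` is absorbed into `colourHom`; later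
arguments can then rewrite along equalities of edges, marks and nodes without transporting arrows.
-/
theorem Hom.naturality_s (f : Hom S T) {m : S.tree.M} {m' : T.tree.M} (hm : f.fM m = m')
    (hs : f.fA (S.tree.s m) = T.tree.s m') :
    S.isoS m ≫ f.colourHom hs = P.s.map (f.markHom hm) ≫ T.isoS m' := by
  subst hm
  simpa [colourHom, markHom] using f.nat_s m

theorem Hom.naturality_p (f : Hom S T) {m : S.tree.M} {m' : T.tree.M} (hm : f.fM m = m')
    (hs : f.fN (S.tree.p m) = T.tree.p m') :
    S.isoP m ≫ f.opHom hs = P.p.map (f.markHom hm) ≫ T.isoP m' := by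
  subst hm
  simpa [opHom, markHom] using f.nat_p m

theorem Hom.naturality_t (f : Hom S T) {n : S.tree.N} {n' : T.tree.N} (hn : f.fN n = n')
    (hs : f.fA (S.tree.t n) = T.tree.t n') :
    S.isoT n ≫ f.colourHom hs = P.t.map (f.opHom hn) ≫ T.isoT n' := by
  subst hn
  simpa [colourHom, opHom] using f.nat_t n

/-- Constructor for morphisms whose arrows are given with free targets. -/
def Hom.ofFamilies (fA : S.tree.A ≃ T.tree.A) (fM : S.tree.M ≃ T.tree.M)
    (fN : S.tree.N ≃ T.tree.N)
    (comm_s : ∀ m, fA (S.tree.s m) = T.tree.s (fM m))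
    (comm_p : ∀ m, fN (S.tree.p m) = T.tree.p (fM m))
    (comm_t : ∀ n, fA (S.tree.t n) = T.tree.t (fN n))
    (cA : ∀ a a', fA a = a' → (S.colour a ⟶ T.colour a'))
    (cM : ∀ m m', fM m = m' → (S.mark m ⟶ T.mark m'))
    (cN : ∀ n n', fN n = n' → (S.op n ⟶ T.op n'))
    (nat_s : ∀ m m' (hm : fM m = m') (hs : fA (S.tree.s m) = T.tree.s m'),
      S.isoS m ≫ cA _ _ hs = P.s.map (cM _ _ hm) ≫ T.isoS m')
    (nat_p : ∀ m m' (hm : fM m = m') (hs : fN (S.tree.p m) = T.tree.p m'),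
      S.isoP m ≫ cN _ _ hs = P.p.map (cM _ _ hm) ≫ T.isoP m')
    (nat_t : ∀ n n' (hn : fN n = n') (hs : fA (S.tree.t n) = T.tree.t n'),
      S.isoT n ≫ cA _ _ hs = P.t.map (cN _ _ hn) ≫ T.isoT n') : Hom S T where
  fA := fA
  fM := fM
  fN := fN
  comm_s := comm_s
  comm_p := comm_p
  comm_t := comm_t
  cA a := cA a _ rfl
  cM m := cM m _ rfl
  cN n := cN n _ rfl
  nat_s m := by
    have h : ∀ a a' (h : fA a = a'), cA a _ rfl ≫ eqToHom (congrArg T.colour h) = cA a a' h := by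
      rintro a _ rfl
      simp
    rw [h]
    exact nat_s m _ rfl (comm_s m)
  nat_p m := by
    have h : ∀ a a' (h : fN a = a'), cN a _ rfl ≫ eqToHom (congrArg T.op h) = cN a a' h := by
      rintro a _ rfl
      simp
    rw [h]
    exact nat_p m _ rfl (comm_p m)
  nat_t n := by
    have h : ∀ a a' (h : fA a = a'), cA a _ rfl ≫ eqToHom (congrArg T.colour h) = cA a a' h := by
      rintro a _ rfl
      simp
    rw [h]
    exact nat_t n _ rfl (comm_t n)

theorem Hom.ext_of_forall {f g : Hom S T} (hA : ∀ a, f.fA a = g.fA a)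
    (hM : ∀ m, f.fM m = g.fM m) (hN : ∀ n, f.fN n = g.fN n)
    (hcA : ∀ a a' (h : f.fA a = a') (h' : g.fA a = a'), f.colourHom h = g.colourHom h')
    (hcM : ∀ m m' (h : f.fM m = m') (h' : g.fM m = m'), f.markHom h = g.markHom h')
    (hcN : ∀ n n' (h : f.fN n = n') (h' : g.fN n = n'), f.opHom h = g.opHom h') : f = g := by
  rcases f with ⟨fA, fM, fN, fs, fp, ft, cA, cM, cN, ns, np, nt⟩
  rcases g with ⟨gA, gM, gN, gs, gp, gt, dA, dM, dN, os, op, ot⟩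
  obtain rfl : fA = gA := Equiv.ext hA
  obtain rfl : fM = gM := Equiv.ext hM
  obtain rfl : fN = gN := Equiv.ext hN
  obtain rfl : cA = dA := by
    funext a
    simpa [colourHom] using hcA a _ rfl rfl
  obtain rfl : cM = dM := by
    funext a
    simpa [markHom] using hcM a _ rfl rfl
  obtain rfl : cN = dN := by
    funext a
    simpa [opHom] using hcN a _ rfl rfl
  rfl

theorem comp_colourHom {U : PTree P} (f : S ⟶ T) (g : T ⟶ U) {a : S.tree.A} {a' : T.tree.A}
    {a'' : U.tree.A} (h : Hom.fA f a = a') (h' : Hom.fA g a' = a'')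
    (h'' : Hom.fA (f ≫ g) a = a'') :
    Hom.colourHom (f ≫ g) h'' = Hom.colourHom f h ≫ Hom.colourHom g h' := by
  subst h h'
  change (Hom.cA f a ≫ Hom.cA g _) ≫ 𝟙 _ = (Hom.cA f a ≫ 𝟙 _) ≫ Hom.cA g _ ≫ 𝟙 _
  simp only [Category.comp_id]

theorem comp_markHom {U : PTree P} (f : S ⟶ T) (g : T ⟶ U) {a : S.tree.M} {a' : T.tree.M}
    {a'' : U.tree.M} (h : Hom.fM f a = a') (h' : Hom.fM g a' = a'')
    (h'' : Hom.fM (f ≫ g) a = a'') :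
    Hom.markHom (f ≫ g) h'' = Hom.markHom f h ≫ Hom.markHom g h' := by
  subst h h'
  change (Hom.cM f a ≫ Hom.cM g _) ≫ 𝟙 _ = (Hom.cM f a ≫ 𝟙 _) ≫ Hom.cM g _ ≫ 𝟙 _
  simp only [Category.comp_id]

theorem comp_opHom {U : PTree P} (f : S ⟶ T) (g : T ⟶ U) {a : S.tree.N} {a' : T.tree.N}
    {a'' : U.tree.N} (h : Hom.fN f a = a') (h' : Hom.fN g a' = a'')
    (h'' : Hom.fN (f ≫ g) a = a'') :
    Hom.opHom (f ≫ g) h'' = Hom.opHom f h ≫ Hom.opHom g h' := by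
  subst h h'
  change (Hom.cN f a ≫ Hom.cN g _) ≫ 𝟙 _ = (Hom.cN f a ≫ 𝟙 _) ≫ Hom.cN g _ ≫ 𝟙 _
  simp only [Category.comp_id]

/-- The inverse of a morphism of `P`-trees. -/
def Hom.symm (f : Hom S T) : Hom T S :=
  Hom.ofFamilies f.fA.symm f.fM.symm f.fN.symm
    (fun m => by rw [Equiv.symm_apply_eq, f.comm_s, Equiv.apply_symm_apply])
    (fun m => by rw [Equiv.symm_apply_eq, f.comm_p, Equiv.apply_symm_apply])
    (fun m => by rw [Equiv.symm_apply_eq, f.comm_t, Equiv.apply_symm_apply])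
    (fun _ _ h => inv (f.colourHom ((Equiv.symm_apply_eq _).1 h).symm))
    (fun _ _ h => inv (f.markHom ((Equiv.symm_apply_eq _).1 h).symm))
    (fun _ _ h => inv (f.opHom ((Equiv.symm_apply_eq _).1 h).symm))
    (fun m m' hm hs => by
      rw [IsIso.comp_inv_eq, Category.assoc,
        f.naturality_s ((Equiv.symm_apply_eq _).1 hm).symm, Functor.map_inv, IsIso.inv_hom_id_assoc])
    (fun m m' hm hs => by
      rw [IsIso.comp_inv_eq, Category.assoc,
        f.naturality_p ((Equiv.symm_apply_eq _).1 hm).symm, Functor.map_inv, IsIso.inv_hom_id_assoc])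
    (fun m m' hm hs => by
      rw [IsIso.comp_inv_eq, Category.assoc,
        f.naturality_t ((Equiv.symm_apply_eq _).1 hm).symm, Functor.map_inv, IsIso.inv_hom_id_assoc])

theorem Hom.symm_colourHom (f : Hom S T) {a : S.tree.A} {a' : T.tree.A}
    (h : f.fA a = a') (h' : f.symm.fA a' = a) : f.symm.colourHom h' = inv (f.colourHom h) := by
  subst h'
  exact Category.comp_id _

theorem Hom.symm_markHom (f : Hom S T) {a : S.tree.M} {a' : T.tree.M}
    (h : f.fM a = a') (h' : f.symm.fM a' = a) : f.symm.markHom h' = inv (f.markHom h) := by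
  subst h'
  exact Category.comp_id _

theorem Hom.symm_opHom (f : Hom S T) {a : S.tree.N} {a' : T.tree.N}
    (h : f.fN a = a') (h' : f.symm.fN a' = a) : f.symm.opHom h' = inv (f.opHom h) := by
  subst h'
  exact Category.comp_id _

instance : IsGroupoid (PTree P) where
  all_isIso {S T} f := by
    refine ⟨Hom.symm f, ?_, ?_⟩
    · refine Hom.ext_of_forall (fun a => (Hom.fA f).symm_apply_apply a)
        (fun a => (Hom.fM f).symm_apply_apply a) (fun a => (Hom.fN f).symm_apply_apply a) ?_ ?_ ?_
      · rintro a _ h rfl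
        refine (comp_colourHom f (Hom.symm f) rfl h h).trans ?_
        refine (congrArg (_ ≫ ·) (Hom.symm_colourHom f rfl h)).trans ?_
        exact (IsIso.hom_inv_id _).trans (Category.id_comp (𝟙 _)).symm
      · rintro a _ h rfl
        refine (comp_markHom f (Hom.symm f) rfl h h).trans ?_
        refine (congrArg (_ ≫ ·) (Hom.symm_markHom f rfl h)).trans ?_
        exact (IsIso.hom_inv_id _).trans (Category.id_comp (𝟙 _)).symm
      · rintro a _ h rfl
        refine (comp_opHom f (Hom.symm f) rfl h h).trans ?_
        refine (congrArg (_ ≫ ·) (Hom.symm_opHom f rfl h)).trans ?_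
        exact (IsIso.hom_inv_id _).trans (Category.id_comp (𝟙 _)).symm
    · refine Hom.ext_of_forall (fun a => (Hom.fA f).apply_symm_apply a)
        (fun a => (Hom.fM f).apply_symm_apply a) (fun a => (Hom.fN f).apply_symm_apply a) ?_ ?_ ?_
      · rintro a _ h rfl
        have h1 : Hom.fA f ((Hom.fA f).symm a) = a := (Hom.fA f).apply_symm_apply a
        refine (comp_colourHom (Hom.symm f) f rfl h1 h).trans ?_
        refine (congrArg (· ≫ _) (Hom.symm_colourHom f h1 rfl)).trans ?_
        exact (IsIso.inv_hom_id _).trans (Category.id_comp (𝟙 _)).symm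
      · rintro a _ h rfl
        have h1 : Hom.fM f ((Hom.fM f).symm a) = a := (Hom.fM f).apply_symm_apply a
        refine (comp_markHom (Hom.symm f) f rfl h1 h).trans ?_
        refine (congrArg (· ≫ _) (Hom.symm_markHom f h1 rfl)).trans ?_
        exact (IsIso.inv_hom_id _).trans (Category.id_comp (𝟙 _)).symm
      · rintro a _ h rfl
        have h1 : Hom.fN f ((Hom.fN f).symm a) = a := (Hom.fN f).apply_symm_apply a
        refine (comp_opHom (Hom.symm f) f rfl h1 h).trans ?_
        refine (congrArg (· ≫ _) (Hom.symm_opHom f h1 rfl)).trans ?_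
        exact (IsIso.inv_hom_id _).trans (Category.id_comp (𝟙 _)).symm

theorem numLeaves_invariant : ArrowInvariant fun T : PTree P => T.tree.numLeaves := by
  intro S T f
  refine Nat.card_congr ((Hom.fA f).subtypeEquiv fun a => not_congr ?_)
  constructor
  · rintro ⟨n, rfl⟩
    exact ⟨_, (Hom.comm_t f n).symm⟩
  · rintro ⟨n, hn⟩
    refine ⟨(Hom.fN f).symm n, (Hom.fA f).injective ?_⟩
    rw [Hom.comm_t, Equiv.apply_symm_apply, hn]

theorem HasCore.of_hom (f : S ⟶ T) {τ : CombTree} (h : HasCore S.tree τ) : HasCore T.tree τ := by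
  obtain ⟨e, h1, h2⟩ := h
  have ht : ∀ n, (Hom.fA f) (S.tree.t ((Hom.fN f).symm n)) = T.tree.t n := fun n => by
    rw [Hom.comm_t, Equiv.apply_symm_apply]
  refine ⟨(Hom.fN f).symm.trans e, fun n hn => h1 _ ?_, fun n m hnm => ?_⟩
  · apply (Hom.fA f).injective
    rw [ht, hn]
    exact (Hom.map_root f).symm
  · obtain ⟨m, rfl⟩ := (Hom.fM f).surjective m
    have := h2 ((Hom.fN f).symm n) m ((Hom.fA f).injective (by rw [ht, hnm, Hom.comm_s]))
    rw [Equiv.trans_apply, this, Equiv.trans_apply, ← Hom.comm_p, Equiv.symm_apply_apply]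

theorem hasCore_invariant (τ : CombTree) :
    ArrowInvariant fun T : PTree P => HasCore T.tree τ := fun _ _ f =>
  propext ⟨HasCore.of_hom f, HasCore.of_hom (inv f)⟩

theorem rooted_invariant : ArrowInvariant fun T : PTree P => T.tree.Rooted := fun _ _ f =>
  propext ⟨fun ⟨n, _⟩ => OpTree.rooted_of_node (Hom.fN f n),
    fun ⟨n, _⟩ => OpTree.rooted_of_node ((Hom.fN f).symm n)⟩

theorem p_surjective (harity : ∀ b : P.B, P.arity b ≠ 0) (T : PTree P) :
    Function.Surjective T.tree.p := by
  intro n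
  have : Nonempty (PiZero (P.Fib (T.op n))) := (Nat.card_ne_zero.1 (harity (T.op n))).1
  obtain ⟨m, hm⟩ := T.cart.2 ⟨n, Classical.arbitrary _⟩
  exact ⟨m, congrArg Sigma.fst hm⟩

theorem numLeaves_pos (harity : ∀ b : P.B, P.arity b ≠ 0) (T : PTree P) :
    0 < T.tree.numLeaves :=
  OpTree.numLeaves_pos (p_surjective harity T)

/-! ### The trivial tree -/

/-- The tree without nodes, of a given colour. -/
def trivialTree (i : P.I) : PTree P where
  tree :=
    { A := PUnit
      M := PEmpty
      N := PEmpty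
      finA := inferInstance
      finM := inferInstance
      finN := inferInstance
      s := PEmpty.elim
      p := id
      t := PEmpty.elim
      t_inj := fun x => x.elim
      s_inj := fun x => x.elim
      root := PUnit.unit
      not_mem_range_s := fun _ => ⟨fun _ => rfl, fun _ h => h.choose.elim⟩
      walk := fun _ => Relation.ReflTransGen.refl }
  colour _ := i
  mark := fun x => x.elim
  op := fun x => x.elim
  isoS := fun x => x.elim
  isoP := fun x => x.elim
  isoT := fun x => x.elim
  cart := ⟨fun x => x.elim, fun x => x.1.elim⟩

theorem trivialTree_not_rooted (i : P.I) : ¬ (trivialTree i).tree.Rooted := fun ⟨n, _⟩ => n.elim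

/-- A tree without nodes is determined by the colour of its root edge. -/
def trivialTreeHom {i : P.I} (T : PTree P) (h : ¬ T.tree.Rooted)
    (r : i ⟶ T.colour T.tree.root) : trivialTree i ⟶ T :=
  have := OpTree.isEmpty_node h
  have := OpTree.isEmpty_mark h
  Hom.ofFamilies (S := trivialTree i)
    { toFun := fun _ => T.tree.root
      invFun := fun _ => PUnit.unit
      left_inv := fun _ => rfl
      right_inv := fun a => (OpTree.eq_root h a).symm }
    (Equiv.equivOfIsEmpty PEmpty T.tree.M) (Equiv.equivOfIsEmpty PEmpty T.tree.N)
    (fun m => m.elim) (fun m => m.elim) (fun n => n.elim)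
    (fun _ _ h => r ≫ eqToHom (congrArg T.colour h))
    (fun m => m.elim) (fun n => n.elim) (fun m => m.elim) (fun m => m.elim) (fun n => n.elim)

end PTree

end PolyEndo

/-! ## Grafting of trees -/

namespace OpTree

/-- Grafting a family of operadic trees onto the input edges of a corolla. -/
def graft {ι : Type} [Finite ι] (F : ι → OpTree) : OpTree where
  A := Option (Σ k, (F k).A)
  M := ι ⊕ Σ k, (F k).M
  N := Option (Σ k, (F k).N)
  finA := inferInstance
  finM := inferInstance
  finN := inferInstance
  s := fun x => match x with
    -- The `k`-th input edge of the corolla is identified with the root edge of `F k`, so the only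
    -- new edge is the root `none`.
    | Sum.inl k => some ⟨k, (F k).root⟩
    | Sum.inr m => some ⟨m.1, (F m.1).s m.2⟩
  p := fun x => match x with
    | Sum.inl _ => none
    | Sum.inr m => some ⟨m.1, (F m.1).p m.2⟩
  t := fun x => match x with
    | none => none
    | some n => some ⟨n.1, (F n.1).t n.2⟩
  t_inj := by
    rintro (_ | ⟨k, n⟩) (_ | ⟨k', n'⟩) h
    · rfl
    · cases h
    · cases h
    · simp only [Option.some.injEq, Sigma.mk.injEq] at h
      obtain ⟨rfl, h⟩ := h
      rw [(F k).t_inj (eq_of_heq h)]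
  s_inj := by
    rintro (k | ⟨k, m⟩) (k' | ⟨k', m'⟩) h
    · simp only [Option.some.injEq, Sigma.mk.injEq] at h
      rw [h.1]
    · simp only [Option.some.injEq, Sigma.mk.injEq] at h
      obtain ⟨rfl, h⟩ := h
      exact ((F k).s_ne_root m' (eq_of_heq h).symm).elim
    · simp only [Option.some.injEq, Sigma.mk.injEq] at h
      obtain ⟨rfl, h⟩ := h
      exact ((F k).s_ne_root m (eq_of_heq h)).elim
    · simp only [Option.some.injEq, Sigma.mk.injEq] at h
      obtain ⟨rfl, h⟩ := h
      rw [(F k).s_inj (eq_of_heq h)]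
  root := none
  not_mem_range_s := by
    rintro (_ | ⟨k, a⟩)
    · simp only [iff_true]
      rintro ⟨k | m, h⟩ <;> cases h
    · simp only [reduceCtorEq, iff_false, not_not]
      rcases (F k).eq_root_or_eq_s a with rfl | ⟨m, rfl⟩
      · exact ⟨Sum.inl k, rfl⟩
      · exact ⟨Sum.inr ⟨k, m⟩, rfl⟩
  walk := by
    rintro (_ | ⟨k, a⟩)
    · exact Relation.ReflTransGen.refl
    · refine (F k).edge_induction
        (C := fun a => Relation.ReflTransGen _ (some (⟨k, a⟩ : Σ k, (F k).A)) none) ?_ ?_ a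
      · exact Relation.ReflTransGen.single ⟨Sum.inl k, rfl, rfl⟩
      · exact fun m h => Relation.ReflTransGen.head ⟨Sum.inr ⟨k, m⟩, rfl, rfl⟩ h

theorem graft_rooted {ι : Type} [Finite ι] (F : ι → OpTree) : (graft F).Rooted := ⟨none, rfl⟩

/-- The new root edge is the output of the new node, hence no leaf, and inside a component being a
leaf is unchanged. A component without nodes contributes its single edge, which becomes an input of
the corolla and stays a leaf. -/
theorem numLeaves_graft {ι : Type} [Fintype ι] (F : ι → OpTree) :
    (graft F).numLeaves = ∑ k, (F k).numLeaves := by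
  let e : (Σ k, {a : (F k).A // a ∉ Set.range (F k).t}) ≃
      {a : (graft F).A // a ∉ Set.range (graft F).t} := by
    refine Equiv.ofBijective (fun x => ⟨some ⟨x.1, x.2.1⟩, ?_⟩) ⟨?_, ?_⟩
    · rintro ⟨_ | ⟨k, n⟩, h⟩
      · cases h
      · obtain ⟨k', a, ha⟩ := x
        simp only [graft, Option.some.injEq, Sigma.mk.injEq] at h
        obtain ⟨rfl, h⟩ := h
        exact ha ⟨n, eq_of_heq h⟩
    · rintro ⟨k, a, ha⟩ ⟨k', a', ha'⟩ h
      replace h : some (⟨k, a⟩ : Σ k, (F k).A) = some ⟨k', a'⟩ := congrArg Subtype.val h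
      simp only [Option.some.injEq, Sigma.mk.injEq] at h
      obtain ⟨rfl, h⟩ := h
      obtain rfl := eq_of_heq h
      rfl
    · rintro ⟨_ | ⟨k, a⟩, ha⟩
      · exact (ha ⟨none, rfl⟩).elim
      · refine ⟨⟨k, a, ?_⟩, rfl⟩
        rintro ⟨n, rfl⟩
        exact ha ⟨some ⟨k, n⟩, rfl⟩
  rw [numLeaves, ← Nat.card_congr e, Nat.card_sigma]
  rfl

end OpTree

namespace PolyEndo

variable {P : PolyEndo.{u, v}}

variable (P) in
/-- The homotopy fibre over a colour of the groupoid of `P`-trees. -/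
abbrev TreesOver (i : P.I) := CostructuredArrow (PTree.rootColour (P := P)) i

/-- The arrow from the colour of the root edge of a tree over a colour. -/
def TreesOver.rootHom {i : P.I} (T : P.TreesOver i) :
    T.left.colour T.left.tree.root ⟶ i := T.hom

theorem TreesOver.colourHom_rootHom {i : P.I} {S T : P.TreesOver i} (f : S ⟶ T) :
    PTree.Hom.colourHom f.left (PTree.Hom.map_root f.left) ≫ T.rootHom = S.rootHom :=
  CostructuredArrow.w f

namespace PTree

theorem Hom.colourHom_eqToHom {S T : PTree P} (f : Hom S T) {a₁ a₂ : S.tree.A} {b₁ b₂ : T.tree.A}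
    (h : f.fA a₁ = b₁) (h' : f.fA a₂ = b₂) (ha : a₁ = a₂) (hb : b₁ = b₂) :
    f.colourHom h ≫ eqToHom (congrArg T.colour hb) =
      eqToHom (congrArg S.colour ha) ≫ f.colourHom h' := by
  subst ha hb
  simp

theorem Hom.opHom_eqToHom {S T : PTree P} (f : Hom S T) {a₁ a₂ : S.tree.N} {b₁ b₂ : T.tree.N}
    (h : f.fN a₁ = b₁) (h' : f.fN a₂ = b₂) (ha : a₁ = a₂) (hb : b₁ = b₂) :
    f.opHom h ≫ eqToHom (congrArg T.op hb) =
      eqToHom (congrArg S.op ha) ≫ f.opHom h' := by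
  subst ha hb
  simp

theorem Hom.map_root_node {S T : PTree P} (f : Hom S T) {n : S.tree.N} {n' : T.tree.N}
    (hn : S.tree.t n = S.tree.root) (hn' : T.tree.t n' = T.tree.root) : f.fN n = n' := by
  apply T.tree.t_inj
  rw [← f.comm_t, hn, f.map_root, hn']

/-- A tree with a root node, over a colour. -/
abbrev RootedOver (i : P.I) :=
  ObjectProperty.FullSubcategory fun T : P.TreesOver i => T.left.tree.Rooted

/-- The root node. -/
def RootedOver.node {i : P.I} (T : RootedOver i) : T.obj.left.tree.N := T.property.choose

theorem RootedOver.t_node {i : P.I} (T : RootedOver i) :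
    T.obj.left.tree.t T.node = T.obj.left.tree.root := T.property.choose_spec

/-- The operation decorating the root node. -/
def rootOp (i : P.I) : RootedOver i ⥤ P.OpsOver i where
  obj T := CostructuredArrow.mk (Y := T.obj.left.op T.node)
    -- The output colour of the root operation is carried to the colour of the root edge and from
    -- there to `i`.
    (T.obj.left.isoT T.node ≫ eqToHom (congrArg T.obj.left.colour T.t_node) ≫ T.obj.rootHom)
  map {S T} f := CostructuredArrow.homMk
    (Hom.opHom f.hom.left (Hom.map_root_node _ S.t_node T.t_node)) <| by
      have h1 := TreesOver.colourHom_rootHom f.hom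
      have h2 : Hom.fA f.hom.left (S.obj.left.tree.t S.node) = T.obj.left.tree.t T.node := by
        rw [S.t_node, T.t_node, Hom.map_root]
      have h3 := Hom.naturality_t f.hom.left (Hom.map_root_node _ S.t_node T.t_node) h2
      have h4 := Hom.colourHom_eqToHom f.hom.left h2 (Hom.map_root f.hom.left) S.t_node T.t_node
      change P.t.map _ ≫ T.obj.left.isoT T.node ≫ _ ≫ T.obj.rootHom =
        S.obj.left.isoT S.node ≫ _ ≫ S.obj.rootHom
      rw [← reassoc_of% h3, reassoc_of% h4, h1]
  map_id T := by
    ext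
    exact Category.id_comp _
  map_comp {S T U} f g := by
    apply CostructuredArrow.hom_ext
    exact comp_opHom f.hom.left g.hom.left (Hom.map_root_node _ S.t_node T.t_node)
      (Hom.map_root_node _ T.t_node U.t_node) (Hom.map_root_node _ S.t_node U.t_node)

section Graft

variable {i : P.I} {β : P.OpsOver i} {ι : Type} [Finite ι] (e : ι → P.Fib β.left)

/-- The colours of the edges of a grafted tree. -/
def graftColour (i : P.I) (T : ∀ k, P.TreesOver (P.s.obj (e k).left)) :
    (OpTree.graft fun k => (T k).left.tree).A → P.I
  | none => i
  | some a => (T a.1).left.colour a.2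

/-- The marks of a grafted tree. -/
def graftMark (T : ∀ k, P.TreesOver (P.s.obj (e k).left)) :
    (OpTree.graft fun k => (T k).left.tree).M → P.E
  | Sum.inl k => (e k).left
  | Sum.inr m => (T m.1).left.mark m.2

/-- The operations of a grafted tree. -/
def graftOp (T : ∀ k, P.TreesOver (P.s.obj (e k).left)) :
    (OpTree.graft fun k => (T k).left.tree).N → P.B
  | none => β.left
  | some n => (T n.1).left.op n.2

/-- The structural arrows over `p` of a grafted tree. -/
def graftIsoP (T : ∀ k, P.TreesOver (P.s.obj (e k).left)) :
    ∀ m, P.p.obj (graftMark e T m) ⟶ graftOp e T ((OpTree.graft fun k => (T k).left.tree).p m)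
  | Sum.inl k => (e k).hom
  | Sum.inr m => (T m.1).left.isoP m.2

theorem sigma_some_injective {X : Type*} {F : Option X → Type*} :
    Function.Injective fun x : Σ n : X, F (some n) => (⟨some x.1, x.2⟩ : Σ n, F n) := by
  rintro ⟨n, c⟩ ⟨n', c'⟩ h
  simp only [Sigma.mk.injEq, Option.some.injEq] at h
  obtain ⟨rfl, h⟩ := h
  rw [eq_of_heq h]

theorem sigma_fiber_injective {K : Type*} {X : K → Type*} {F : (Σ k, X k) → Type*} (k : K) :
    Function.Injective fun x : Σ n : X k, F ⟨k, n⟩ => (⟨⟨k, x.1⟩, x.2⟩ : Σ n, F n) := by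
  rintro ⟨n, c⟩ ⟨n', c'⟩ h
  simp only [Sigma.mk.injEq, heq_eq_eq, true_and] at h
  obtain ⟨rfl, h⟩ := h
  rw [eq_of_heq h]

/-- Over the new node the inputs are enumerated by `he`; over every other node the condition is that
of the component containing it. -/
theorem graft_cart (he : Function.Bijective fun k => PiZero.mk (e k))
    (T : ∀ k, P.TreesOver (P.s.obj (e k).left)) :
    Function.Bijective fun m => (⟨(OpTree.graft fun k => (T k).left.tree).p m,
      PiZero.mk (CostructuredArrow.mk (graftIsoP e T m))⟩ :
        Σ n, PiZero (P.Fib (graftOp e T n))) := by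
  let F : (OpTree.graft fun k => (T k).left.tree).N → Type _ := fun n =>
    PiZero (P.Fib (graftOp e T n))
  constructor
  · rintro (k | ⟨k, m⟩) (k' | ⟨k', m'⟩) h
    · exact congrArg Sum.inl (he.1 (eq_of_heq (Sigma.mk.inj h).2))
    · exact absurd (congrArg Sigma.fst h) (Option.some_ne_none _).symm
    · exact absurd (congrArg Sigma.fst h) (Option.some_ne_none _)
    · have h1 := sigma_some_injective (F := F)
        (a₁ := ⟨⟨k, (T k).left.tree.p m⟩, PiZero.mk (CostructuredArrow.mk ((T k).left.isoP m))⟩)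
        (a₂ := ⟨⟨k', (T k').left.tree.p m'⟩,
          PiZero.mk (CostructuredArrow.mk ((T k').left.isoP m'))⟩) h
      obtain rfl : k = k' := congrArg (fun x => x.1.1) h1
      rw [(T k).left.cart.1 (sigma_fiber_injective (F := fun n => F (some n)) k h1)]
  · rintro ⟨_ | ⟨k, n⟩, c⟩
    · obtain ⟨k, rfl⟩ := he.2 c
      exact ⟨Sum.inl k, rfl⟩
    · obtain ⟨m, hm⟩ := (T k).left.cart.2 ⟨n, c⟩
      refine ⟨Sum.inr ⟨k, m⟩, ?_⟩
      exact congrArg (fun x : Σ n, PiZero (P.Fib ((T k).left.op n)) =>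
        (⟨some ⟨k, x.1⟩, x.2⟩ : Σ n, F n)) hm

/-- Grafting a family of `P`-trees onto the inputs of an operation. -/
def graft (he : Function.Bijective fun k => PiZero.mk (e k))
    (T : ∀ k, P.TreesOver (P.s.obj (e k).left)) : PTree P where
  tree := OpTree.graft fun k => (T k).left.tree
  colour := graftColour e i T
  mark := graftMark e T
  op := graftOp e T
  isoS := fun x => match x with
    -- The structure of `T k` over its colour points into `s (e k)`, while `isoS` points out of it.
    | Sum.inl k => (inv (T k).rootHom :
        P.s.obj (e k).left ⟶ (T k).left.colour (T k).left.tree.root)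
    | Sum.inr m => (T m.1).left.isoS m.2
  isoP := graftIsoP e T
  isoT := fun x => match x with
    | none => β.hom
    | some n => (T n.1).left.isoT n.2
  cart := graft_cart e he T

variable {e} (he : Function.Bijective fun k => PiZero.mk (e k))
  (T U : ∀ k, P.TreesOver (P.s.obj (e k).left))

variable {T U} in
/-- Grafting of morphisms. -/
def graftMap (g : ∀ k, T k ⟶ U k) : Hom (graft e he T) (graft e he U) where
  fA := Equiv.optionCongr (Equiv.sigmaCongrRight fun k => Hom.fA (g k).left)
  fM := Equiv.sumCongr (Equiv.refl ι) (Equiv.sigmaCongrRight fun k => Hom.fM (g k).left)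
  fN := Equiv.optionCongr (Equiv.sigmaCongrRight fun k => Hom.fN (g k).left)
  comm_s := by
    rintro (k | ⟨k, m⟩)
    · exact congrArg (fun a => some (⟨k, a⟩ : Σ k, (U k).left.tree.A)) (Hom.map_root (g k).left)
    · exact congrArg (fun a => some (⟨k, a⟩ : Σ k, (U k).left.tree.A)) (Hom.comm_s (g k).left m)
  comm_p := by
    rintro (k | ⟨k, m⟩)
    · rfl
    · exact congrArg (fun a => some (⟨k, a⟩ : Σ k, (U k).left.tree.N)) (Hom.comm_p (g k).left m)
  comm_t := by
    rintro (_ | ⟨k, m⟩)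
    · rfl
    · exact congrArg (fun a => some (⟨k, a⟩ : Σ k, (U k).left.tree.A)) (Hom.comm_t (g k).left m)
  cA := fun x => match x with
    | none => 𝟙 i
    | some a => Hom.cA (g a.1).left a.2
  cM := fun x => match x with
    | Sum.inl k => 𝟙 (e k).left
    | Sum.inr m => Hom.cM (g m.1).left m.2
  cN := fun x => match x with
    | none => 𝟙 β.left
    | some n => Hom.cN (g n.1).left n.2
  nat_s := by
    rintro (k | ⟨k, m⟩)
    -- Naturality at an input of the corolla is exactly the commuting triangle of `g k` over
    -- `P.s.obj (e k).left`.
    · change inv (T k).rootHom ≫ Hom.colourHom (g k).left (Hom.map_root (g k).left) =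
            P.s.map (𝟙 (e k).left) ≫ inv (U k).rootHom
      rw [IsIso.inv_comp_eq, ← TreesOver.colourHom_rootHom (g k), CategoryTheory.Functor.map_id, Category.id_comp,
        Category.assoc, IsIso.hom_inv_id, Category.comp_id]
    · exact Hom.nat_s (g k).left m
  nat_p := by
    rintro (k | ⟨k, m⟩)
    · change (e k).hom ≫ 𝟙 β.left ≫ 𝟙 β.left = P.p.map (𝟙 (e k).left) ≫ (e k).hom
      simp
    · exact Hom.nat_p (g k).left m
  nat_t := by
    rintro (_ | ⟨k, m⟩)
    · change β.hom ≫ 𝟙 i ≫ 𝟙 i = P.t.map (𝟙 β.left) ≫ β.hom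
      simp
    · exact Hom.nat_t (g k).left m

end Graft

theorem Hom.colourHom_congr {S T : PTree P} {f g : Hom S T} (hfg : f = g) {a : S.tree.A}
    {a' : T.tree.A} (h : f.fA a = a') (h' : g.fA a = a') : f.colourHom h = g.colourHom h' := by
  subst hfg
  rfl

theorem Hom.markHom_congr {S T : PTree P} {f g : Hom S T} (hfg : f = g) {a : S.tree.M}
    {a' : T.tree.M} (h : f.fM a = a') (h' : g.fM a = a') : f.markHom h = g.markHom h' := by
  subst hfg
  rfl

theorem Hom.opHom_congr {S T : PTree P} {f g : Hom S T} (hfg : f = g) {a : S.tree.N}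
    {a' : T.tree.N} (h : f.fN a = a') (h' : g.fN a = a') : f.opHom h = g.opHom h' := by
  subst hfg
  rfl

/-- An equivalence restricts to matching parts of its ends. -/
theorem exists_equiv_restrict {X Y W W' : Type*} (F : W ≃ W') {p : X → W} {q : Y → W'}
    (hp : Function.Injective p) (hq : Function.Injective q) (h1 : ∀ x, ∃ y, F (p x) = q y)
    (h2 : ∀ y, ∃ x, F.symm (q y) = p x) : ∃ E : X ≃ Y, ∀ x, F (p x) = q (E x) := by
  choose φ hφ using h1
  refine ⟨Equiv.ofBijective φ ⟨fun x x' h => hp (F.injective ?_), fun y => ?_⟩, hφ⟩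
  · rw [hφ, hφ, h]
  · obtain ⟨x, hx⟩ := h2 y
    refine ⟨x, hq ?_⟩
    rw [← hφ, ← hx, Equiv.apply_symm_apply]

theorem some_mk_injective {K : Type*} {X : K → Type*} (k : K) :
    Function.Injective fun x : X k => some (⟨k, x⟩ : Σ k, X k) :=
  fun _ _ h => sigma_mk_injective (Option.some_injective _ h)

theorem inr_mk_injective {K : Type*} {X : K → Type*} (k : K) :
    Function.Injective fun x : X k => (Sum.inr ⟨k, x⟩ : K ⊕ Σ k, X k) :=
  fun _ _ h => sigma_mk_injective (Sum.inr_injective h)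

theorem inv_eq_id_of_eq {D : Type*} [Groupoid D] {x : D} {f : x ⟶ x} (h : f = 𝟙 x) :
    CategoryTheory.inv f = 𝟙 x := by
  subst h
  exact IsIso.inv_id

theorem comp_eq_of_inv_comp_eq {D : Type*} [Groupoid D] {x y z : D} {f : x ⟶ z} {g : y ⟶ z}
    {c : x ⟶ y} {d : z ⟶ z} (h : CategoryTheory.inv f ≫ c = d ≫ CategoryTheory.inv g)
    (hd : d = 𝟙 z) : c ≫ g = f := by
  subst hd
  rw [IsIso.inv_comp_eq] at h
  rw [h]
  simp

/-! ### Morphisms between grafted trees -/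

section Graft

variable {i : P.I} {β : P.OpsOver i} {ι : Type} [Finite ι] {e : ι → P.Fib β.left}
  {he : Function.Bijective fun k => PiZero.mk (e k)}
  {T U : ∀ k, P.TreesOver (P.s.obj (e k).left)}

theorem graftMap_colourHom (g : ∀ k, T k ⟶ U k) {k : ι} {a : (T k).left.tree.A}
    {a' : (U k).left.tree.A} (h' : Hom.fA (g k).left a = a')
    (h : (graftMap he g).fA (some ⟨k, a⟩) = some ⟨k, a'⟩) :
    (graftMap he g).colourHom h = Hom.colourHom (g k).left h' := by
  subst h'
  rfl

theorem graftMap_markHom (g : ∀ k, T k ⟶ U k) {k : ι} {a : (T k).left.tree.M}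
    {a' : (U k).left.tree.M} (h' : Hom.fM (g k).left a = a')
    (h : (graftMap he g).fM (Sum.inr ⟨k, a⟩) = Sum.inr ⟨k, a'⟩) :
    (graftMap he g).markHom h = Hom.markHom (g k).left h' := by
  subst h'
  rfl

theorem graftMap_opHom (g : ∀ k, T k ⟶ U k) {k : ι} {a : (T k).left.tree.N}
    {a' : (U k).left.tree.N} (h' : Hom.fN (g k).left a = a')
    (h : (graftMap he g).fN (some ⟨k, a⟩) = some ⟨k, a'⟩) :
    (graftMap he g).opHom h = Hom.opHom (g k).left h' := by
  subst h'
  rfl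

theorem graftMap_injective :
    Function.Injective fun g : ∀ k, T k ⟶ U k => graftMap he g := by
  intro g g' (hg : graftMap he g = graftMap he g')
  funext k
  apply CostructuredArrow.hom_ext
  refine Hom.ext_of_forall (fun a => ?_) (fun m => ?_) (fun n => ?_) ?_ ?_ ?_
  · have := congrArg (fun f => f.fA (some ⟨k, a⟩)) hg
    exact some_mk_injective (X := fun k => (U k).left.tree.A) k this
  · have := congrArg (fun f => f.fM (Sum.inr ⟨k, m⟩)) hg
    exact inr_mk_injective (X := fun k => (U k).left.tree.M) k this
  · have := congrArg (fun f => f.fN (some ⟨k, n⟩)) hg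
    exact some_mk_injective (X := fun k => (U k).left.tree.N) k this
  · intro a a' h h'
    rw [← graftMap_colourHom (he := he) g h
        (congrArg (fun x => some (⟨k, x⟩ : Σ k, (U k).left.tree.A)) h),
      ← graftMap_colourHom (he := he) g' h'
        (congrArg (fun x => some (⟨k, x⟩ : Σ k, (U k).left.tree.A)) h')]
    exact Hom.colourHom_congr hg _ _
  · intro a a' h h'
    rw [← graftMap_markHom (he := he) g h
        (congrArg (fun x => (Sum.inr ⟨k, x⟩ : ι ⊕ Σ k, (U k).left.tree.M)) h),
      ← graftMap_markHom (he := he) g' h'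
        (congrArg (fun x => (Sum.inr ⟨k, x⟩ : ι ⊕ Σ k, (U k).left.tree.M)) h')]
    exact Hom.markHom_congr hg _ _
  · intro a a' h h'
    rw [← graftMap_opHom (he := he) g h
        (congrArg (fun x => some (⟨k, x⟩ : Σ k, (U k).left.tree.N)) h),
      ← graftMap_opHom (he := he) g' h'
        (congrArg (fun x => some (⟨k, x⟩ : Σ k, (U k).left.tree.N)) h')]
    exact Hom.opHom_congr hg _ _

/-- A morphism of grafted trees is over the corolla if it is the identity on the root operation. -/
def OverCorolla (f : Hom (graft e he T) (graft e he U)) : Prop :=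
  ∃ h : f.fN none = none, f.opHom h = 𝟙 β.left

theorem OverCorolla.symm {f : Hom (graft e he T) (graft e he U)} (hf : OverCorolla f) :
    OverCorolla f.symm := by
  obtain ⟨h, hf⟩ := hf
  refine ⟨(Equiv.symm_apply_eq _).2 h.symm, ?_⟩
  exact (Hom.symm_opHom f h _).trans (inv_eq_id_of_eq hf)

/-- Marks over the root node go to marks over the root node. As `f` is the identity on the root
operation, its arrow at the mark `k` is a morphism of the fibre from `e k` to some `e k'`; distinct
indices enumerate distinct classes, so `k' = k`. -/
theorem OverCorolla.fM_inl {f : Hom (graft e he T) (graft e he U)} (hf : OverCorolla f) (k : ι) :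
    f.fM (Sum.inl k) = Sum.inl k := by
  obtain ⟨h0, hf⟩ := hf
  have h1 : none = (graft e he U).tree.p (f.fM (Sum.inl k)) := h0.symm.trans (f.comm_p (Sum.inl k))
  rcases hx : f.fM (Sum.inl k) with k' | m
  · have h2 : (e k).hom ≫ f.opHom h0 = P.p.map (f.markHom hx) ≫ (e k').hom := f.naturality_p hx h0
    have h3 : P.p.map (f.markHom hx : (e k).left ⟶ (e k').left) ≫ (e k').hom = (e k).hom := by
      rw [← h2, hf]
      exact Category.comp_id _
    have h4 : e k ⟶ e k' := CostructuredArrow.homMk (f.markHom hx) h3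
    rw [he.1 (PiZero.mk_eq_iff.2 ⟨h4⟩)]
  · rw [hx] at h1
    exact absurd h1 (Option.some_ne_none _).symm

/-- Discreteness of the fibres of `p` enters here: an endomorphism of `e k` in a thin category is
the identity. -/
theorem OverCorolla.markHom_inl (hP : P.Finitary) {f : Hom (graft e he T) (graft e he U)}
    (hf : OverCorolla f) (k : ι) : f.markHom (hf.fM_inl k) = 𝟙 (e k).left := by
  have hx := hf.fM_inl k
  obtain ⟨h0, hf⟩ := hf
  have h2 : (e k).hom ≫ f.opHom h0 = P.p.map (f.markHom hx) ≫ (e k).hom := f.naturality_p hx h0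
  have h3 : P.p.map (f.markHom hx : (e k).left ⟶ (e k).left) ≫ (e k).hom = (e k).hom := by
    rw [← h2, hf]
    exact Category.comp_id _
  have := (hP β.left).1
  exact congrArg CommaMorphism.left
    (Subsingleton.elim (CostructuredArrow.homMk (f.markHom hx) h3) (𝟙 (e k)))

/-- `f` respects the walk and fixes the inputs of the corolla, so induction from the root edge of
the `k`-th component upwards keeps its edges in the `k`-th component. -/
theorem OverCorolla.exists_fA {f : Hom (graft e he T) (graft e he U)} (hf : OverCorolla f)
    (k : ι) (a : (T k).left.tree.A) : ∃ a', f.fA (some ⟨k, a⟩) = some ⟨k, a'⟩ := by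
  refine (T k).left.tree.edge_induction (C := fun a => ∃ a', f.fA (some ⟨k, a⟩) = some ⟨k, a'⟩)
    ⟨(U k).left.tree.root, ?_⟩ ?_ a
  · have := f.comm_s (Sum.inl k)
    rw [hf.fM_inl] at this
    exact this
  · rintro m ⟨a', ha⟩
    have h1 := f.comm_t (some ⟨k, (T k).left.tree.p m⟩)
    have h2 := f.comm_p (Sum.inr ⟨k, m⟩)
    have h3 := f.comm_s (Sum.inr ⟨k, m⟩)
    have h4 : some ⟨k, a'⟩ = (graft e he U).tree.t (f.fN (some ⟨k, (T k).left.tree.p m⟩)) :=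
      ha.symm.trans h1
    have h5 : f.fN (some ⟨k, (T k).left.tree.p m⟩) =
      (graft e he U).tree.p (f.fM (Sum.inr ⟨k, m⟩)) := h2
    rw [h5] at h4
    rcases hx : f.fM (Sum.inr ⟨k, m⟩) with k' | ⟨k', m'⟩
    · rw [hx] at h4
      exact absurd h4 (Option.some_ne_none _)
    · rw [hx] at h4 h3
      obtain rfl : k = k' := congrArg Sigma.fst (Option.some_injective _ h4)
      exact ⟨_, h3⟩

theorem OverCorolla.exists_fN {f : Hom (graft e he T) (graft e he U)} (hf : OverCorolla f)
    (k : ι) (n : (T k).left.tree.N) : ∃ n', f.fN (some ⟨k, n⟩) = some ⟨k, n'⟩ := by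
  obtain ⟨a', ha⟩ := hf.exists_fA k ((T k).left.tree.t n)
  have h1 : some ⟨k, a'⟩ = (graft e he U).tree.t (f.fN (some ⟨k, n⟩)) :=
    ha.symm.trans (f.comm_t (some ⟨k, n⟩))
  rcases hx : f.fN (some ⟨k, n⟩) with _ | ⟨k', n'⟩
  · rw [hx] at h1
    exact absurd h1 (Option.some_ne_none _)
  · rw [hx] at h1
    obtain rfl : k = k' := congrArg Sigma.fst (Option.some_injective _ h1)
    exact ⟨_, rfl⟩

theorem OverCorolla.exists_fM {f : Hom (graft e he T) (graft e he U)} (hf : OverCorolla f)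
    (k : ι) (m : (T k).left.tree.M) : ∃ m', f.fM (Sum.inr ⟨k, m⟩) = Sum.inr ⟨k, m'⟩ := by
  obtain ⟨n', hn⟩ := hf.exists_fN k ((T k).left.tree.p m)
  have h1 : some ⟨k, n'⟩ = (graft e he U).tree.p (f.fM (Sum.inr ⟨k, m⟩)) :=
    hn.symm.trans (f.comm_p (Sum.inr ⟨k, m⟩))
  rcases hx : f.fM (Sum.inr ⟨k, m⟩) with k' | ⟨k', m'⟩
  · rw [hx] at h1
    exact absurd h1 (Option.some_ne_none _)
  · rw [hx] at h1
    obtain rfl : k = k' := congrArg Sigma.fst (Option.some_injective _ h1)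
    exact ⟨_, rfl⟩

/-- Both `f` and its inverse preserve the components, so `f` restricts to equivalences of them. The
arrows are recorded with free targets so that `graftMap` can be compared with `f` block by block. -/
theorem OverCorolla.exists_restrict (hP : P.Finitary) {f : Hom (graft e he T) (graft e he U)}
    (hf : OverCorolla f) (k : ι) : ∃ g : T k ⟶ U k,
      (∀ a, f.fA (some ⟨k, a⟩) = some ⟨k, Hom.fA g.left a⟩) ∧
      (∀ m, f.fM (Sum.inr ⟨k, m⟩) = Sum.inr ⟨k, Hom.fM g.left m⟩) ∧
      (∀ n, f.fN (some ⟨k, n⟩) = some ⟨k, Hom.fN g.left n⟩) ∧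
      (∀ a a' h h', Hom.colourHom g.left (a := a) (a' := a') h =
        f.colourHom (a := some ⟨k, a⟩) (a' := some ⟨k, a'⟩) h') ∧
      (∀ a a' h h', Hom.markHom g.left (m := a) (m' := a') h =
        f.markHom (m := Sum.inr ⟨k, a⟩) (m' := Sum.inr ⟨k, a'⟩) h') ∧
      (∀ a a' h h', Hom.opHom g.left (n := a) (n' := a') h =
        f.opHom (n := some ⟨k, a⟩) (n' := some ⟨k, a'⟩) h') := by
  obtain ⟨EA, hA⟩ := exists_equiv_restrict f.fA
    (some_mk_injective (X := fun k => (T k).left.tree.A) k)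
    (some_mk_injective (X := fun k => (U k).left.tree.A) k) (hf.exists_fA k) (hf.symm.exists_fA k)
  obtain ⟨EM, hM⟩ := exists_equiv_restrict f.fM
    (inr_mk_injective (X := fun k => (T k).left.tree.M) k)
    (inr_mk_injective (X := fun k => (U k).left.tree.M) k) (hf.exists_fM k) (hf.symm.exists_fM k)
  obtain ⟨EN, hN⟩ := exists_equiv_restrict f.fN
    (some_mk_injective (X := fun k => (T k).left.tree.N) k)
    (some_mk_injective (X := fun k => (U k).left.tree.N) k) (hf.exists_fN k) (hf.symm.exists_fN k)
  have jA : ∀ {a a'}, EA a = a' → f.fA (some ⟨k, a⟩) = some ⟨k, a'⟩ := by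
    rintro a _ rfl
    exact hA a
  have jM : ∀ {a a'}, EM a = a' → f.fM (Sum.inr ⟨k, a⟩) = Sum.inr ⟨k, a'⟩ := by
    rintro a _ rfl
    exact hM a
  have jN : ∀ {a a'}, EN a = a' → f.fN (some ⟨k, a⟩) = some ⟨k, a'⟩ := by
    rintro a _ rfl
    exact hN a
  let g : Hom (T k).left (U k).left := Hom.ofFamilies EA EM EN
    (fun m => by
      have h1 := f.comm_s (Sum.inr ⟨k, m⟩)
      rw [jM rfl] at h1
      exact some_mk_injective (X := fun k => (U k).left.tree.A) k ((jA rfl).symm.trans h1))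
    (fun m => by
      have h1 := f.comm_p (Sum.inr ⟨k, m⟩)
      rw [jM rfl] at h1
      exact some_mk_injective (X := fun k => (U k).left.tree.N) k ((jN rfl).symm.trans h1))
    (fun n => by
      have h1 := f.comm_t (some ⟨k, n⟩)
      rw [jN rfl] at h1
      exact some_mk_injective (X := fun k => (U k).left.tree.A) k ((jA rfl).symm.trans h1))
    (fun a a' h => f.colourHom (jA h))
    (fun a a' h => f.markHom (jM h))
    (fun a a' h => f.opHom (jN h))
    (fun m m' hm hs => f.naturality_s (jM hm) (jA hs))
    (fun m m' hm hs => f.naturality_p (jM hm) (jN hs))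
    (fun m m' hm hs => f.naturality_t (jN hm) (jA hs))
  have gA : ∀ a a' (h : g.fA a = a'), g.colourHom h = f.colourHom (jA h) := by
    rintro a _ rfl
    exact Category.comp_id _
  have gM : ∀ a a' (h : g.fM a = a'), g.markHom h = f.markHom (jM h) := by
    rintro a _ rfl
    exact Category.comp_id _
  have gN : ∀ a a' (h : g.fN a = a'), g.opHom h = f.opHom (jN h) := by
    rintro a _ rfl
    exact Category.comp_id _
  -- Compatibility with the arrows to `P.s.obj (e k).left` is naturality of `f` at the input `k`,
  -- where its arrow between marks is the identity.
  have w : g.colourHom g.map_root ≫ (U k).rootHom = (T k).rootHom := by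
    rw [gA]
    refine comp_eq_of_inv_comp_eq (f.naturality_s (hf.fM_inl k) (jA g.map_root)) ?_
    rw [hf.markHom_inl hP]
    exact P.s.map_id _
  exact ⟨CostructuredArrow.homMk g w, hA, hM, hN, fun a a' h _ => gA a a' h,
    fun a a' h _ => gM a a' h, fun a a' h _ => gN a a' h⟩

theorem exists_graftMap_eq (hP : P.Finitary) {f : Hom (graft e he T) (graft e he U)}
    (hf : OverCorolla f) (hroot : ∃ h : f.fA none = none, f.colourHom h = 𝟙 i) :
    ∃ g : ∀ k, T k ⟶ U k, graftMap he g = f := by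
  choose g gA gM gN cA cM cN using hf.exists_restrict hP
  obtain ⟨hA0, hroot⟩ := hroot
  refine ⟨g, Hom.ext_of_forall ?_ ?_ ?_ ?_ ?_ ?_⟩
  · rintro (_ | ⟨k, a⟩)
    · exact hA0.symm
    · exact (gA k a).symm
  · rintro (k | ⟨k, m⟩)
    · exact (hf.fM_inl k).symm
    · exact (gM k m).symm
  · rintro (_ | ⟨k, n⟩)
    · exact hf.choose.symm
    · exact (gN k n).symm
  · rintro (_ | ⟨k, a⟩) _ rfl h'
    · exact (Category.comp_id _).trans hroot.symm
    · exact (graftMap_colourHom g rfl rfl).trans (cA k a _ rfl _)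
  · rintro (k | ⟨k, m⟩) _ rfl h'
    · exact (Category.comp_id _).trans (hf.markHom_inl hP k).symm
    · exact (graftMap_markHom g rfl rfl).trans (cM k m _ rfl _)
  · rintro (_ | ⟨k, n⟩) _ rfl h'
    · exact (Category.comp_id _).trans hf.choose_spec.symm
    · exact (graftMap_opHom g rfl rfl).trans (cN k n _ rfl _)

end Graft

end PTree

end PolyEndo

/-! ### Subtrees above an edge, and decomposition at the root node -/

namespace OpTree

variable {T : OpTree}

/-- Reachability along the walk towards the root. -/
abbrev Reach (T : OpTree) : T.A → T.A → Prop := Relation.ReflTransGen T.Step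

theorem eq_root_of_reach {x : T.A} (h : T.Reach T.root x) : x = T.root := by
  rcases Relation.ReflTransGen.cases_head h with h | ⟨y, hy, -⟩
  · exact h.symm
  · exact (T.not_step_root y hy).elim

/-- The root has no outgoing step. Since `s` is injective the walk is deterministic, so a cycle
through `s m` passes through `t (p m)`, and induction on edges excludes it. -/
theorem not_transGen_self (a : T.A) : ¬ Relation.TransGen T.Step a a := by
  refine T.edge_induction (C := fun a => ¬ Relation.TransGen T.Step a a) ?_ ?_ a
  · intro h
    obtain ⟨y, hy, -⟩ := Relation.TransGen.head'_iff.1 h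
    exact T.not_step_root y hy
  · intro m hm h
    obtain ⟨y, ⟨m', hm', hy⟩, h'⟩ := Relation.TransGen.head'_iff.1 h
    obtain rfl := T.s_inj hm'
    rw [← hy] at h'
    exact hm (Relation.TransGen.tail' h' ⟨m', rfl, rfl⟩)

/-- The subtree above an edge. -/
def above (T : OpTree) (r : T.A) : OpTree where
  A := {a // T.Reach a r}
  M := {m // T.Reach (T.t (T.p m)) r}
  N := {n // T.Reach (T.t n) r}
  finA := inferInstance
  finM := inferInstance
  finN := inferInstance
  s m := ⟨T.s m.1, Relation.ReflTransGen.head ⟨m.1, rfl, rfl⟩ m.2⟩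
  p m := ⟨T.p m.1, m.2⟩
  t n := ⟨T.t n.1, n.2⟩
  t_inj := fun _ _ h => Subtype.ext (T.t_inj (congrArg Subtype.val h))
  s_inj := fun _ _ h => Subtype.ext (T.s_inj (congrArg Subtype.val h))
  root := ⟨r, Relation.ReflTransGen.refl⟩
  not_mem_range_s := by
    rintro ⟨a, ha⟩
    constructor
    · intro h
      rcases Relation.ReflTransGen.cases_head ha with h' | ⟨y, ⟨m, hm, rfl⟩, hy⟩
      · exact Subtype.ext h'
      · exact (h ⟨⟨m, hy⟩, Subtype.ext hm⟩).elim
    · rintro h ⟨⟨m, hm⟩, h'⟩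
      -- A mark of the subtree sitting on `r` itself would make the walk from `r` return to `r`.
      have h1 : T.s m = r := congrArg Subtype.val (h'.trans h)
      exact not_transGen_self r (Relation.TransGen.head' ⟨m, h1, rfl⟩ hm)
  walk := by
    rintro ⟨a, ha⟩
    refine Relation.ReflTransGen.head_induction_on (motive := fun a ha =>
      Relation.ReflTransGen _ (⟨a, ha⟩ : {a // T.Reach a r}) ⟨r, Relation.ReflTransGen.refl⟩) ha
      Relation.ReflTransGen.refl ?_
    rintro _ _ ⟨m, rfl, rfl⟩ h ih
    exact Relation.ReflTransGen.head ⟨⟨m, h⟩, rfl, rfl⟩ ih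

end OpTree

namespace PolyEndo

variable {P : PolyEndo.{u, v}}

namespace PTree

/-- The subtree of a `P`-tree above an edge. -/
def above (T : PTree P) (r : T.tree.A) : PTree P where
  tree := T.tree.above r
  colour a := T.colour a.1
  mark m := T.mark m.1
  op n := T.op n.1
  isoS m := T.isoS m.1
  isoP m := T.isoP m.1
  isoT n := T.isoT n.1
  cart := by
    have hinj : Function.Injective
        (fun x : Σ n : (T.tree.above r).N, PiZero (P.Fib (T.op n.1)) =>
          (⟨x.1.1, x.2⟩ : Σ n, PiZero (P.Fib (T.op n)))) := by
      rintro ⟨⟨n, hn⟩, c⟩ ⟨⟨n', hn'⟩, c'⟩ h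
      simp only [Sigma.mk.injEq] at h
      obtain ⟨rfl, h⟩ := h
      rw [eq_of_heq h]
    constructor
    · intro m m' h
      exact Subtype.ext (T.cart.1 (congrArg
        (fun x : Σ n : (T.tree.above r).N, PiZero (P.Fib (T.op n.1)) =>
          (⟨x.1.1, x.2⟩ : Σ n, PiZero (P.Fib (T.op n)))) h))
    · rintro ⟨⟨n, hn⟩, c⟩
      obtain ⟨m, hm⟩ := T.cart.2 ⟨n, c⟩
      have h1 : T.tree.p m = n := congrArg Sigma.fst hm
      exact ⟨⟨m, h1 ▸ hn⟩, hinj hm⟩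

/-- The surjective half of `cart`, unwound into an actual arrow of the fibre; `mark_eq` is the
injective half in the same form. -/
theorem exists_mark (T : PTree P) (n : T.tree.N) (c : P.Fib (T.op n)) :
    ∃ (m : T.tree.M) (h : T.tree.p m = n) (ψ : c.left ⟶ T.mark m),
      P.p.map ψ ≫ T.isoP m ≫ eqToHom (congrArg T.op h) = c.hom := by
  obtain ⟨m, hm⟩ := T.cart.2 ⟨n, PiZero.mk c⟩
  obtain rfl : T.tree.p m = n := congrArg Sigma.fst hm
  have h1 : PiZero.mk (CostructuredArrow.mk (T.isoP m)) = PiZero.mk c :=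
    eq_of_heq (Sigma.mk.inj hm).2
  obtain ⟨f⟩ := PiZero.mk_eq_iff.1 h1.symm
  refine ⟨m, rfl, f.left, ?_⟩
  have := CostructuredArrow.w f
  simpa using this

theorem mark_eq (T : PTree P) {m m' : T.tree.M} (h : T.tree.p m' = T.tree.p m)
    (ψ : T.mark m ⟶ T.mark m')
    (hψ : P.p.map ψ ≫ T.isoP m' ≫ eqToHom (congrArg T.op h) = T.isoP m) : m = m' := by
  have key : ∀ (n n' : T.tree.N) (h : n' = n) (c : P.Fib (T.op n)) (c' : P.Fib (T.op n'))
      (f : c.left ⟶ c'.left), P.p.map f ≫ c'.hom ≫ eqToHom (congrArg T.op h) = c.hom →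
      (⟨n, PiZero.mk c⟩ : Σ n, PiZero (P.Fib (T.op n))) = ⟨n', PiZero.mk c'⟩ := by
    rintro n _ rfl c c' f hf
    rw [eqToHom_refl, Category.comp_id] at hf
    rw [PiZero.mk_eq_iff.2 ⟨CostructuredArrow.homMk f hf⟩]
  exact T.cart.1 (key _ _ h (CostructuredArrow.mk (T.isoP m)) (CostructuredArrow.mk (T.isoP m'))
    ψ hψ)

/-! ### The homotopy fibre over a root operation as a product -/

section Graft

variable {i : P.I} {β : P.OpsOver i} {ι : Type} [Finite ι] {e : ι → P.Fib β.left}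
  (he : Function.Bijective fun k => PiZero.mk (e k))

/-- A grafted tree as a tree over its root colour, with a root node. -/
def graftRooted (T : ∀ k, P.TreesOver (P.s.obj (e k).left)) : RootedOver i :=
  ⟨CostructuredArrow.mk (Y := graft e he T) (𝟙 i), OpTree.graft_rooted _⟩

/-- `RootedOver.node` is a choice, so it agrees with the new node only propositionally; this is the
source of the `eqToHom`s in `graftRootedHom`. -/
theorem graftRooted_node (T : ∀ k, P.TreesOver (P.s.obj (e k).left)) :
    (graftRooted he T).node = none :=
  (graft e he T).tree.t_inj (graftRooted he T).t_node

/-- The root operation of a grafted tree. -/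
def graftRootedHom (T : ∀ k, P.TreesOver (P.s.obj (e k).left)) :
    (rootOp i).obj (graftRooted he T) ⟶ β :=
  CostructuredArrow.homMk (eqToHom (congrArg (graft e he T).op (graftRooted_node he T))) <| by
    have key : ∀ (n : (graft e he T).tree.N) (hn : n = none)
        (h : (graft e he T).tree.t n = none),
        P.t.map (eqToHom (congrArg (graft e he T).op hn)) ≫ β.hom =
          (graft e he T).isoT n ≫ eqToHom (congrArg (graft e he T).colour h) ≫ 𝟙 i := by
      rintro _ rfl h
      change P.t.map (𝟙 β.left) ≫ β.hom = β.hom ≫ 𝟙 i ≫ 𝟙 i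
      simp
    exact key _ (graftRooted_node he T) (graftRooted he T).t_node

/-- A grafted tree as an object of the homotopy fibre over its root operation. -/
def graftOver (T : ∀ k, P.TreesOver (P.s.obj (e k).left)) : CostructuredArrow (rootOp i) β :=
  CostructuredArrow.mk (graftRootedHom he T)

variable (T U : ∀ k, P.TreesOver (P.s.obj (e k).left))

variable {T U} in
/-- Grafting of morphisms, in the homotopy fibre over the root operation. -/
def graftOverMap (g : ∀ k, T k ⟶ U k) : graftOver he T ⟶ graftOver he U :=
  CostructuredArrow.homMk (ObjectProperty.homMk (CostructuredArrow.homMk (graftMap he g) (by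
      change (𝟙 i ≫ 𝟙 i) ≫ 𝟙 i = 𝟙 i
      simp))) <| by
    apply CostructuredArrow.hom_ext
    refine (Hom.opHom_eqToHom (graftMap he g) (Hom.map_root_node _
      (graftRooted he T).t_node (graftRooted he U).t_node) rfl (graftRooted_node he T)
      (graftRooted_node he U)).trans ?_
    have h : (graftMap he g).opHom (n := none) rfl = 𝟙 β.left := Category.comp_id (𝟙 β.left)
    exact (congrArg (_ ≫ ·) h).trans
      (Category.comp_id (eqToHom (congrArg (graft e he T).op (graftRooted_node he T))))

/-- A morphism in the fibre is a morphism of grafted trees which is the identity on the root colour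
and on the root operation, and `exists_graftMap_eq` says that these come from the components. -/
theorem graftOverMap_bijective (hP : P.Finitary) :
    Function.Bijective fun g : ∀ k, T k ⟶ U k => graftOverMap he g := by
  constructor
  · intro g g' h
    exact graftMap_injective (congrArg (fun f : graftOver he T ⟶ graftOver he U =>
      f.left.hom.left) h)
  · intro f
    let f₀ : Hom (graft e he T) (graft e he U) := f.left.hom.left
    have hA0 : f₀.colourHom f₀.map_root ≫ 𝟙 i = 𝟙 i := TreesOver.colourHom_rootHom f.left.hom
    have hN0 : f₀.fN none = none := Hom.map_root_node f₀ rfl rfl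
    have h1 : Hom.opHom f₀ (Hom.map_root_node _ (graftRooted he T).t_node
        (graftRooted he U).t_node) ≫
        eqToHom (congrArg (graft e he U).op (graftRooted_node he U)) =
        eqToHom (congrArg (graft e he T).op (graftRooted_node he T)) :=
      congrArg CommaMorphism.left (CostructuredArrow.w f)
    rw [Hom.opHom_eqToHom f₀ _ hN0 (graftRooted_node he T) (graftRooted_node he U)] at h1
    have h2 : f₀.opHom hN0 = 𝟙 β.left := by
      exact (cancel_epi (eqToHom (congrArg (graft e he T).op (graftRooted_node he T)))).1
        (h1.trans (Category.comp_id _).symm)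
    obtain ⟨g, hg⟩ := exists_graftMap_eq hP ⟨hN0, h2⟩
      ⟨f₀.map_root, (Category.comp_id _).symm.trans hA0⟩
    refine ⟨g, ?_⟩
    apply CostructuredArrow.hom_ext
    apply ObjectProperty.hom_ext
    apply CostructuredArrow.hom_ext
    exact hg

/-- Cutting at the root node: `φ` matches the inputs of `β` with the marks of `n₀`, and every edge
except the root lies above exactly one of the corresponding input edges. The subtrees above these
edges, grafted onto `β`, give back `T`. -/
theorem exists_graft_hom (T : PTree P) (n₀ : T.tree.N) (hn₀ : T.tree.t n₀ = T.tree.root)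
    (r : T.colour T.tree.root ⟶ i) (φ : T.op n₀ ⟶ β.left)
    (hφ : P.t.map φ ≫ β.hom = T.isoT n₀ ≫ eqToHom (congrArg T.colour hn₀) ≫ r) :
    ∃ (S : ∀ k, P.TreesOver (P.s.obj (e k).left)) (f : Hom (graft e he S) T)
      (hA : f.fA none = T.tree.root) (hN : f.fN none = n₀),
      f.colourHom hA ≫ r = 𝟙 i ∧ f.opHom hN ≫ φ = 𝟙 β.left := by
  -- `m k` is the mark of `n₀` corresponding to the input `e k`, moved to the operation of `n₀`
  -- along `inv φ`.
  choose m hm ψ hψ using fun k => T.exists_mark n₀ (CostructuredArrow.mk ((e k).hom ≫ inv φ))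
  have m_inj : Function.Injective m := by
    intro k k' h
    refine he.1 (PiZero.mk_eq_iff.2 ?_)
    have key : ∀ (m₁ m₂ : T.tree.M) (_ : m₁ = m₂) (h₁ : T.tree.p m₁ = n₀)
        (h₂ : T.tree.p m₂ = n₀) (ψ₁ : (e k).left ⟶ T.mark m₁) (ψ₂ : (e k').left ⟶ T.mark m₂),
        P.p.map ψ₁ ≫ T.isoP m₁ ≫ eqToHom (congrArg T.op h₁) = (e k).hom ≫ inv φ →
        P.p.map ψ₂ ≫ T.isoP m₂ ≫ eqToHom (congrArg T.op h₂) = (e k').hom ≫ inv φ →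
        Nonempty (e k ⟶ e k') := by
      rintro m₁ _ rfl h₁ h₂ ψ₁ ψ₂ w₁ w₂
      refine ⟨CostructuredArrow.homMk (ψ₁ ≫ inv ψ₂) ?_⟩
      rw [← cancel_mono (inv φ), Category.assoc, ← w₂, ← w₁]
      simp
    exact key _ _ h (hm k) (hm k') (ψ k) (ψ k') (hψ k) (hψ k')
  have m_surj : ∀ m' : T.tree.M, T.tree.p m' = n₀ → ∃ k, m k = m' := by
    intro m' hm'
    obtain ⟨k, hk⟩ := he.2 (PiZero.mk (CostructuredArrow.mk
      (T.isoP m' ≫ eqToHom (congrArg T.op hm') ≫ φ)))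
    obtain ⟨g⟩ := PiZero.mk_eq_iff.1 hk.symm
    have hg : P.p.map g.left ≫ (e k).hom = T.isoP m' ≫ eqToHom (congrArg T.op hm') ≫ φ :=
      CostructuredArrow.w g
    refine ⟨k, (T.mark_eq ((hm k).trans hm'.symm) (g.left ≫ ψ k) ?_).symm⟩
    have h1 : P.p.map (ψ k) ≫ T.isoP (m k) ≫ eqToHom (congrArg T.op (hm k)) =
      (e k).hom ≫ inv φ := hψ k
    have h2 : P.p.map (g.left ≫ ψ k) ≫ T.isoP (m k) ≫ eqToHom (congrArg T.op (hm k)) =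
        T.isoP m' ≫ eqToHom (congrArg T.op hm') := by
      rw [Functor.map_comp, Category.assoc, h1, reassoc_of% hg, IsIso.hom_inv_id, Category.comp_id]
    rw [← cancel_mono (eqToHom (congrArg T.op hm')), ← h2]
    simp
  -- The walk from `a` is deterministic, so one of the two input edges is reached from the other;
  -- but one step below an input edge of `n₀` is already the root.
  have reach_inj : ∀ {k k' a}, T.tree.Reach a (T.tree.s (m k)) →
      T.tree.Reach a (T.tree.s (m k')) → k = k' := by
    have key : ∀ {k k'}, T.tree.Reach (T.tree.s (m k)) (T.tree.s (m k')) → k = k' := by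
      intro k k' h
      rcases Relation.ReflTransGen.cases_head h with h | ⟨_, ⟨m', hm', rfl⟩, h⟩
      · exact m_inj (T.tree.s_inj h)
      · obtain rfl := T.tree.s_inj hm'
        rw [hm, hn₀] at h
        exact (T.tree.s_ne_root _ (OpTree.eq_root_of_reach h)).elim
    intro k k' a h h'
    rcases Relation.ReflTransGen.total_of_right_unique T.tree.step_rightUnique h h' with h | h
    · exact key h
    · exact (key h).symm
  have not_reach : ∀ {k}, ¬ T.tree.Reach T.tree.root (T.tree.s (m k)) := fun h =>
    T.tree.s_ne_root _ (OpTree.eq_root_of_reach h)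
  have reach_surj : ∀ a, a = T.tree.root ∨ ∃ k, T.tree.Reach a (T.tree.s (m k)) := by
    refine T.tree.edge_induction (Or.inl rfl) ?_
    rintro m' (h | ⟨k, h⟩)
    · obtain ⟨k, rfl⟩ := m_surj m' (T.tree.t_inj (h.trans hn₀.symm))
      exact Or.inr ⟨k, Relation.ReflTransGen.refl⟩
    · exact Or.inr ⟨k, Relation.ReflTransGen.head ⟨m', rfl, rfl⟩ h⟩
  -- The arrow to the colour of `e k` is chosen so that grafting inverts it back to `P.s.map (ψ k) ≫
  -- T.isoS (m k)`, which is what naturality at the input `k` demands.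
  let S : ∀ k, P.TreesOver (P.s.obj (e k).left) := fun k =>
    CostructuredArrow.mk (Y := T.above (T.tree.s (m k))) (inv (P.s.map (ψ k) ≫ T.isoS (m k)))
  let fA : (graft e he S).tree.A → T.tree.A := fun x => match x with
    | none => T.tree.root
    | some a => a.2.1
  let fM : (graft e he S).tree.M → T.tree.M := fun x => match x with
    | Sum.inl k => m k
    | Sum.inr a => a.2.1
  let fN : (graft e he S).tree.N → T.tree.N := fun x => match x with
    | none => n₀
    | some a => a.2.1
  have bA : Function.Bijective fA := by
    constructor
    · rintro (_ | ⟨k, a, ha⟩) (_ | ⟨k', a', ha'⟩) (h : _ = _)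
      · rfl
      · change T.tree.root = a' at h
        subst h
        exact (not_reach ha').elim
      · change a = T.tree.root at h
        subst h
        exact (not_reach ha).elim
      · change a = a' at h
        subst h
        obtain rfl := reach_inj ha ha'
        rfl
    · intro a
      rcases reach_surj a with rfl | ⟨k, h⟩
      · exact ⟨none, rfl⟩
      · exact ⟨some ⟨k, a, h⟩, rfl⟩
  have bN : Function.Bijective fN := by
    constructor
    · rintro (_ | ⟨k, n, ha⟩) (_ | ⟨k', n', ha'⟩) (h : _ = _)
      · rfl
      · change n₀ = n' at h
        subst h
        rw [hn₀] at ha'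
        exact (not_reach ha').elim
      · change n = n₀ at h
        subst h
        rw [hn₀] at ha
        exact (not_reach ha).elim
      · change n = n' at h
        subst h
        obtain rfl := reach_inj ha ha'
        rfl
    · intro n
      rcases reach_surj (T.tree.t n) with h | ⟨k, h⟩
      · exact ⟨none, T.tree.t_inj (hn₀.trans h.symm)⟩
      · exact ⟨some ⟨k, n, h⟩, rfl⟩
  have bM : Function.Bijective fM := by
    constructor
    · rintro (k | ⟨k, x, ha⟩) (k' | ⟨k', x', ha'⟩) (h : _ = _)
      · exact congrArg Sum.inl (m_inj h)
      · change m k = x' at h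
        subst h
        rw [hm, hn₀] at ha'
        exact (not_reach ha').elim
      · change x = m k' at h
        subst h
        rw [hm, hn₀] at ha
        exact (not_reach ha).elim
      · change x = x' at h
        subst h
        obtain rfl := reach_inj ha ha'
        rfl
    · intro x
      rcases reach_surj (T.tree.t (T.tree.p x)) with h | ⟨k, h⟩
      · obtain ⟨k, rfl⟩ := m_surj x (T.tree.t_inj (h.trans hn₀.symm))
        exact ⟨Sum.inl k, rfl⟩
      · exact ⟨Sum.inr ⟨k, x, h⟩, rfl⟩
  let f : Hom (graft e he S) T :=
    { fA := Equiv.ofBijective fA bA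
      fM := Equiv.ofBijective fM bM
      fN := Equiv.ofBijective fN bN
      comm_s := by rintro (k | x) <;> rfl
      comm_p := by
        rintro (k | x)
        · exact (hm k).symm
        · rfl
      comm_t := by
        rintro (_ | x)
        · exact hn₀.symm
        · rfl
      cA := fun x => match x with
        | none => (inv r : i ⟶ T.colour T.tree.root)
        | some a => 𝟙 (T.colour a.2.1)
      cM := fun x => match x with
        | Sum.inl k => ψ k
        | Sum.inr a => 𝟙 (T.mark a.2.1)
      cN := fun x => match x with
        | none => (inv φ : β.left ⟶ T.op n₀)
        | some a => 𝟙 (T.op a.2.1)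
      nat_s := by
        rintro (k | x)
        · change inv (inv (P.s.map (ψ k) ≫ T.isoS (m k))) ≫ 𝟙 _ ≫ 𝟙 _ =
            P.s.map (ψ k) ≫ T.isoS (m k)
          simp
        · change T.isoS x.2.1 ≫ 𝟙 _ ≫ 𝟙 _ = P.s.map (𝟙 _) ≫ T.isoS x.2.1
          simp
      nat_p := by
        rintro (k | x)
        · have h1 : P.p.map (ψ k) ≫ T.isoP (m k) ≫ eqToHom (congrArg T.op (hm k)) =
            (e k).hom ≫ inv φ := hψ k
          change (e k).hom ≫ inv φ ≫ eqToHom (congrArg T.op (hm k).symm) =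
            P.p.map (ψ k) ≫ T.isoP (m k)
          rw [← Category.assoc, ← h1]
          simp
        · change T.isoP x.2.1 ≫ 𝟙 _ ≫ 𝟙 _ = P.p.map (𝟙 _) ≫ T.isoP x.2.1
          simp
      nat_t := by
        rintro (_ | x)
        · change β.hom ≫ inv r ≫ eqToHom (congrArg T.colour hn₀.symm) =
            P.t.map (inv φ) ≫ T.isoT n₀
          rw [Functor.map_inv, IsIso.eq_inv_comp, reassoc_of% hφ]
          simp
        · change T.isoT x.2.1 ≫ 𝟙 _ ≫ 𝟙 _ = P.t.map (𝟙 _) ≫ T.isoT x.2.1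
          simp }
  refine ⟨S, f, rfl, rfl, ?_, ?_⟩
  · change (inv r ≫ 𝟙 _) ≫ r = 𝟙 i
    simp
  · change (inv φ ≫ 𝟙 _) ≫ φ = 𝟙 β.left
    simp

theorem exists_graftOver_hom (y : CostructuredArrow (rootOp i) β) :
    ∃ T, Nonempty (graftOver he T ⟶ y) := by
  obtain ⟨T, f, hA, hN, h1, h2⟩ := exists_graft_hom he y.left.obj.left y.left.node y.left.t_node
    y.left.obj.rootHom y.hom.left (CostructuredArrow.w y.hom)
  refine ⟨T, ⟨CostructuredArrow.homMk (ObjectProperty.homMk (CostructuredArrow.homMk f h1)) ?_⟩⟩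
  apply CostructuredArrow.hom_ext
  have h3 := Hom.opHom_eqToHom f (Hom.map_root_node f (graftRooted he T).t_node y.left.t_node) hN
    (graftRooted_node he T) rfl
  rw [eqToHom_refl, Category.comp_id] at h3
  refine (congrArg (· ≫ y.hom.left) h3).trans ?_
  refine (Category.assoc _ _ _).trans ((congrArg (_ ≫ ·) h2).trans ?_)
  exact Category.comp_id _

end Graft

end PTree

end PolyEndo

/-! ## Cores and the grafting operator -/

namespace CombTree

theorem cls_eq_iff {τ τ' : CombTree} : τ.cls = τ'.cls ↔ IsIso τ τ' :=
  ⟨fun h => Quotient.exact h, fun h => Quotient.sound h⟩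

theorem IsIso.graft {ι κ : Type} [Finite ι] [Finite κ] {F : ι → CombTree} {G : κ → CombTree}
    (σ : ι ≃ κ) (h : ∀ i, IsIso (F i) (G (σ i))) :
    IsIso (CombTree.graft F) (CombTree.graft G) := by
  choose φ h₀ hφ using h
  refine ⟨Equiv.optionCongr (Equiv.sigmaCongr σ φ), rfl, ?_⟩
  rintro (_ | ⟨i, v⟩)
  · rfl
  · have h2 : φ i v = (G (σ i)).root ↔ v = (F i).root := by
      rw [← h₀, (φ i).apply_eq_iff_eq]
    by_cases hv : v = (F i).root
    · have h1 : graftParent F (some ⟨i, v⟩) = none := if_pos hv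
      have h3 : graftParent G (some ⟨σ i, φ i v⟩) = none := if_pos (h2.2 hv)
      exact (congrArg (Equiv.optionCongr (Equiv.sigmaCongr σ φ)) h1).trans h3.symm
    · have h1 : graftParent F (some ⟨i, v⟩) = some ⟨i, (F i).parent v⟩ := if_neg hv
      have h3 : graftParent G (some ⟨σ i, φ i v⟩) = some ⟨σ i, (G (σ i)).parent (φ i v)⟩ :=
        if_neg (mt h2.1 hv)
      refine (congrArg (Equiv.optionCongr (Equiv.sigmaCongr σ φ)) h1).trans (Eq.trans ?_ h3.symm)
      rw [← hφ]
      rfl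

end CombTree

/-- Equal multisets of values mean that the two families have fibres of equal size over each value;
bijections of the fibres are glued. -/
theorem exists_equiv_of_map_univ_eq {ι κ γ : Type*} [Fintype ι] [Fintype κ] {f : ι → γ}
    {g : κ → γ} (h : Finset.univ.val.map f = Finset.univ.val.map g) :
    ∃ σ : ι ≃ κ, ∀ i, g (σ i) = f i := by
  classical
  have key : ∀ c, Nonempty ({a // f a = c} ≃ {b // g b = c}) := by
    intro c
    have h1 := congrArg (Multiset.count c) h
    rw [Multiset.count_map, Multiset.count_map] at h1
    refine ⟨Fintype.equivOfCardEq ?_⟩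
    rw [Fintype.card_subtype, Fintype.card_subtype]
    simp only [eq_comm (a := c)] at h1
    exact h1
  exact ⟨Equiv.ofFiberEquiv fun c => (key c).some, fun i => Equiv.ofFiberEquiv_map _ i⟩

/-- `graftForest` chooses an ordering of the forest and representatives of its trees. Two families
with the same multiset of classes differ by a reindexing and isomorphisms, which grafting respects.
-/
theorem graftForest_sum_single {ι : Type} [Fintype ι] (F : ι → CombTree) :
    graftForest (∑ i, Finsupp.single (F i).cls 1) = (CombTree.graft F).cls := by
  set l := (Finsupp.toMultiset (∑ i, Finsupp.single (F i).cls 1)).toList with hl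
  have h1 : (l : Multiset CombTreeClass) = Finset.univ.val.map fun i => (F i).cls := by
    rw [hl, Multiset.coe_toList, map_sum]
    simp only [Finsupp.toMultiset_single, one_smul]
    exact Multiset.sum_map_singleton (Finset.univ.val.map fun i => (F i).cls) ▸ by
      rw [Multiset.map_map]
      rfl
  obtain ⟨σ, hσ⟩ := exists_equiv_of_map_univ_eq (f := l.get) (g := fun i => (F i).cls) (by
    rw [← h1, Fin.univ_val_map, List.ofFn_get])
  refine CombTree.cls_eq_iff.2 (CombTree.IsIso.graft σ fun j => CombTree.cls_eq_iff.1 ?_)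
  exact (Quotient.out_eq (l.get j)).trans (hσ j).symm

namespace PolyEndo

namespace PTree

theorem HasCore.rooted {T : OpTree} {τ : CombTree} (h : HasCore T τ) : T.Rooted :=
  OpTree.rooted_of_node (h.choose.symm τ.root)

/-- The two conditions determine the parent function completely, since each output edge is either
the root or of the form `s m`. -/
theorem HasCore.isIso {T : OpTree} {τ τ' : CombTree} (h : HasCore T τ) (h' : HasCore T τ') :
    CombTree.IsIso τ τ' := by
  obtain ⟨n₀, hn₀⟩ := h.rooted
  obtain ⟨e, h1, h2⟩ := h
  obtain ⟨e', h1', h2'⟩ := h'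
  refine ⟨e.symm.trans e', ?_, fun v => ?_⟩
  · rw [← h1 n₀ hn₀, ← h1' n₀ hn₀]
    simp
  · obtain ⟨n, rfl⟩ := e.surjective v
    rcases T.eq_root_or_eq_s (T.t n) with h | ⟨m, hm⟩
    · have h3 := h1' n h
      rw [h1 n h, τ.parent_root, ← h1 n h, Equiv.trans_apply, Equiv.symm_apply_apply, h3,
        τ'.parent_root]
    · rw [h2 n m hm.symm, Equiv.trans_apply, Equiv.symm_apply_apply, Equiv.trans_apply,
        Equiv.symm_apply_apply, h2' n m hm.symm]

theorem HasCore.of_isIso {T : OpTree} {τ τ' : CombTree} (h : HasCore T τ)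
    (hτ : CombTree.IsIso τ τ') : HasCore T τ' := by
  obtain ⟨e, h1, h2⟩ := h
  obtain ⟨φ, h0, hφ⟩ := hτ
  refine ⟨e.trans φ, fun n hn => ?_, fun n m hnm => ?_⟩
  · rw [Equiv.trans_apply, h1 n hn, h0]
  · rw [Equiv.trans_apply, ← hφ, h2 n m hnm, Equiv.trans_apply]

theorem exists_hasCore {T : OpTree} (h : T.Rooted) : ∃ τ, HasCore T τ := by
  classical
  obtain ⟨n₀, hn₀⟩ := h
  have hs : ∀ n, T.t n ≠ T.root → ∃ m, T.s m = T.t n := fun n hn =>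
    (T.eq_root_or_eq_s _).resolve_left hn
  -- The root node is its own parent, as `CombTree` requires.
  let par : T.N → T.N := fun n => if hn : T.t n = T.root then n else T.p (hs n hn).choose
  have par_root : ∀ n, T.t n = T.root → par n = n := fun n hn => dif_pos hn
  have par_s : ∀ n m, T.t n = T.s m → par n = T.p m := by
    intro n m hnm
    have hn : T.t n ≠ T.root := hnm ▸ T.s_ne_root m
    have h1 : par n = T.p (hs n hn).choose := dif_neg hn
    rw [h1, T.s_inj ((hs n hn).choose_spec.trans hnm)]
  have walk : ∀ a n, T.t n = a → ∃ k : ℕ, par^[k] n = n₀ := by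
    refine T.edge_induction (C := fun a => ∀ n, T.t n = a → ∃ k : ℕ, par^[k] n = n₀) ?_ ?_
    · intro n hn
      exact ⟨0, T.t_inj (hn.trans hn₀.symm)⟩
    · intro m ih n hn
      obtain ⟨k, hk⟩ := ih _ rfl
      refine ⟨k + 1, ?_⟩
      rw [Function.iterate_succ_apply, par_s n m hn, hk]
  exact ⟨⟨T.N, inferInstance, n₀, par, par_root n₀ hn₀, fun n => walk _ n rfl⟩, Equiv.refl _,
    fun n hn => T.t_inj (hn.trans hn₀.symm), par_s⟩

/-- Components without nodes have no core and add no vertices, so the trees to be grafted are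
indexed by the rooted components only. -/
theorem HasCore.graft {ι : Type} [Finite ι] {T : ι → OpTree}
    {F : {k // (T k).Rooted} → CombTree} (h : ∀ k, HasCore (T k.1) (F k)) :
    HasCore (OpTree.graft T) (CombTree.graft F) := by
  choose e h1 h2 using h
  let E : (Σ k, (T k).N) ≃ Σ k, (F k).V :=
    { toFun := fun n => ⟨⟨n.1, OpTree.rooted_of_node n.2⟩, e _ n.2⟩
      invFun := fun v => ⟨v.1.1, (e v.1).symm v.2⟩
      left_inv := fun n => by
        change (⟨n.1, (e ⟨n.1, _⟩).symm (e ⟨n.1, _⟩ n.2)⟩ : Σ k, (T k).N) = n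
        rw [Equiv.symm_apply_apply]
      right_inv := fun v => by
        change (⟨v.1, e v.1 ((e v.1).symm v.2)⟩ : Σ k, (F k).V) = v
        rw [Equiv.apply_symm_apply] }
  refine ⟨Equiv.optionCongr E, ?_, ?_⟩
  · rintro (_ | n) hn
    · rfl
    · exact absurd hn (Option.some_ne_none _)
  · rintro (_ | ⟨k, n⟩) (k' | ⟨k', m⟩) hnm
    · exact absurd hnm (Option.some_ne_none _).symm
    · exact absurd hnm (Option.some_ne_none _).symm
    · have hnm' : some (⟨k, (T k).t n⟩ : Σ k, (T k).A) = some ⟨k', (T k').root⟩ := hnm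
      obtain rfl : k = k' := congrArg Sigma.fst (Option.some_injective _ hnm')
      have h3 : (T k).t n = (T k).root := some_mk_injective (X := fun k => (T k).A) k hnm'
      exact if_pos (h1 ⟨k, OpTree.rooted_of_node n⟩ n h3)
    · have hnm' : some (⟨k, (T k).t n⟩ : Σ k, (T k).A) = some ⟨k', (T k').s m⟩ := hnm
      obtain rfl : k = k' := congrArg Sigma.fst (Option.some_injective _ hnm')
      have h3 : (T k).t n = (T k).s m := some_mk_injective (X := fun k => (T k).A) k hnm'
      let K : {k // (T k).Rooted} := ⟨k, OpTree.rooted_of_node n⟩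
      obtain ⟨n₀, hn₀⟩ := K.2
      have h4 : ¬ e K n = (F K).root := by
        rw [← h1 K n₀ hn₀, (e K).apply_eq_iff_eq]
        rintro rfl
        exact (T k).s_ne_root m (h3.symm.trans hn₀)
      refine Eq.trans (b := some (⟨K, (F K).parent (e K n)⟩ : Σ k, (F k).V)) (if_neg h4) ?_
      rw [h2 K n m h3]
      rfl

open Classical in
/-- The monomial of `H_CK` given by the core of a tree; it is `1` if there are no nodes. -/
def coreExponent (T : OpTree) : CombTreeClass →₀ ℕ :=
  if h : ∃ τ, HasCore T τ then Finsupp.single h.choose.cls 1 else 0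

theorem HasCore.coreExponent_eq {T : OpTree} {τ : CombTree} (h : HasCore T τ) :
    coreExponent T = Finsupp.single τ.cls 1 := by
  have h' : ∃ τ, HasCore T τ := ⟨τ, h⟩
  rw [coreExponent, dif_pos h', CombTree.cls_eq_iff.2 (h'.choose_spec.isIso h)]

theorem coreExponent_of_not_rooted {T : OpTree} (h : ¬ T.Rooted) : coreExponent T = 0 :=
  dif_neg fun ⟨_, hτ⟩ => h hτ.rooted

/-- The core of a tree as an element of `H_CK`. -/
def coreMonomial (T : OpTree) : HCK := MvPolynomial.monomial (coreExponent T) 1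

theorem coreMonomial_of_not_rooted {T : OpTree} (h : ¬ T.Rooted) : coreMonomial T = 1 := by
  rw [coreMonomial, coreExponent_of_not_rooted h]
  rfl

open Classical in
theorem treeCoeff_coreMonomial (T : OpTree) (τ : CombTree) :
    treeCoeff τ (coreMonomial T) = if HasCore T τ then 1 else 0 := by
  rw [treeCoeff, coreMonomial, MvPolynomial.coeff_monomial]
  refine if_congr ?_ rfl rfl
  constructor
  · intro h
    by_cases hr : T.Rooted
    · obtain ⟨σ, hσ⟩ := exists_hasCore hr
      rw [hσ.coreExponent_eq, Finsupp.single_left_inj one_ne_zero] at h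
      exact hσ.of_isIso (CombTree.cls_eq_iff.1 h)
    · rw [coreExponent_of_not_rooted hr] at h
      exact absurd h.symm (Finsupp.single_ne_zero.2 one_ne_zero)
  · exact fun h => h.coreExponent_eq

/-- Cores multiply to a forest in which components without nodes are invisible factors `1`, just as
they add no child to the new root; `B₊` of this forest is the core of the grafted tree. -/
theorem Bplus_prod_coreMonomial {ι : Type} [Fintype ι] (T : ι → OpTree) :
    Bplus (∏ k, coreMonomial (T k)) = coreMonomial (OpTree.graft T) := by
  classical
  choose F hF using fun k : {k // (T k).Rooted} => exists_hasCore k.2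
  have h1 : ∑ k, coreExponent (T k) = ∑ k : {k // (T k).Rooted}, Finsupp.single (F k).cls 1 := by
    refine (Fintype.sum_of_injective Subtype.val Subtype.val_injective _ _ ?_ ?_).symm
    · intro k hk
      refine coreExponent_of_not_rooted fun hr => hk ⟨⟨k, hr⟩, rfl⟩
    · exact fun k => (hF k).coreExponent_eq.symm
  have h2 : ∏ k, coreMonomial (T k) =
      MvPolynomial.basisMonomials CombTreeClass ℚ (∑ k, coreExponent (T k)) := by
    rw [MvPolynomial.coe_basisMonomials]
    exact (MvPolynomial.monomial_sum_one _ _).symm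
  rw [h2, Bplus, Module.Basis.constr_basis, h1, graftForest_sum_single, coreMonomial,
    (HasCore.graft hF).coreExponent_eq]
  rfl

theorem coreMonomial_invariant {P : PolyEndo.{u, v}} :
    ArrowInvariant fun T : PTree P => coreMonomial T.tree := by
  intro S T f
  change coreMonomial S.tree = coreMonomial T.tree
  by_cases h : S.tree.Rooted
  · obtain ⟨τ, hτ⟩ := exists_hasCore h
    rw [coreMonomial, coreMonomial, hτ.coreExponent_eq, (hτ.of_hom f).coreExponent_eq]
  · rw [coreMonomial_of_not_rooted h, coreMonomial_of_not_rooted]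
    exact fun hT => h (Eq.mpr (rooted_invariant f) hT)

end PTree

end PolyEndo

/-! ## Contractions on power series -/

section FixedPoint

variable {ι R : Type*} [CommRing R]

/-- An operator on families of power series whose `k`-th coefficients depend only on the
coefficients of index less than `k` of the argument. -/
def IsContraction (Φ : (ι → PowerSeries R) → ι → PowerSeries R) : Prop :=
  ∀ k X Y, (∀ j < k, ∀ i, PowerSeries.coeff j (X i) = PowerSeries.coeff j (Y i)) →
    ∀ i, PowerSeries.coeff k (Φ X i) = PowerSeries.coeff k (Φ Y i)

/-- The `j`-th coefficients of the iterates of `0` are constant from the `(j + 1)`-st iterate on;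
the solution collects these stable values, and uniqueness is induction on the coefficient. -/
theorem IsContraction.exists_unique_fixed {Φ : (ι → PowerSeries R) → ι → PowerSeries R}
    (hΦ : IsContraction Φ) : ∃ X, ∀ Y, (∀ i, Y i = Φ Y i) ↔ Y = X := by
  let A : ℕ → ι → PowerSeries R := fun n => Φ^[n] 0
  have hA : ∀ n, A (n + 1) = Φ (A n) := fun n => Function.iterate_succ_apply' Φ n 0
  have stable : ∀ j n m, j < n → j < m → ∀ i,
      PowerSeries.coeff j (A n i) = PowerSeries.coeff j (A m i) := by
    intro j
    induction j using Nat.strong_induction_on with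
    | _ j ih =>
      intro n m hn hm
      obtain ⟨n, rfl⟩ := Nat.exists_eq_succ_of_ne_zero (Nat.ne_zero_of_lt hn)
      obtain ⟨m, rfl⟩ := Nat.exists_eq_succ_of_ne_zero (Nat.ne_zero_of_lt hm)
      rw [Nat.succ_eq_add_one, Nat.succ_eq_add_one, hA, hA]
      exact hΦ j _ _ fun j' hj' => ih j' hj' n m (by omega) (by omega)
  let X : ι → PowerSeries R := fun i => PowerSeries.mk fun k => PowerSeries.coeff k (A (k + 1) i)
  have hX : ∀ i, X i = Φ X i := by
    intro i
    ext1 k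
    rw [PowerSeries.coeff_mk, hA]
    refine hΦ k _ _ (fun j hj i => ?_) i
    rw [PowerSeries.coeff_mk]
    exact stable j k (j + 1) hj (Nat.lt_succ_self j) i
  refine ⟨X, fun Y => ⟨fun hY => ?_, fun hY => hY ▸ hX⟩⟩
  have key : ∀ k i, PowerSeries.coeff k (Y i) = PowerSeries.coeff k (X i) := by
    intro k
    induction k using Nat.strong_induction_on with
    | _ k ih =>
      intro i
      rw [hY, hX]
      exact hΦ k _ _ ih i
  funext i
  ext1 k
  exact key k i

theorem PowerSeries.coeff_prod_congr {κ : Type*} {s : Finset κ} {f g : κ → PowerSeries R} {r : ℕ}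
    (h : ∀ e ∈ s, ∀ j ≤ r, PowerSeries.coeff j (f e) = PowerSeries.coeff j (g e)) :
    PowerSeries.coeff r (∏ e ∈ s, f e) = PowerSeries.coeff r (∏ e ∈ s, g e) := by
  classical
  rw [PowerSeries.coeff_prod, PowerSeries.coeff_prod]
  refine Finset.sum_congr rfl fun l hl => Finset.prod_congr rfl fun e he => h e he _ ?_
  rw [Finset.mem_finsuppAntidiag] at hl
  rw [← hl.1]
  exact Finset.single_le_sum (fun _ _ => Nat.zero_le _) he

end FixedPoint

/-! ### The Bergbauer–Kreimer equations as contractions -/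

namespace PolyEndo

variable {P : PolyEndo.{u, v}}

theorem coeff_bkSystemRHS (X : P.I → PowerSeries HCK) (i : P.I) (k : ℕ) :
    PowerSeries.coeff k (P.bkSystemRHS X i) = PowerSeries.coeff k 1 +
      ∑ᶠ β : PiZero (P.OpsOver i), (Nat.card (β.rep ⟶ β.rep) : ℚ)⁻¹ •
        (if P.arity β.rep.left - 1 ≤ k then
          Bplus (PowerSeries.coeff (k - (P.arity β.rep.left - 1))
            (∏ᶠ e : PiZero (P.Fib β.rep.left), X (P.s.obj e.rep.left))) else 0) := by
  rw [bkSystemRHS, map_add, PowerSeries.coeff_mk]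
  congr 1
  refine finsum_congr fun β => ?_
  rw [LinearMap.map_smul_of_tower, PowerSeries.coeff_X_pow_mul', BplusSeries,
    PowerSeries.coeff_mk, one_div, Nat.card_congr (autEquivEnd _)]

theorem isContraction_bkSystemRHS (hP : P.Finitary)
    (harity : ∀ b : P.B, P.arity b ≠ 0 ∧ P.arity b ≠ 1) : IsContraction P.bkSystemRHS := by
  intro k X Y h i
  rw [coeff_bkSystemRHS, coeff_bkSystemRHS]
  congr 1
  refine finsum_congr fun β => ?_
  congr 1
  have hβ := harity β.rep.left
  split_ifs with hk
  · congr 1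
    have := (hP β.rep.left).2
    have := Fintype.ofFinite (PiZero (P.Fib β.rep.left))
    rw [finprod_eq_prod_of_fintype, finprod_eq_prod_of_fintype]
    refine PowerSeries.coeff_prod_congr fun e _ j hj => h j ?_ _
    -- Arity at least `2` gives `j ≤ k - (arity - 1) < k`.
    omega
  · rfl

theorem coeff_bkRHS (w : ℕ → ℚ) (Y : PowerSeries HCK) (k : ℕ) :
    PowerSeries.coeff k (bkRHS w Y) = PowerSeries.coeff k 1 +
      ∑ n ∈ Finset.Icc 1 k, w n • Bplus (PowerSeries.coeff (k - n) (Y ^ (n + 1))) := by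
  rw [bkRHS, map_add, PowerSeries.coeff_mk]
  congr 1
  refine Finset.sum_congr rfl fun n hn => ?_
  rw [LinearMap.map_smul_of_tower, PowerSeries.coeff_X_pow_mul', BplusSeries,
    PowerSeries.coeff_mk, if_pos (Finset.mem_Icc.1 hn).2]

/-- Every term carries a factor `α^n` with `n ≥ 1`. The one-element index set makes the single
equation a system, so that the same fixed point theorem serves both. -/
theorem isContraction_bkRHS (w : ℕ → ℚ) :
    IsContraction fun (Y : PUnit.{1} → PowerSeries HCK) i => bkRHS w (Y i) := by
  intro k X Y h i
  simp only [coeff_bkRHS]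
  congr 1
  refine Finset.sum_congr rfl fun n hn => ?_
  rw [Finset.mem_Icc] at hn
  congr 2
  rw [← Finset.card_range (n + 1), ← Finset.prod_const, ← Finset.prod_const]
  exact PowerSeries.coeff_prod_congr fun _ _ j hj => h j (by omega) i

end PolyEndo

/-! ### Finiteness and cardinality of full subcategories -/

theorem IsFiniteOn.exists_lt {C : Type*} [Category* C] {S : ℕ → C → Prop} {k : ℕ}
    (h : ∀ j < k, IsFiniteOn (S j)) : IsFiniteOn fun x => ∃ j < k, S j x := by
  induction k with
  | zero => exact ⟨by simp, by simp⟩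
  | succ k ih =>
    refine ((ih fun j hj => h j (by omega)).or (h k (by omega))).mono ?_
    rintro x ⟨j, hj, hx⟩
    rcases Nat.lt_succ_iff_lt_or_eq.1 hj with h | rfl
    · exact Or.inl ⟨j, h, hx⟩
    · exact Or.inr hx

theorem fullSubcategory_hom_equiv {C : Type*} [Category* C] (Q : ObjectProperty C)
    (x y : Q.FullSubcategory) : Nonempty ((x ⟶ y) ≃ (x.obj ⟶ y.obj)) :=
  ⟨Q.fullyFaithfulι.homEquiv⟩

theorem isFiniteGroupoid_fullSubcategory_iff {C : Type*} [Category* C] [IsGroupoid C]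
    (Q : ObjectProperty C) : IsFiniteGroupoid Q.FullSubcategory ↔ IsFiniteOn Q := by
  rw [isFiniteGroupoid_iff]
  constructor
  · intro h
    exact IsFiniteOn.of_hom_equiv (fullSubcategory_hom_equiv Q)
      (fun y hy => ⟨⟨y, hy⟩, hy, ⟨𝟙 y⟩⟩) (h.mono fun _ _ => trivial)
  · intro h
    exact (h.comp_of_hom_equiv (fullSubcategory_hom_equiv Q)).mono fun x _ => x.property

theorem groupoidInt_fullSubcategory {C : Type*} [Category* C] [IsGroupoid C]
    {V : Type*} [AddCommGroup V] [Module ℚ V] (Q : ObjectProperty C) {w : C → V}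
    (hw : ArrowInvariant w) (hQ : ∀ x, w x ≠ 0 → Q x) :
    groupoidInt (fun x : Q.FullSubcategory => w x.obj) = groupoidInt w :=
  groupoidInt_comp (fullSubcategory_hom_equiv Q) hw fun y hy => ⟨⟨y, hQ y hy⟩, ⟨𝟙 y⟩⟩

theorem ArrowInvariant.ite {C : Type*} [Category* C] {V : Type*} {S : C → Prop}
    [DecidablePred S] (hS : ArrowInvariant S) {w w' : C → V} (hw : ArrowInvariant w)
    (hw' : ArrowInvariant w') : ArrowInvariant fun x => if S x then w x else w' x := by
  intro x y f
  simp only [hS f, hw f, hw' f]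

namespace PolyEndo

variable {P : PolyEndo.{u, v}}

namespace PTree

/-! ### The trivial tree over a colour -/

/-- The trivial tree over its colour. -/
def trivialOver (i : P.I) : P.TreesOver i := CostructuredArrow.mk (Y := trivialTree i) (𝟙 i)

/-- There is a single edge, and the triangle over `i` forces its colour arrow to be the identity.
Trees without nodes over `i` thus form a contractible groupoid, the source of the summand `1` in the
equations. -/
instance (i : P.I) : Subsingleton (trivialOver i ⟶ trivialOver i) := by
  constructor
  intro f g
  have hroot : ∀ f : trivialOver i ⟶ trivialOver i, Hom.colourHom f.left (Hom.map_root f.left) =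
      𝟙 i := fun f => (Category.comp_id _).symm.trans (TreesOver.colourHom_rootHom f)
  apply CostructuredArrow.hom_ext
  refine Hom.ext_of_forall (fun _ => rfl) (fun m => m.elim) (fun n => n.elim) ?_
    (fun m => m.elim) (fun n => n.elim)
  rintro ⟨⟩ ⟨⟩ h h'
  exact (hroot f).trans (hroot g).symm

theorem exists_trivialOver_hom {i : P.I} (T : P.TreesOver i) (h : ¬ T.left.tree.Rooted) :
    Nonempty (trivialOver i ⟶ T) := by
  refine ⟨CostructuredArrow.homMk (trivialTreeHom T.left h (inv T.rootHom)) ?_⟩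
  change ((inv T.rootHom ≫ 𝟙 _) ≫ 𝟙 _) ≫ T.rootHom = 𝟙 i
  simp

theorem trivialOver_hom_equiv (i : P.I) (x y : Discrete PUnit.{1}) :
    Nonempty ((x ⟶ y) ≃ (trivialOver i ⟶ trivialOver i)) :=
  ⟨{ toFun := fun _ => 𝟙 _
     invFun := fun _ => eqToHom (Subsingleton.elim _ _)
     left_inv := fun _ => Subsingleton.elim _ _
     right_inv := fun _ => Subsingleton.elim _ _ }⟩

theorem isFiniteOn_punit (S : Discrete PUnit.{1} → Prop) : IsFiniteOn S :=
  ⟨(Set.toFinite (Set.univ : Set (Discrete PUnit.{1}))).image PiZero.mk |>.subset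
    (Set.image_mono (Set.subset_univ _)), fun _ _ => inferInstance⟩

theorem groupoidInt_punit {V : Type*} [AddCommGroup V] [Module ℚ V]
    (w : Discrete PUnit.{1} → V) : groupoidInt w = w ⟨PUnit.unit⟩ := by
  have : Subsingleton (PiZero (Discrete PUnit.{1})) := by
    constructor
    intro a b
    rw [← a.mk_rep, ← b.mk_rep]
    exact congrArg _ (Subsingleton.elim _ _)
  have hw : ∀ z : PiZero (Discrete PUnit.{1}), autWeight w z.rep = w ⟨PUnit.unit⟩ := by
    intro z
    have : Unique (z.rep ⟶ z.rep) := ⟨⟨𝟙 _⟩, fun _ => Subsingleton.elim _ _⟩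
    rw [autWeight, Nat.card_unique, Subsingleton.elim z.rep ⟨PUnit.unit⟩]
    simp
  have : Unique (PiZero (Discrete PUnit.{1})) :=
    ⟨⟨PiZero.mk ⟨PUnit.unit⟩⟩, fun _ => Subsingleton.elim _ _⟩
  rw [groupoidInt, finsum_unique, hw]

/-! ### The recursion over the root operation -/

/-- The core monomial of the trees with a given number of leaves, and zero otherwise. -/
def leafWeight {i : P.I} (l : ℕ) (T : P.TreesOver i) : HCK :=
  if T.left.tree.numLeaves = l then coreMonomial T.left.tree else 0

theorem over_numLeaves_invariant (i : P.I) :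
    ArrowInvariant fun T : P.TreesOver i => T.left.tree.numLeaves :=
  fun _ _ f => numLeaves_invariant f.left

theorem numLeaves_eq_invariant (i : P.I) (l : ℕ) :
    ArrowInvariant fun T : P.TreesOver i => T.left.tree.numLeaves = l :=
  fun _ _ f => congrArg (· = l) (numLeaves_invariant f.left)

theorem leafWeight_invariant (i : P.I) (l : ℕ) :
    ArrowInvariant (leafWeight (P := P) (i := i) l) :=
  (numLeaves_eq_invariant i l).ite (fun _ _ f => coreMonomial_invariant f.left) fun _ _ _ => rfl

theorem numLeaves_of_leafWeight_ne {i : P.I} {l : ℕ} {T : P.TreesOver i}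
    (h : leafWeight l T ≠ 0) : T.left.tree.numLeaves = l := by
  by_contra h0
  exact h (if_neg h0)

section Root

variable {i : P.I} {β : P.OpsOver i} {ι : Type} [Fintype ι] {e : ι → P.Fib β.left}

theorem graftOver_hom_equiv (he : Function.Bijective fun k => PiZero.mk (e k))
    (hP : P.Finitary) (T U : ∀ k, P.TreesOver (P.s.obj (e k).left)) :
    Nonempty ((T ⟶ U) ≃ (graftOver he T ⟶ graftOver he U)) :=
  ⟨Equiv.ofBijective _ (graftOverMap_bijective he T U hP)⟩

theorem graftOver_numLeaves (he : Function.Bijective fun k => PiZero.mk (e k))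
    (T : ∀ k, P.TreesOver (P.s.obj (e k).left)) :
    (graftOver he T).left.obj.left.tree.numLeaves = ∑ k, (T k).left.tree.numLeaves :=
  OpTree.numLeaves_graft _

/-- Each input carries a subtree with at least one leaf. This bounds the arity of a root operation
by the number of leaves. -/
theorem card_le_numLeaves (he : Function.Bijective fun k => PiZero.mk (e k))
    (harity : ∀ b : P.B, P.arity b ≠ 0)
    (y : CostructuredArrow (rootOp i) β) :
    Fintype.card ι ≤ y.left.obj.left.tree.numLeaves := by
  obtain ⟨T, ⟨f⟩⟩ := exists_graftOver_hom he y
  have h : (graftOver he T).left.obj.left.tree.numLeaves = y.left.obj.left.tree.numLeaves :=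
    numLeaves_invariant f.left.hom.left
  rw [← h, graftOver_numLeaves, ← Finset.card_univ, Finset.card_eq_sum_ones]
  exact Finset.sum_le_sum fun k _ => numLeaves_pos harity _

variable {k : ℕ}

/-- The fibre is a product of at least two groupoids of trees. As each factor uses up a leaf, no
subtree has more than `k` leaves, and the inductive hypothesis covers them all. -/
theorem isFiniteOn_rootFibre (he : Function.Bijective fun k => PiZero.mk (e k))
    (hP : P.Finitary) (harity : ∀ b : P.B, P.arity b ≠ 0)
    (hcard : 2 ≤ Fintype.card ι)
    (ih : ∀ j < k, ∀ i : P.I, IsFiniteOn fun T : P.TreesOver i => T.left.tree.numLeaves = j + 1) :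
    IsFiniteOn fun y : CostructuredArrow (rootOp i) β =>
      y.left.obj.left.tree.numLeaves = k + 1 := by
  have hS : ∀ q, IsFiniteOn fun T : P.TreesOver (P.s.obj (e q).left) =>
      ∃ j < k, T.left.tree.numLeaves = j + 1 :=
    fun q => IsFiniteOn.exists_lt fun j hj => ih j hj _
  refine IsFiniteOn.of_hom_equiv (φ := graftOver he) (graftOver_hom_equiv he hP) ?_
    ((isFiniteOn_pi hS).mono ?_)
  · intro y hy
    obtain ⟨T, ⟨f⟩⟩ := exists_graftOver_hom he y
    refine ⟨T, ?_, ⟨f⟩⟩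
    rw [← hy]
    exact numLeaves_invariant f.left.hom.left
  · intro T hT q
    rw [graftOver_numLeaves] at hT
    have hpos : ∀ q, 0 < (T q).left.tree.numLeaves := fun q => numLeaves_pos harity _
    -- A second input `q'` takes at least one of the `k + 1` leaves away from `q`.
    obtain ⟨q', hq'⟩ := Fintype.exists_ne_of_one_lt_card (by omega) q
    have h1 : (T q).left.tree.numLeaves + (T q').left.tree.numLeaves ≤ k + 1 := by
      rw [← hT]
      classical
      rw [← Finset.sum_pair hq'.symm (f := fun q => (T q).left.tree.numLeaves)]
      exact Finset.sum_le_sum_of_subset (Finset.subset_univ _)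
    have := hpos q
    have := hpos q'
    exact ⟨(T q).left.tree.numLeaves - 1, by omega, by omega⟩

/-- Trees with `j + 1` leaves belong to `α^j`, so a distribution of `k + 1` leaves over the inputs
is a family of exponents with sum `r = k + 1 - |ι|`. For given numbers of leaves at most one such
family contributes. -/
theorem ite_sum_eq_sum_antidiag {R : Type*} [CommSemiring R] [DecidableEq ι] (l : ι → ℕ)
    (hl : ∀ q, 0 < l q) (c : ι → R) {r k : ℕ} (hr : r + Fintype.card ι = k + 1) :
    (if ∑ q, l q = k + 1 then ∏ q, c q else 0) =
      ∑ s ∈ Finset.finsuppAntidiag Finset.univ r, ∏ q, if l q = s q + 1 then c q else 0 := by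
  have h1 : ∀ s : ι →₀ ℕ, (∏ q, if l q = s q + 1 then c q else 0) =
      if ∀ q, l q = s q + 1 then ∏ q, c q else 0 := by
    intro s
    rw [Finset.prod_ite_zero]
    simp
  simp only [h1]
  have hsum : ∀ s : ι →₀ ℕ, (∀ q, l q = s q + 1) →
      ∑ q, l q = ∑ q, s q + Fintype.card ι := by
    intro s hs
    simp only [hs, Finset.sum_add_distrib, Finset.sum_const, smul_eq_mul, mul_one,
      Finset.card_univ]
  split_ifs with h
  · let s₀ : ι →₀ ℕ := Finsupp.equivFunOnFinite.symm fun q => l q - 1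
    have hs₀ : ∀ q, l q = s₀ q + 1 := fun q => (Nat.succ_pred_eq_of_pos (hl q)).symm
    rw [Finset.sum_eq_single s₀, if_pos hs₀]
    · intro s _ hs
      refine if_neg fun h2 => hs (Finsupp.ext fun q => ?_)
      have := h2 q
      have := hs₀ q
      omega
    · intro hs
      refine absurd (Finset.mem_finsuppAntidiag.2 ⟨?_, fun q _ => Finset.mem_univ q⟩) hs
      exact Nat.add_right_cancel ((hsum s₀ hs₀).symm.trans (h.trans hr.symm))
  · refine (Finset.sum_eq_zero fun s hs => if_neg fun h2 => h ?_).symm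
    rw [hsum s h2, (Finset.mem_finsuppAntidiag.1 hs).1, hr]

/-- Through grafting the integral becomes one over a product. `B₊` comes out by linearity, the
leaves are distributed over the inputs, and multiplicativity with the inductive hypothesis produces
a coefficient of the product of the `X`. -/
theorem groupoidInt_rootFibre (he : Function.Bijective fun k => PiZero.mk (e k))
    (hP : P.Finitary) (harity : ∀ b : P.B, P.arity b ≠ 0)
    (hcard : 2 ≤ Fintype.card ι) {X : P.I → PowerSeries HCK}
    (ih : ∀ j < k, ∀ i : P.I, IsFiniteOn fun T : P.TreesOver i => T.left.tree.numLeaves = j + 1)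
    (ihX : ∀ j < k, ∀ i : P.I, PowerSeries.coeff j (X i) =
      groupoidInt (leafWeight (P := P) (i := i) (j + 1))) :
    groupoidInt (fun y : CostructuredArrow (rootOp i) β => leafWeight (k + 1) y.left.obj) =
      if Fintype.card ι - 1 ≤ k then
        Bplus (PowerSeries.coeff (k - (Fintype.card ι - 1)) (∏ q, X (P.s.obj (e q).left)))
      else 0 := by
  classical
  have hw : ArrowInvariant fun y : CostructuredArrow (rootOp i) β =>
      leafWeight (k + 1) y.left.obj :=
    fun _ _ f => leafWeight_invariant i (k + 1) f.left.hom
  rw [← groupoidInt_comp (graftOver_hom_equiv he hP) hw fun y _ => exists_graftOver_hom he y]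
  have h1 : ∀ T, leafWeight (k + 1) (graftOver he T).left.obj =
      Bplus (if ∑ q, (T q).left.tree.numLeaves = k + 1 then
        ∏ q, coreMonomial (T q).left.tree else 0) := by
    intro T
    rw [leafWeight, graftOver_numLeaves]
    split_ifs
    · exact (Bplus_prod_coreMonomial fun q => (T q).left.tree).symm
    · rw [map_zero]
  have hpos : ∀ (T : ∀ q, P.TreesOver (P.s.obj (e q).left)) q, 0 < (T q).left.tree.numLeaves :=
    fun T q => numLeaves_pos harity _
  simp only [h1]
  split_ifs with hk
  · have hr : k - (Fintype.card ι - 1) + Fintype.card ι = k + 1 := by omega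
    have hS : ∀ q, IsFiniteOn fun T : P.TreesOver (P.s.obj (e q).left) =>
        ∃ j < k, T.left.tree.numLeaves = j + 1 :=
      fun q => IsFiniteOn.exists_lt fun j hj => ih j hj _
    have hSpi := isFiniteOn_pi hS
    have h2 : ∀ T : ∀ q, P.TreesOver (P.s.obj (e q).left),
        (if ∑ q, (T q).left.tree.numLeaves = k + 1 then
        ∏ q, coreMonomial (T q).left.tree else 0) =
        ∑ s ∈ Finset.finsuppAntidiag Finset.univ (k - (Fintype.card ι - 1)),
          ∏ q, leafWeight (s q + 1) (T q) := fun T =>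
      ite_sum_eq_sum_antidiag _ (hpos T) _ hr
    simp only [h2]
    have hs : ∀ s ∈ Finset.finsuppAntidiag Finset.univ (k - (Fintype.card ι - 1)), ∀ q : ι,
        s q < k := by
      intro s hs q
      have h3 : ∑ q, s q = k - (Fintype.card ι - 1) := (Finset.mem_finsuppAntidiag.1 hs).1
      have h4 : s q ≤ ∑ q, s q := Finset.single_le_sum (fun _ _ => Nat.zero_le _)
        (Finset.mem_univ q)
      omega
    have hsupp : ∀ s ∈ Finset.finsuppAntidiag Finset.univ (k - (Fintype.card ι - 1)),
        ∀ T : ∀ q, P.TreesOver (P.s.obj (e q).left), ∏ q, leafWeight (s q + 1) (T q) ≠ 0 →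
        ∀ q, ∃ j < k, (T q).left.tree.numLeaves = j + 1 := by
      intro s hs' T hT q
      exact ⟨s q, hs s hs' q, numLeaves_of_leafWeight_ne
        (Finset.prod_ne_zero_iff.1 hT q (Finset.mem_univ q))⟩
    rw [groupoidInt_map Bplus hSpi, groupoidInt_sum _ hSpi hsupp, PowerSeries.coeff_prod]
    · congr 1
      refine Finset.sum_congr rfl fun s hs' => ?_
      rw [groupoidInt_pi (w := fun q => leafWeight (s q + 1))
        (fun q => ih (s q) (hs s hs' q) _) (fun q T h => numLeaves_of_leafWeight_ne h)
        fun q => leafWeight_invariant _ _]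
      exact Finset.prod_congr rfl fun q _ => (ihX (s q) (hs s hs' q) _).symm
    · intro T hT
      obtain ⟨s, hs', h3⟩ := Finset.exists_ne_zero_of_sum_ne_zero hT
      exact hsupp s hs' T h3
  -- With more than `k + 1` inputs there are too many leaves, so the integrand vanishes.
  · have h2 : ∀ T : ∀ q, P.TreesOver (P.s.obj (e q).left),
        ¬ ∑ q, (T q).left.tree.numLeaves = k + 1 := by
      intro T h
      have h3 : Fintype.card ι ≤ ∑ q, (T q).left.tree.numLeaves := by
        rw [← Finset.card_univ, Finset.card_eq_sum_ones]
        exact Finset.sum_le_sum fun q _ => hpos T q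
      omega
    simp [h2, groupoidInt, autWeight]

end Root

/-- An enumeration of the inputs of an operation by representatives. -/
theorem exists_inputs (hP : P.Finitary) (b : P.B) :
    ∃ e : Fin (P.arity b) → P.Fib b, (∃ ε : Fin (P.arity b) ≃ PiZero (P.Fib b),
      ∀ k, e k = (ε k).rep) ∧ Function.Bijective fun k => PiZero.mk (e k) := by
  have := (hP b).2
  let ε : Fin (P.arity b) ≃ PiZero (P.Fib b) := (Finite.equivFin _).symm
  refine ⟨fun k => (ε k).rep, ⟨ε, fun _ => rfl⟩, ?_⟩
  simp only [PiZero.mk_rep]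
  exact ε.bijective

theorem isFiniteOn_arity_eq (hfin : ∀ (i : P.I) (n : ℕ), IsFiniteGroupoid (P.OpsOverArity i n))
    (i : P.I) (n : ℕ) : IsFiniteOn fun β : P.OpsOver i => P.arity β.left = n :=
  (isFiniteGroupoid_fullSubcategory_iff _).1 (hfin i n)

theorem finite_opsOver_end (hfin : ∀ (i : P.I) (n : ℕ), IsFiniteGroupoid (P.OpsOverArity i n))
    {i : P.I} (β : P.OpsOver i) : Finite (β ⟶ β) :=
  (isFiniteOn_arity_eq hfin i _).2 β rfl

/-- Root operations of trees with `l` leaves have arity at most `l`, and each of these finitely many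
arities has finitely many classes of operations. -/
theorem finite_root_classes (hP : P.Finitary) (harity : ∀ b : P.B, P.arity b ≠ 0)
    (hfin : ∀ (i : P.I) (n : ℕ), IsFiniteGroupoid (P.OpsOverArity i n)) (i : P.I) (l : ℕ) :
    (PiZero.mk '' {β : P.OpsOver i | ∃ T : RootedOver i, T.obj.left.tree.numLeaves = l ∧
      Nonempty ((rootOp i).obj T ⟶ β)}).Finite := by
  have h : IsFiniteOn fun β : P.OpsOver i => ∃ j < l + 1, P.arity β.left = j :=
    IsFiniteOn.exists_lt fun j _ => isFiniteOn_arity_eq hfin i j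
  refine h.1.subset (Set.image_mono ?_)
  rintro β ⟨T, rfl, ⟨f⟩⟩
  obtain ⟨e, -, he⟩ := exists_inputs hP β.left
  have := card_le_numLeaves he harity (CostructuredArrow.mk f)
  rw [Fintype.card_fin] at this
  exact ⟨_, Nat.lt_succ_of_le this, rfl⟩

/-- Finiteness and value go through the induction together, since the formulas for integrals over
products and fibrations need the finiteness in lower degrees. -/
theorem coeff_eq_groupoidInt (hP : P.Finitary)
    (harity : ∀ b : P.B, P.arity b ≠ 0 ∧ P.arity b ≠ 1)
    (hfin : ∀ (i : P.I) (n : ℕ), IsFiniteGroupoid (P.OpsOverArity i n))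
    {X : P.I → PowerSeries HCK} (hX : ∀ i, X i = P.bkSystemRHS X i) (k : ℕ) (i : P.I) :
    IsFiniteOn (fun T : P.TreesOver i => T.left.tree.numLeaves = k + 1) ∧
      PowerSeries.coeff k (X i) = groupoidInt (leafWeight (P := P) (i := i) (k + 1)) := by
  classical
  induction k using Nat.strong_induction_on generalizing i with
  | _ k ih =>
    have harity0 : ∀ b : P.B, P.arity b ≠ 0 := fun b => (harity b).1
    have hfib : ∀ z : PiZero (P.OpsOver i), IsFiniteOn
        fun y : CostructuredArrow (rootOp i) z.rep => y.left.obj.left.tree.numLeaves = k + 1 := by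
      intro z
      obtain ⟨e, -, he⟩ := exists_inputs hP z.rep.left
      refine isFiniteOn_rootFibre he hP harity0 ?_ fun j hj i => (ih j hj i).1
      rw [Fintype.card_fin]
      have := harity z.rep.left
      omega
    have hbase := finite_root_classes hP harity0 hfin i (k + 1)
    have hrooted : IsFiniteOn fun T : RootedOver i => T.obj.left.tree.numLeaves = k + 1 :=
      IsFiniteOn.of_fibration (F := rootOp i) (finite_opsOver_end hfin) hbase hfib
    have hR : IsFiniteOn fun T : P.TreesOver i =>
        T.left.tree.Rooted ∧ T.left.tree.numLeaves = k + 1 :=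
      IsFiniteOn.of_hom_equiv (fullSubcategory_hom_equiv _)
        (fun T hT => ⟨⟨T, hT.1⟩, hT, ⟨𝟙 T⟩⟩) (hrooted.mono fun T hT => hT.2)
    have hN : IsFiniteOn fun T : P.TreesOver i =>
        ¬ T.left.tree.Rooted ∧ T.left.tree.numLeaves = k + 1 :=
      IsFiniteOn.of_hom_equiv (trivialOver_hom_equiv i) (fun T hT => ⟨⟨PUnit.unit⟩,
        ⟨trivialTree_not_rooted i, hT.2 ▸
          over_numLeaves_invariant i (exists_trivialOver_hom T hT.1).some⟩,
        exists_trivialOver_hom T hT.1⟩) (isFiniteOn_punit _)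
    have hall : IsFiniteOn fun T : P.TreesOver i => T.left.tree.numLeaves = k + 1 := by
      refine (hR.or hN).mono fun T hT => ?_
      by_cases h : T.left.tree.Rooted
      · exact Or.inl ⟨h, hT⟩
      · exact Or.inr ⟨h, hT⟩
    refine ⟨hall, ?_⟩
    -- The weight is split into the part on trees with a root node, handled by the fibration over
    -- root operations, and the part on trees without nodes.
    let wR : P.TreesOver i → HCK := fun T => if T.left.tree.Rooted then leafWeight (k + 1) T else 0
    let wN : P.TreesOver i → HCK := fun T => if T.left.tree.Rooted then 0 else leafWeight (k + 1) T
    have hrInv : ArrowInvariant fun T : P.TreesOver i => T.left.tree.Rooted :=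
      fun _ _ f => rooted_invariant f.left
    have hwR : ArrowInvariant wR :=
      hrInv.ite (leafWeight_invariant i (k + 1)) fun _ _ _ => rfl
    have hwN : ArrowInvariant wN :=
      hrInv.ite (fun _ _ _ => rfl) (leafWeight_invariant i (k + 1))
    have hsR : ∀ T, wR T ≠ 0 → T.left.tree.Rooted ∧ leafWeight (k + 1) T ≠ 0 := by
      intro T hT
      by_cases h : T.left.tree.Rooted
      · exact ⟨h, by simpa [wR, h] using hT⟩
      · exact absurd (if_neg h) hT
    have hsN : ∀ T, wN T ≠ 0 → ¬ T.left.tree.Rooted ∧ leafWeight (k + 1) T ≠ 0 := by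
      intro T hT
      by_cases h : T.left.tree.Rooted
      · exact absurd (if_pos h) hT
      · exact ⟨h, by simpa [wN, h] using hT⟩
    have hsum : leafWeight (P := P) (i := i) (k + 1) = fun T => wN T + wR T := by
      funext T
      by_cases h : T.left.tree.Rooted <;> simp [wR, wN, h]
    -- A tree without nodes has exactly one leaf, so this part is `1` for `k = 0` and `0` otherwise.
    have hIN : groupoidInt wN = PowerSeries.coeff k 1 := by
      rw [← groupoidInt_comp (trivialOver_hom_equiv i) hwN
        fun T hT => ⟨⟨PUnit.unit⟩, exists_trivialOver_hom T (hsN T hT).1⟩, groupoidInt_punit]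
      have h1 : ¬ (trivialOver i).left.tree.Rooted := trivialTree_not_rooted i
      simp only [wN, if_neg h1, leafWeight, OpTree.numLeaves_of_not_rooted h1,
        coreMonomial_of_not_rooted h1, PowerSeries.coeff_one]
      refine if_congr ?_ rfl rfl
      omega
    have hIR : groupoidInt wR = ∑ᶠ z : PiZero (P.OpsOver i),
        (Nat.card (z.rep ⟶ z.rep) : ℚ)⁻¹ • groupoidInt
          (fun y : CostructuredArrow (rootOp i) z.rep => leafWeight (k + 1) y.left.obj) := by
      rw [← groupoidInt_fullSubcategory (fun T : P.TreesOver i => T.left.tree.Rooted) hwR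
        fun T hT => (hsR T hT).1]
      have h1 : ∀ T : RootedOver i, wR T.obj = leafWeight (k + 1) T.obj := fun T =>
        if_pos T.property
      simp only [h1]
      exact groupoidInt_fibration (F := rootOp i) (finite_opsOver_end hfin)
        (fun _ _ f => numLeaves_eq_invariant i (k + 1) f.hom) hbase hfib
        (fun _ _ f => leafWeight_invariant i (k + 1) f.hom)
        fun T hT => numLeaves_of_leafWeight_ne hT
    rw [hsum, groupoidInt_add hall (fun T hT => numLeaves_of_leafWeight_ne (hsN T hT).2)
      fun T hT => numLeaves_of_leafWeight_ne (hsR T hT).2, hIN, hIR, hX, coeff_bkSystemRHS]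
    congr 1
    refine finsum_congr fun z => ?_
    congr 1
    obtain ⟨e, ⟨ε, hε⟩, he⟩ := exists_inputs hP z.rep.left
    have hcard : 2 ≤ Fintype.card (Fin (P.arity z.rep.left)) := by
      rw [Fintype.card_fin]
      have := harity z.rep.left
      omega
    rw [groupoidInt_rootFibre he hP harity0 hcard (fun j hj i => (ih j hj i).1)
      fun j hj i => (ih j hj i).2, Fintype.card_fin, ← finprod_eq_prod_of_fintype]
    -- `X` depends on the colour object itself, not only on its isomorphism class; hence the
    -- enumeration of inputs has to use the same representatives as `bkSystemRHS`.
    have hprod : ∏ᶠ q, X (P.s.obj (e q).left) =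
        ∏ᶠ c : PiZero (P.Fib z.rep.left), X (P.s.obj c.rep.left) :=
      finprod_eq_of_bijective ε ε.bijective fun q => by rw [hε]
    rw [hprod]

/-- The coefficient of a tree, as a linear functional. -/
def treeCoeffLinear (τ : CombTree) : HCK →ₗ[ℚ] ℚ :=
  MvPolynomial.lcoeff ℚ (Finsupp.single τ.cls 1)

theorem over_hasCore_invariant (i : P.I) (l : ℕ) (τ : CombTree) :
    ArrowInvariant fun T : P.TreesOver i => T.left.tree.numLeaves = l ∧ HasCore T.left.tree τ :=
  fun _ _ f => congrArg₂ And (numLeaves_eq_invariant i l f) (hasCore_invariant τ f.left)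

open Classical in
theorem treeCoeff_leafWeight {i : P.I} (l : ℕ) (τ : CombTree) (T : P.TreesOver i) :
    treeCoeffLinear τ (leafWeight l T) =
      if T.left.tree.numLeaves = l ∧ HasCore T.left.tree τ then 1 else 0 := by
  rw [leafWeight]
  split_ifs with h1 h2 h2
  · exact (treeCoeff_coreMonomial _ _).trans (if_pos h2.2)
  · exact (treeCoeff_coreMonomial _ _).trans (if_neg fun h => h2 ⟨h1, h⟩)
  · exact absurd h2.1 h1
  · exact map_zero _

/-- The coefficient of `τ` is linear and takes a core monomial to the indicator of having core `τ`,
so integrating it counts exactly the trees in question. -/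
theorem treesOverWith_card {i : P.I} {k : ℕ} {c : HCK} (τ : CombTree)
    (hf : IsFiniteOn (fun T : P.TreesOver i => T.left.tree.numLeaves = k + 1))
    (hc : c = groupoidInt (leafWeight (P := P) (i := i) (k + 1))) :
    IsFiniteGroupoid (P.TreesOverWith i (k + 1) τ) ∧
      treeCoeff τ c = groupoidCard (P.TreesOverWith i (k + 1) τ) := by
  classical
  refine ⟨(isFiniteGroupoid_fullSubcategory_iff _).2 (hf.mono fun T hT => hT.1), ?_⟩
  have h1 : treeCoeff τ c = groupoidInt fun T : P.TreesOver i =>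
      treeCoeffLinear τ (leafWeight (k + 1) T) := by
    rw [groupoidInt_map _ hf fun T hT => numLeaves_of_leafWeight_ne hT, ← hc]
    rfl
  simp only [treeCoeff_leafWeight] at h1
  rw [h1, groupoidCard_eq_groupoidInt, ← groupoidInt_fullSubcategory
    (fun T : P.TreesOver i => T.left.tree.numLeaves = k + 1 ∧ HasCore T.left.tree τ)
    ((over_hasCore_invariant i (k + 1) τ).ite (fun _ _ _ => rfl) fun _ _ _ => rfl)
    fun T hT => by_contra fun h => hT (if_neg h)]
  congr 1
  funext T
  exact if_pos T.property

end PTree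

end PolyEndo

/-! ## The one-variable case -/

section Contractible

universe u₁ v₁ u₂ v₂

variable {C : Type u₁} [Category.{v₁} C] {D : Type u₂} [Category.{v₂} D]

variable (D) in
/-- There is exactly one arrow between any two objects. -/
def UniqueHoms : Prop := ∀ x y : D, Nonempty (x ⟶ y) ∧ Subsingleton (x ⟶ y)

theorem uniqueHoms_of_equivalence (E : D ≌ Discrete PUnit.{1}) : UniqueHoms D := by
  intro x y
  have e : (x ⟶ y) ≃ (E.functor.obj x ⟶ E.functor.obj y) :=
    (Functor.FullyFaithful.ofFullyFaithful E.functor).homEquiv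
  exact ⟨⟨e.symm (eqToHom (Subsingleton.elim _ _))⟩, e.subsingleton⟩

variable {F : C ⥤ D} (d : D)

/-- Over a base with unique arrows every triangle commutes, so a homotopy fibre has the same
morphisms as the total groupoid; `UniqueHoms.exists_costructuredArrow` says that it also has all the
objects. -/
theorem UniqueHoms.costructuredArrow_hom_equiv (hD : UniqueHoms D)
    (x y : CostructuredArrow F d) : Nonempty ((x ⟶ y) ≃ (x.left ⟶ y.left)) :=
  ⟨{ toFun := fun f => f.left
     invFun := fun f => CostructuredArrow.homMk f ((hD _ _).2.elim _ _)
     left_inv := fun _ => CostructuredArrow.hom_ext _ _ rfl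
     right_inv := fun _ => rfl }⟩

theorem UniqueHoms.exists_costructuredArrow (hD : UniqueHoms D) (x : C) :
    ∃ y : CostructuredArrow F d, y.left = x :=
  ⟨CostructuredArrow.mk (hD (F.obj x) d).1.some, rfl⟩

variable [IsGroupoid C]

theorem UniqueHoms.isFiniteOn_iff (hD : UniqueHoms D) {S : C → Prop} :
    IsFiniteOn (fun y : CostructuredArrow F d => S y.left) ↔ IsFiniteOn S := by
  refine ⟨fun h => IsFiniteOn.of_hom_equiv (φ := fun y : CostructuredArrow F d => y.left)
    (hD.costructuredArrow_hom_equiv d) (fun x hx => ?_) h, fun h =>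
    h.comp_of_hom_equiv (φ := fun y : CostructuredArrow F d => y.left)
      (hD.costructuredArrow_hom_equiv d)⟩
  obtain ⟨y, rfl⟩ := hD.exists_costructuredArrow (F := F) d x
  exact ⟨y, hx, ⟨𝟙 _⟩⟩

theorem UniqueHoms.groupoidInt_eq (hD : UniqueHoms D) {V : Type*} [AddCommGroup V] [Module ℚ V]
    {w : C → V} (hw : ArrowInvariant w) :
    groupoidInt (fun y : CostructuredArrow F d => w y.left) = groupoidInt w := by
  refine groupoidInt_comp (φ := fun y : CostructuredArrow F d => y.left)
    (hD.costructuredArrow_hom_equiv d) hw fun x _ => ?_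
  obtain ⟨y, rfl⟩ := hD.exists_costructuredArrow (F := F) d x
  exact ⟨y, ⟨𝟙 _⟩⟩

end Contractible

theorem groupoidCard_fullSubcategory {C : Type*} [Category* C] [IsGroupoid C]
    {Q : ObjectProperty C} [DecidablePred Q] (hQ : ArrowInvariant Q) :
    groupoidCard Q.FullSubcategory = groupoidInt fun x => if Q x then (1 : ℚ) else 0 := by
  rw [groupoidCard_eq_groupoidInt, ← groupoidInt_fullSubcategory Q
    (hQ.ite (fun _ _ _ => rfl) fun _ _ _ => rfl) fun T hT => by_contra fun h => hT (if_neg h)]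
  congr 1
  funext x
  exact (if_pos x.property).symm

namespace PolyEndo

variable {P : PolyEndo.{u, v}}

theorem arity_invariant : ArrowInvariant P.arity := by
  intro b b' f
  refine Nat.card_congr (Equiv.ofBijective
    (fun z => PiZero.mk (CostructuredArrow.mk (z.rep.hom ≫ f))) ⟨?_, ?_⟩)
  · intro z z' h
    obtain ⟨g⟩ := PiZero.mk_eq_iff.1 h
    have hg : P.p.map g.left ≫ z'.rep.hom ≫ f = z.rep.hom ≫ f := CostructuredArrow.w g
    rw [← z.mk_rep, ← z'.mk_rep]
    refine PiZero.mk_eq_iff.2 ⟨CostructuredArrow.homMk g.left ?_⟩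
    rw [← cancel_mono f, Category.assoc]
    exact hg
  · intro z
    obtain ⟨g⟩ := PiZero.rep_hom (CostructuredArrow.mk (z.rep.hom ≫ inv f))
    have hg : P.p.map g.left ≫ z.rep.hom ≫ inv f = _ := CostructuredArrow.w g
    refine ⟨PiZero.mk (CostructuredArrow.mk (z.rep.hom ≫ inv f)), ?_⟩
    refine Eq.trans ?_ z.mk_rep
    refine PiZero.mk_eq_iff.2 ⟨CostructuredArrow.homMk g.left ?_⟩
    change P.p.map g.left ≫ z.rep.hom = _ ≫ f
    rw [← hg]
    simp

theorem arity_eq_invariant (n : ℕ) : ArrowInvariant fun b : P.B => P.arity b = n :=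
  fun _ _ f => congrArg (· = n) (arity_invariant f)

section OneVariable

theorem isFiniteGroupoid_opsArity (hI : UniqueHoms P.I)
    (hfin : ∀ (i : P.I) (n : ℕ), IsFiniteGroupoid (P.OpsOverArity i n)) (i : P.I) (n : ℕ) :
    IsFiniteGroupoid (P.OpsArity n) :=
  (isFiniteGroupoid_fullSubcategory_iff _).2
    ((hI.isFiniteOn_iff i).1 (PTree.isFiniteOn_arity_eq hfin i n))

/-- For a constant family the product over the inputs is a power of `Y` depending only on the arity.
Grouping the operations by arity collects the factors `1 / |Aut β|` into the cardinalities `w_n`. -/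
theorem bkSystemRHS_const (hI : UniqueHoms P.I) (hP : P.Finitary)
    (harity : ∀ b : P.B, P.arity b ≠ 0 ∧ P.arity b ≠ 1)
    (hfin : ∀ (i : P.I) (n : ℕ), IsFiniteGroupoid (P.OpsOverArity i n))
    (Y : PowerSeries HCK) (i : P.I) :
    P.bkSystemRHS (fun _ => Y) i = bkRHS (fun n => groupoidCard (P.OpsArity (n + 1))) Y := by
  classical
  ext1 k
  rw [coeff_bkSystemRHS, coeff_bkRHS]
  congr 1
  let g : ℕ → HCK := fun n => Bplus (PowerSeries.coeff (k - n) (Y ^ (n + 1)))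
  -- Writing the summand as a linear map applied to an indicator lets `groupoidInt_map` extract the
  -- fixed element `g n`.
  let w : ℕ → P.OpsOver i → HCK := fun n β =>
    LinearMap.toSpanSingleton ℚ HCK (g n) (if P.arity β.left = n + 1 then 1 else 0)
  have h1 : ∀ β : P.OpsOver i, (if P.arity β.left - 1 ≤ k then
      Bplus (PowerSeries.coeff (k - (P.arity β.left - 1)) (∏ᶠ _ : PiZero (P.Fib β.left), Y))
      else 0) = ∑ n ∈ Finset.Icc 1 k, w n β := by
    intro β
    have := (hP β.left).2
    have := Fintype.ofFinite (PiZero (P.Fib β.left))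
    have hβ := harity β.left
    have hpow : ∏ᶠ _ : PiZero (P.Fib β.left), Y = Y ^ (P.arity β.left - 1 + 1) := by
      rw [finprod_eq_prod_of_fintype, Finset.prod_const, Finset.card_univ,
        ← Nat.card_eq_fintype_card]
      congr 1
      change P.arity β.left = _
      omega
    rw [hpow]
    split_ifs with hk
    -- Only `n = arity - 1` survives, and it lies in the range because the arity is at least `2`.
    · rw [Finset.sum_eq_single (P.arity β.left - 1)]
      · have h2 : P.arity β.left = P.arity β.left - 1 + 1 := by omega
        simp only [w, if_pos h2, LinearMap.toSpanSingleton_apply, one_smul, g]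
      · intro n _ hn
        have h2 : ¬ P.arity β.left = n + 1 := by omega
        simp only [w, if_neg h2, map_zero]
      · intro h
        exact absurd (Finset.mem_Icc.2 ⟨by omega, hk⟩) h
    · refine (Finset.sum_eq_zero fun n hn => ?_).symm
      rw [Finset.mem_Icc] at hn
      have h2 : ¬ P.arity β.left = n + 1 := by omega
      simp only [w, if_neg h2, map_zero]
  have hS : IsFiniteOn fun β : P.OpsOver i => ∃ j < k + 2, P.arity β.left = j :=
    IsFiniteOn.exists_lt fun j _ => PTree.isFiniteOn_arity_eq hfin i j
  have h3 : ∀ n, groupoidInt (w n) = groupoidCard (P.OpsArity (n + 1)) • g n := by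
    intro n
    rw [groupoidCard_fullSubcategory (arity_eq_invariant (n + 1)), ← hI.groupoidInt_eq
      (F := P.t) (w := fun b => if P.arity b = n + 1 then (1 : ℚ) else 0) i
      ((arity_eq_invariant (n + 1)).ite (fun _ _ _ => rfl) fun _ _ _ => rfl)]
    refine (groupoidInt_map (LinearMap.toSpanSingleton ℚ HCK (g n))
      (PTree.isFiniteOn_arity_eq hfin i (n + 1)) fun β hβ => ?_).trans ?_
    · exact by_contra fun h => hβ (if_neg h)
    · rw [LinearMap.toSpanSingleton_apply]
  have h4 : groupoidInt (fun β : P.OpsOver i => ∑ n ∈ Finset.Icc 1 k, w n β) =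
      ∑ n ∈ Finset.Icc 1 k, groupoidInt (w n) := by
    refine groupoidInt_sum _ hS fun n hn β hβ => ⟨n + 1, ?_, ?_⟩
    · have := (Finset.mem_Icc.1 hn).2
      omega
    · by_contra h
      exact hβ (by simp only [w, if_neg h, map_zero])
  rw [Finset.sum_congr rfl fun n _ => (h3 n).symm, ← h4]
  exact finsum_congr fun z => congrArg _ (h1 z.rep)

theorem treesWith_iff_treesOverWith (hI : UniqueHoms P.I) (i : P.I) (l : ℕ) (τ : CombTree) :
    (IsFiniteGroupoid (P.TreesWith l τ) ↔ IsFiniteGroupoid (P.TreesOverWith i l τ)) ∧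
      groupoidCard (P.TreesWith l τ) = groupoidCard (P.TreesOverWith i l τ) := by
  classical
  have hinv : ArrowInvariant fun T : PTree P => T.tree.numLeaves = l ∧ PTree.HasCore T.tree τ :=
    fun _ _ f => congrArg₂ And (congrArg (· = l) (PTree.numLeaves_invariant f))
      (PTree.hasCore_invariant τ f)
  constructor
  · rw [isFiniteGroupoid_fullSubcategory_iff, isFiniteGroupoid_fullSubcategory_iff]
    exact (hI.isFiniteOn_iff i).symm
  · rw [groupoidCard_fullSubcategory hinv,
      groupoidCard_fullSubcategory (PTree.over_hasCore_invariant i l τ)]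
    exact (hI.groupoidInt_eq i (w := fun T : PTree P =>
      if T.tree.numLeaves = l ∧ PTree.HasCore T.tree τ then (1 : ℚ) else 0) (hinv.ite (fun _ _ _ => rfl) fun _ _ _ => rfl)).symm

end OneVariable

end PolyEndo

end

/-! ### The system and the one-variable equation -/

theorem mainTheorem2 (P : PolyEndo.{u, v}) (hP : P.Finitary)
    (harity : ∀ b : P.B, P.arity b ≠ 0 ∧ P.arity b ≠ 1)
    (hfin : ∀ (i : P.I) (n : ℕ), IsFiniteGroupoid (P.OpsOverArity i n)) :
    (∃ X : P.I → PowerSeries HCK,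
      (∀ Y : P.I → PowerSeries HCK, (∀ i, Y i = P.bkSystemRHS Y i) ↔ Y = X) ∧
      ∀ (i : P.I) (k : ℕ) (τ : CombTree),
        IsFiniteGroupoid (P.TreesOverWith i (k + 1) τ) ∧
        treeCoeff τ (PowerSeries.coeff k (X i)) =
          groupoidCard (P.TreesOverWith i (k + 1) τ)) ∧
    (Nonempty (P.I ≌ Discrete PUnit.{1}) →
      (∀ n, IsFiniteGroupoid (P.OpsArity n)) ∧
      ∃ X : PowerSeries HCK,
        (∀ Y : PowerSeries HCK,
          Y = bkRHS (fun n => groupoidCard (P.OpsArity (n + 1))) Y ↔ Y = X) ∧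
        ∀ (k : ℕ) (τ : CombTree),
          IsFiniteGroupoid (P.TreesWith (k + 1) τ) ∧
          treeCoeff τ (PowerSeries.coeff k X) = groupoidCard (P.TreesWith (k + 1) τ)) := by
  have hmain : ∀ X : P.I → PowerSeries HCK, (∀ i, X i = P.bkSystemRHS X i) →
      ∀ (i : P.I) (k : ℕ) (τ : CombTree), IsFiniteGroupoid (P.TreesOverWith i (k + 1) τ) ∧
        treeCoeff τ (PowerSeries.coeff k (X i)) =
          groupoidCard (P.TreesOverWith i (k + 1) τ) := by
    intro X hX i k τ
    obtain ⟨h1, h2⟩ := PolyEndo.PTree.coeff_eq_groupoidInt hP harity hfin hX k i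
    exact PolyEndo.PTree.treesOverWith_card τ h1 h2
  constructor
  · obtain ⟨X, hX⟩ := (PolyEndo.isContraction_bkSystemRHS hP harity).exists_unique_fixed
    exact ⟨X, hX, hmain X ((hX X).2 rfl)⟩
  · rintro ⟨E⟩
    have hI := uniqueHoms_of_equivalence E
    let i₀ : P.I := E.inverse.obj ⟨PUnit.unit⟩
    refine ⟨PolyEndo.isFiniteGroupoid_opsArity hI hfin i₀, ?_⟩
    obtain ⟨X, hX⟩ := (PolyEndo.isContraction_bkRHS
      fun n => groupoidCard (P.OpsArity (n + 1))).exists_unique_fixed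
    have hX' : ∀ Y : PowerSeries HCK,
        Y = bkRHS (fun n => groupoidCard (P.OpsArity (n + 1))) Y ↔ Y = X PUnit.unit := by
      intro Y
      refine ⟨fun h => congrFun ((hX fun _ => Y).1 fun _ => h) PUnit.unit, fun h => ?_⟩
      rw [h]
      exact (hX X).2 rfl PUnit.unit
    refine ⟨X PUnit.unit, hX', fun k τ => ?_⟩
    -- The constant family of the one-variable solution solves the system, so the first part
    -- computes its coefficients at the colour `i₀`.
    obtain ⟨h1, h2⟩ := hmain (fun _ => X PUnit.unit) (fun i => by
      rw [PolyEndo.bkSystemRHS_const hI hP harity hfin]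
      exact (hX' _).2 rfl) i₀ k τ
    obtain ⟨h3, h4⟩ := PolyEndo.treesWith_iff_treesOverWith hI i₀ (k + 1) τ
    exact ⟨h3.2 h1, h2.trans h4.symm⟩
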